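/- Let $Q$ be a smooth (finite-dimensional, Hausdorff, second countable) manifold and $\tau:V\to Q$ a smooth real vector bundle of finite rank. Let $TQ\oplus V$ be a Lagrange--Poincaré bundle ($\mathfrak{LP}$-bundle): $V$ carries a smooth fibrewise Lie bracket $[\cdot,\cdot]$, a $V$-valued 2-form $\omega$ on $Q$ and a linear connection $\nabla$, such that $$[X_1\oplus w_1,X_2\oplus w_2]=[X_1,X_2]\oplus\big(\nabla_{X_1}w_2-\nabla_{X_2}w_1-\omega(X_1,X_2)+[w_1,w_2]\big)$$ is a Lie bracket on $\Gamma(TQ\oplus V)$. Write $D/dt$ for covariant derivatives along curves (on $V$ and $V^*$ with respect to $\nabla$). Let $L:TQ\oplus V\to\mathbb R$ be smooth and $t_0<t_1$. For a smooth curve $v(t)$ in $V$ with base curve $q=\tau\circ v$ put $S(L)(\dot q\oplus v)=\int_{t_0}^{t_1}L(\dot q(t),v(t))\,dt$. An allowed variation of $\dot q\oplus v$ is one induced by a smooth deformation $v_\lambda(t)$ of $v=v_0$ whose base curves $q_\lambda=\tau\circ v_\lambda$ have fixed endpoints, and for which there is a smooth curve $w(t)$ in $V$ over $q(t)$ with $w(t_0)=0$,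 $w(t_1)=0$ and, with $\delta q=\partial_\lambda q_\lambda|_{\lambda=0}$ and $\delta v=\frac{D v_\lambda}{d\lambda}\big|_{\lambda=0}$, $$\delta v=\frac{Dw}{dt}+[v,w]+\omega_q(\delta q,\dot q)\qquad\text{on }[t_0,t_1].$$ Let $T^{(2)}Q$ be the bundle of 2-jets of curves in $Q$ and $2V=V\oplus V$, where the 1-jet $[v]^{(1)}$ of a curve $v$ is represented by $v\oplus\frac{Dv}{dt}$. Then there is a unique smooth bundle map over the identity of $Q$, $$\mathcal{LP}(L):T^{(2)}Q\oplus 2V\to T^*Q\oplus V^*,$$ such that for all smooth curves $v$ in $V$ over $q$ (with arbitrary endpoints) and all allowed variations, given by deformations $v_\lambda$ and curves $w$ as above, $$\frac{d}{d\lambda}\Big|_{\lambda=0}S(L)(\dot q_\lambda\oplus v_\lambda)=\int_{t_0}^{t_1}\mathcal{LP}(L)\big([q]^{(2)}\oplus[v]^{(1)}\big)\cdot(\delta q\oplus w)\,dt .$$ Its components $\mathrm{Hor}(\mathcal{LP})(L)$, with values in $T^*Q$, and $\mathrm{Ver}(\mathcal{LP})(L)$, with values in $V^*$, are given, along every smooth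 curve $v$ in $V$ over $q$, by $$\mathrm{Hor}(\mathcal{LP})(L)\big([q]^{(2)}\oplus[v]^{(1)}\big)=\frac{\partial L}{\partial q}-\frac{D}{dt}\frac{\partial L}{\partial\dot q}-\Big\langle\frac{\partial L}{\partial v},\omega_q(\dot q,\cdot)\Big\rangle,$$ $$\mathrm{Ver}(\mathcal{LP})(L)\big([q]^{(2)}\oplus[v]^{(1)}\big)=\mathrm{ad}^*_v\frac{\partial L}{\partial v}-\frac{D}{dt}\frac{\partial L}{\partial v}.$$ Here $\partial L/\partial\dot q$ and $\partial L/\partial v$ are the fibre derivatives of $L$, $\langle\mathrm{ad}^*_v\mu,w\rangle=\langle\mu,[v,w]\rangle$, and the horizontal derivative $\partial L/\partial q$ and the derivative $\frac{D}{dt}$ on $T^*Q$ are taken with respect to any torsion-free smooth linear connection on $TQ$, together with $\nabla$ on $V$. -/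

import Mathlib

open Bundle Set
open scoped Manifold ContDiff Topology

noncomputable section

/-! ### The second order tangent bundle -/

section SecondOrderTangentBundle

/-- The action of (the 2-jet at `y` of) a map `f` on 2-jets of curves through `y`: if a curve `c`
satisfies `c = y`, `c' = a`, `c'' = b` at some time, then `f ∘ c` has first derivative `f' a` and
second derivative `f'' (a, a) + f' b` at that time. -/
def jetTransform {E : Type*} [NormedAddCommGroup E] [NormedSpace ℝ E]
    (f : E → E) (y : E) (p : E × E) : E × E :=
  (fderiv ℝ f y p.1, fderiv ℝ (fderiv ℝ f) y p.1 p.1 + fderiv ℝ f y p.2)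

variable {E : Type*} [NormedAddCommGroup E] [NormedSpace ℝ E]

theorem jetTransform_id {f : E → E} {y : E} (h : f =ᶠ[𝓝 y] id) (p : E × E) :
    jetTransform f y p = p := by
  have h1 : fderiv ℝ f =ᶠ[𝓝 y] fun _ => ContinuousLinearMap.id ℝ E :=
    h.fderiv.trans (Filter.Eventually.of_forall fun z => fderiv_id)
  have h2 : fderiv ℝ (fderiv ℝ f) y = 0 := by
    rw [h1.fderiv_eq]; simp
  simp [jetTransform, h1.eq_of_nhds, h2]

theorem jetTransform_comp {f g k : E → E} {y : E} (hf : ContDiffAt ℝ 2 f y)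
    (hg : ContDiffAt ℝ 2 g (f y)) (h : g ∘ f =ᶠ[𝓝 y] k) (p : E × E) :
    jetTransform g (f y) (jetTransform f y p) = jetTransform k y p := by
  have hfd : ∀ᶠ z in 𝓝 y, DifferentiableAt ℝ f z :=
    (hf.eventually (by simp)).mono fun z hz => hz.differentiableAt (by simp)
  have hgd : ∀ᶠ z in 𝓝 y, DifferentiableAt ℝ g (f z) :=
    hf.continuousAt.eventually
      ((hg.eventually (by simp)).mono fun z hz => hz.differentiableAt (by simp))
  have h1 : fderiv ℝ k =ᶠ[𝓝 y] fun z => (fderiv ℝ g (f z)).comp (fderiv ℝ f z) := by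
    refine h.symm.fderiv.trans ?_
    filter_upwards [hfd, hgd] with z hz hz'
    exact fderiv_comp z hz' hz
  have hf2 : DifferentiableAt ℝ (fderiv ℝ f) y :=
    (hf.fderiv_right (m := 1) (by norm_num)).differentiableAt (by simp)
  have hg2 : DifferentiableAt ℝ (fderiv ℝ g) (f y) :=
    (hg.fderiv_right (m := 1) (by norm_num)).differentiableAt (by simp)
  have h3 : HasFDerivAt (fun z => fderiv ℝ g (f z))
      ((fderiv ℝ (fderiv ℝ g) (f y)).comp (fderiv ℝ f y)) y :=
    hg2.hasFDerivAt.comp y hfd.self_of_nhds.hasFDerivAt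
  have h2 := (h3.clm_comp hf2.hasFDerivAt).fderiv
  simp only [jetTransform, h1.eq_of_nhds, h1.fderiv_eq, h2]
  simp [add_comm, add_left_comm]

variable (E) (Q : Type*) [TopologicalSpace Q] [ChartedSpace E Q] [IsManifold 𝓘(ℝ, E) ∞ Q]

theorem contDiffOn_transition (i j : atlas E Q) :
    ContDiffOn ℝ ∞ (j.1 ∘ i.1.symm) (i.1.symm.trans j.1).source := by
  have := (𝓘(ℝ, E)).contDiffOn_extendCoordChange (n := ∞)
    (IsManifold.subset_maximalAtlas (I := 𝓘(ℝ, E)) (n := ∞) i.2)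
    (IsManifold.subset_maximalAtlas (I := 𝓘(ℝ, E)) (n := ∞) j.2)
  simpa [ModelWithCorners.extendCoordChange] using this

set_option linter.unusedSectionVars false in
theorem mem_transition_source {i j : atlas E Q} {x : Q} (hi : x ∈ i.1.source)
    (hj : x ∈ j.1.source) : i.1 x ∈ (i.1.symm.trans j.1).source := by
  simp [hi, hj]

theorem contDiffAt_transition {i j : atlas E Q} {x : Q} (hi : x ∈ i.1.source)
    (hj : x ∈ j.1.source) : ContDiffAt ℝ 2 (j.1 ∘ i.1.symm) (i.1 x) :=
  (((contDiffOn_transition E Q i j).contDiffAt ((i.1.symm.trans j.1).open_source.mem_nhds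
    (mem_transition_source E Q hi hj))).of_le ENat.LEInfty.out)

/-- The second order tangent bundle `T⁽²⁾Q = J²(ℝ, Q)`, the bundle of 2-jets of curves in `Q`, as a
fibre bundle over `Q`. In a chart `φ` a 2-jet of a curve `c` at `t` is represented by the pair
`((φ ∘ c)' t, (φ ∘ c)'' t)`, and these representations transform under a change of charts by the
second order chain rule. -/
def jetBundleCore : FiberBundleCore (atlas E Q) Q (E × E) where
  baseSet i := i.1.source
  isOpen_baseSet i := i.1.open_source
  indexAt := achart E
  mem_baseSet_at := mem_chart_source E
  coordChange i j x := jetTransform (j.1 ∘ i.1.symm) (i.1 x)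
  coordChange_self i x hx v := by
    refine jetTransform_id ?_ v
    filter_upwards [i.1.open_target.mem_nhds (i.1.map_source hx)] with y hy
    simp [hy]
  continuousOn_coordChange i j := by
    have hopen := (i.1.symm.trans j.1).open_source
    have h0 := contDiffOn_transition E Q i j
    have h1 : ContDiffOn ℝ ∞ (fderiv ℝ (j.1 ∘ i.1.symm)) (i.1.symm.trans j.1).source :=
      h0.fderiv_of_isOpen hopen (by simp)
    have h2 : ContDiffOn ℝ ∞ (fderiv ℝ (fderiv ℝ (j.1 ∘ i.1.symm)))
        (i.1.symm.trans j.1).source := h1.fderiv_of_isOpen hopen (by simp)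
    have hφ : ContinuousOn (fun p : Q × (E × E) => i.1 p.1)
        ((i.1.source ∩ j.1.source) ×ˢ univ) :=
      i.1.continuousOn.comp continuousOn_fst fun p hp => hp.1.1
    have hm : MapsTo (fun p : Q × (E × E) => i.1 p.1) ((i.1.source ∩ j.1.source) ×ˢ univ)
        (i.1.symm.trans j.1).source := fun p hp =>
      mem_transition_source E Q hp.1.1 hp.1.2
    have c1 := h1.continuousOn.comp hφ hm
    have c2 := h2.continuousOn.comp hφ hm
    have ca : ContinuousOn (fun p : Q × (E × E) => p.2.1)
        ((i.1.source ∩ j.1.source) ×ˢ univ) := by fun_prop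
    have cb : ContinuousOn (fun p : Q × (E × E) => p.2.2)
        ((i.1.source ∩ j.1.source) ×ˢ univ) := by fun_prop
    exact (c1.clm_apply ca).prodMk (((c2.clm_apply ca).clm_apply ca).add (c1.clm_apply cb))
  coordChange_comp i j k x hx v := by
    obtain ⟨⟨hi, hj⟩, hk⟩ := hx
    have hfx : (j.1 ∘ i.1.symm) (i.1 x) = j.1 x := by simp [hi]
    have := jetTransform_comp (p := v) (f := j.1 ∘ i.1.symm) (g := k.1 ∘ j.1.symm)
      (k := k.1 ∘ i.1.symm) (y := i.1 x) (contDiffAt_transition E Q hi hj)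
      (by rw [hfx]; exact contDiffAt_transition E Q hj hk) ?_
    · rwa [hfx] at this
    · filter_upwards [(i.1.symm.trans j.1).open_source.mem_nhds
        (mem_transition_source E Q hi hj)] with y hy
      have hy' : i.1.symm y ∈ j.1.source := by simpa using hy.2
      simp [hy']

/-- The fibre of `T⁽²⁾Q` at `q`. -/
abbrev JetSpace (q : Q) : Type _ := (jetBundleCore E Q).Fiber q

/-- The 2-jet with vanishing derivatives in the preferred chart. It has no invariant meaning and only
serves as the default value required by the constructions on local trivializations. -/
instance JetSpace.instZero (q : Q) : Zero (JetSpace E Q q) := ⟨((0, 0) : E × E)⟩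

variable {Q}

/-- The 2-jet `[q]⁽²⁾(t)` of a curve `q`, represented in the preferred chart at `q t`. -/
def jetTwo (q : ℝ → Q) (t : ℝ) : JetSpace E Q (q t) :=
  ((deriv (fun s => chartAt E (q t) (q s)) t,
    deriv (deriv (fun s => chartAt E (q t) (q s))) t) : E × E)

/-- The velocity `q̇(t)`; the curve `q̇` is the natural lift of `q` to `TQ`. -/
def velocity (q : ℝ → Q) (t : ℝ) : TangentSpace 𝓘(ℝ, E) (q t) :=
  mfderiv 𝓘(ℝ, ℝ) 𝓘(ℝ, E) q t (1 : ℝ)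

end SecondOrderTangentBundle

/-! ### Connections: derivatives along curves and horizontal derivatives -/

section Connections

variable {E : Type*} [NormedAddCommGroup E] [NormedSpace ℝ E]
  {F : Type*} [NormedAddCommGroup F] [NormedSpace ℝ F]
  {Q : Type*} [TopologicalSpace Q] [ChartedSpace E Q] [IsManifold 𝓘(ℝ, E) ∞ Q]
  {V : Q → Type*} [TopologicalSpace (TotalSpace F V)]
  [∀ x, AddCommGroup (V x)] [∀ x, Module ℝ (V x)] [∀ x, TopologicalSpace (V x)]
  [∀ x, IsTopologicalAddGroup (V x)] [∀ x, ContinuousSMul ℝ (V x)]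
  [FiberBundle F V] [VectorBundle ℝ F V]

/-- The covariant derivative `Dv/dt` of a curve `v` in `V`, which is a curve in `V` over the same
base curve. In the local frame `(eᵢ)` of a trivialization, `v = ∑ vⁱ eᵢ` and
`Dv/dt = ∑ (dvⁱ/dt) eᵢ + ∑ vⁱ ∇_{q̇} eᵢ`; `FiberBundle.extend F` extends a vector to the local
section with constant components. -/
def covDerivAlong (nabla : CovariantDerivative 𝓘(ℝ, E) F V) (v : ℝ → TotalSpace F V) (t : ℝ) :
    V (v t).proj :=
  (trivializationAt F V (v t).proj).symm (v t).proj
      (deriv (fun s => (trivializationAt F V (v t).proj (v s)).2) t) +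
    nabla (FiberBundle.extend F (v t).2) (v t).proj (velocity E (fun s => (v s).proj) t)

/-- The covariant derivative on the dual bundle along `q`: for a curve `α` of covectors over `q`,
`⟨Dα/dt, Y⟩ = d/dt ⟨α, s(q)⟩ - ⟨α, ∇_{q̇} s⟩` for a local section `s` with value `Y` at `q t`. -/
def dualCovDerivAlong (nabla : CovariantDerivative 𝓘(ℝ, E) F V) (q : ℝ → Q)
    (α : ∀ t, V (q t) →L[ℝ] ℝ) (t : ℝ) (Y : V (q t)) : ℝ :=
  deriv (fun s => α s (FiberBundle.extend F Y (q s))) t -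
    α t (nabla (FiberBundle.extend F Y) (q t) (velocity E q t))

/-- The total space of `TQ ⊕ V`. -/
abbrev TangentSum (E F : Type*) [NormedAddCommGroup E] [NormedSpace ℝ E]
    {Q : Type*} [TopologicalSpace Q] [ChartedSpace E Q] (V : Q → Type*) : Type _ :=
  TotalSpace (E × F) (fun x : Q => TangentSpace 𝓘(ℝ, E) x × V x)

/-- The curve `q̇ ⊕ v` in `TQ ⊕ V` determined by a curve `v` in `V`, where `q = τ ∘ v`. -/
def liftCurve (v : ℝ → TotalSpace F V) (t : ℝ) : TangentSum E F V :=
  ⟨(v t).proj, velocity E (fun s => (v s).proj) t, (v t).2⟩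

/-- The fibre derivative `∂L/∂q̇` at `u ⊕ v`. -/
def fiberDerivVel (L : TangentSum E F V → ℝ) (p : TangentSum E F V) :
    TangentSpace 𝓘(ℝ, E) p.proj →L[ℝ] ℝ :=
  fderiv ℝ (fun u : TangentSpace 𝓘(ℝ, E) p.proj => L ⟨p.proj, u, p.2.2⟩) p.2.1

/-- The fibre derivative `∂L/∂v` at `u ⊕ v`. -/
def fiberDerivVert (L : TangentSum E F V → ℝ) (p : TangentSum E F V) : V p.proj →L[ℝ] ℝ :=
  fderiv ℝ (fun v : V p.proj => L ⟨p.proj, p.2.1, v⟩) p.2.2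

/-- The horizontal derivative `∂L/∂q` at `u ⊕ v` with respect to connections on `TQ` and on `V`: the
derivative of `L` along the horizontal lift of a tangent vector `X`. For local sections `s₁`, `s₂`
through `u`, `v` this is `d(L(s₁ ⊕ s₂))(X) - ⟨∂L/∂q̇, ∇_X s₁⟩ - ⟨∂L/∂v, ∇_X s₂⟩`. -/
def horizontalDeriv (nablaQ : CovariantDerivative 𝓘(ℝ, E) E (fun x : Q => TangentSpace 𝓘(ℝ, E) x))
    (nabla : CovariantDerivative 𝓘(ℝ, E) F V) (L : TangentSum E F V → ℝ)
    (p : TangentSum E F V) : TangentSpace 𝓘(ℝ, E) p.proj →L[ℝ] ℝ :=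
  mvfderiv 𝓘(ℝ, E)
      (fun x => L ⟨x, FiberBundle.extend E p.2.1 x, FiberBundle.extend F p.2.2 x⟩) p.proj -
    (fiberDerivVel L p).comp (nablaQ (FiberBundle.extend E p.2.1) p.proj) -
    (fiberDerivVert L p).comp (nabla (FiberBundle.extend F p.2.2) p.proj)

end Connections

/-! ### Lagrange–Poincaré bundles -/

section LagrangePoincare

/-- The structure of a Lagrange–Poincaré bundle on `TQ ⊕ V → Q`: a smooth fibrewise Lie bracket on
`V`, a `V`-valued 2-form `ω` on `Q` and a linear connection `∇` on `V` such that
`[X₁ ⊕ w₁, X₂ ⊕ w₂] = [X₁, X₂] ⊕ (∇_{X₁} w₂ - ∇_{X₂} w₁ - ω(X₁, X₂) + [w₁, w₂])`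
is a Lie bracket on the smooth sections of `TQ ⊕ V`. -/
structure LPBundle (E F : Type*) [NormedAddCommGroup E] [NormedSpace ℝ E]
    [NormedAddCommGroup F] [NormedSpace ℝ F]
    {Q : Type*} [TopologicalSpace Q] [ChartedSpace E Q] [IsManifold 𝓘(ℝ, E) ∞ Q]
    (V : Q → Type*) [TopologicalSpace (TotalSpace F V)]
    [∀ x, AddCommGroup (V x)] [∀ x, Module ℝ (V x)] [∀ x, TopologicalSpace (V x)]
    [∀ x, IsTopologicalAddGroup (V x)] [∀ x, ContinuousSMul ℝ (V x)]
    [FiberBundle F V] [VectorBundle ℝ F V] where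
  /-- The Lie bracket on the fibres of `V`. -/
  bracket : ∀ x, V x →ₗ[ℝ] V x →ₗ[ℝ] V x
  bracket_self : ∀ x (v : V x), bracket x v v = 0
  bracket_jacobi : ∀ x (u v w : V x), bracket x u (bracket x v w) +
    bracket x v (bracket x w u) + bracket x w (bracket x u v) = 0
  bracket_smooth : ∀ (s₁ s₂ : ∀ x, V x) (x : Q),
    ContMDiffAt 𝓘(ℝ, E) (𝓘(ℝ, E).prod 𝓘(ℝ, F)) ∞ (fun y => TotalSpace.mk' F y (s₁ y)) x →
    ContMDiffAt 𝓘(ℝ, E) (𝓘(ℝ, E).prod 𝓘(ℝ, F)) ∞ (fun y => TotalSpace.mk' F y (s₂ y)) x →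
    ContMDiffAt 𝓘(ℝ, E) (𝓘(ℝ, E).prod 𝓘(ℝ, F)) ∞
      (fun y => TotalSpace.mk' F y (bracket y (s₁ y) (s₂ y))) x
  /-- The `V`-valued 2-form on `Q`. -/
  twoForm : ∀ x : Q, TangentSpace 𝓘(ℝ, E) x →ₗ[ℝ] TangentSpace 𝓘(ℝ, E) x →ₗ[ℝ] V x
  twoForm_self : ∀ x (X : TangentSpace 𝓘(ℝ, E) x), twoForm x X X = 0
  twoForm_smooth : ∀ (X Y : ∀ x : Q, TangentSpace 𝓘(ℝ, E) x) (x : Q),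
    ContMDiffAt 𝓘(ℝ, E) (𝓘(ℝ, E).prod 𝓘(ℝ, E)) ∞ (fun y => TotalSpace.mk' E y (X y)) x →
    ContMDiffAt 𝓘(ℝ, E) (𝓘(ℝ, E).prod 𝓘(ℝ, E)) ∞ (fun y => TotalSpace.mk' E y (Y y)) x →
    ContMDiffAt 𝓘(ℝ, E) (𝓘(ℝ, E).prod 𝓘(ℝ, F)) ∞
      (fun y => TotalSpace.mk' F y (twoForm y (X y) (Y y))) x
  /-- The connection on `V`. -/
  nabla : CovariantDerivative 𝓘(ℝ, E) F V
  nabla_smooth : CovariantDerivative.ContMDiffCovariantDerivative nabla ∞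
  /-- The bracket on smooth sections of `TQ ⊕ V` satisfies the Jacobi identity (it is bilinear and
  alternating because the bracket of vector fields, the fibre bracket and `ω` are). -/
  section_jacobi :
    letI br : (∀ x : Q, TangentSpace 𝓘(ℝ, E) x) × (∀ x, V x) →
        (∀ x : Q, TangentSpace 𝓘(ℝ, E) x) × (∀ x, V x) →
        (∀ x : Q, TangentSpace 𝓘(ℝ, E) x) × (∀ x, V x) := fun s₁ s₂ =>
      (VectorField.mlieBracket 𝓘(ℝ, E) s₁.1 s₂.1, fun x =>
        nabla s₂.2 x (s₁.1 x) - nabla s₁.2 x (s₂.1 x) - twoForm x (s₁.1 x) (s₂.1 x) +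
          bracket x (s₁.2 x) (s₂.2 x))
    letI Smooth : (∀ x : Q, TangentSpace 𝓘(ℝ, E) x) × (∀ x, V x) → Prop := fun s =>
      ContMDiff 𝓘(ℝ, E) (𝓘(ℝ, E).prod 𝓘(ℝ, E)) ∞ (fun y => TotalSpace.mk' E y (s.1 y)) ∧
      ContMDiff 𝓘(ℝ, E) (𝓘(ℝ, E).prod 𝓘(ℝ, F)) ∞ (fun y => TotalSpace.mk' F y (s.2 y))
    ∀ s₁ s₂ s₃, Smooth s₁ → Smooth s₂ → Smooth s₃ →
      br s₁ (br s₂ s₃) + br s₂ (br s₃ s₁) + br s₃ (br s₁ s₂) = 0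

variable {E : Type*} [NormedAddCommGroup E] [NormedSpace ℝ E]
  {F : Type*} [NormedAddCommGroup F] [NormedSpace ℝ F]
  {Q : Type*} [TopologicalSpace Q] [ChartedSpace E Q] [IsManifold 𝓘(ℝ, E) ∞ Q]
  {V : Q → Type*} [TopologicalSpace (TotalSpace F V)]
  [∀ x, AddCommGroup (V x)] [∀ x, Module ℝ (V x)] [∀ x, TopologicalSpace (V x)]
  [∀ x, IsTopologicalAddGroup (V x)] [∀ x, ContinuousSMul ℝ (V x)]
  [FiberBundle F V] [VectorBundle ℝ F V]

variable (E F V) in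
/-- A bundle map `T⁽²⁾Q ⊕ 2V → T*Q ⊕ V*` over the identity of `Q`: a family of maps of the fibres
that is smooth as a map of total spaces. -/
structure SecondOrderBundleMap where
  toFun : ∀ q : Q, JetSpace E Q q × (V q × V q) →
    (TangentSpace 𝓘(ℝ, E) q →L[ℝ] ℝ) × (V q →L[ℝ] ℝ)
  smooth : ContMDiff (𝓘(ℝ, E).prod 𝓘(ℝ, (E × E) × (F × F)))
    (𝓘(ℝ, E).prod 𝓘(ℝ, (E →L[ℝ] ℝ) × (F →L[ℝ] ℝ))) ∞
    (fun p : TotalSpace ((E × E) × (F × F)) (fun q : Q => JetSpace E Q q × (V q × V q)) =>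
      (⟨p.proj, toFun p.proj p.2⟩ : TotalSpace ((E →L[ℝ] ℝ) × (F →L[ℝ] ℝ))
        (fun q : Q => (TangentSpace 𝓘(ℝ, E) q →L[ℝ] ℝ) × (V q →L[ℝ] ℝ))))

/-- The value of a bundle map at `[q]⁽²⁾ ⊕ [v]⁽¹⁾` at time `t`, for a curve `v` in `V` over `q`; the
1-jet `[v]⁽¹⁾` is the element `v ⊕ Dv/dt` of `2V`. -/
def SecondOrderBundleMap.atCurve (A : SecondOrderBundleMap E F V)
    (nabla : CovariantDerivative 𝓘(ℝ, E) F V) (v : ℝ → TotalSpace F V) (t : ℝ) :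
    (TangentSpace 𝓘(ℝ, E) (v t).proj →L[ℝ] ℝ) × (V (v t).proj →L[ℝ] ℝ) :=
  A.toFun (v t).proj
    (jetTwo E (fun s => (v s).proj) t, ((v t).2, covDerivAlong nabla v t))

/-- The action `S(L)(q̇ ⊕ v) = ∫ L(q̇, v) dt`. -/
def action (L : TangentSum E F V → ℝ) (t₀ t₁ : ℝ) (v : ℝ → TotalSpace F V) : ℝ :=
  ∫ t in t₀..t₁, L (liftCurve v t)

/-- `v lam t` is a smooth deformation, through curves whose base curves have fixed endpoints, of the
curve `v 0`, and the induced variation `δq̇ ⊕ δv` is the allowed one given by `δq` and by the curve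
`w` in `V` over `q` with zero endpoints: `δv = Dw/dt + [v, w] + ω(δq, q̇)`. -/
structure IsAllowedDeformation (P : LPBundle E F V) (t₀ t₁ : ℝ)
    (v : ℝ → ℝ → TotalSpace F V) (w : ∀ t, V (v 0 t).proj) : Prop where
  smooth : ContMDiff 𝓘(ℝ, ℝ × ℝ) (𝓘(ℝ, E).prod 𝓘(ℝ, F)) ∞ (fun p : ℝ × ℝ => v p.1 p.2)
  left_fixed : ∀ lam, (v lam t₀).proj = (v 0 t₀).proj
  right_fixed : ∀ lam, (v lam t₁).proj = (v 0 t₁).proj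
  smooth_w : ContMDiff 𝓘(ℝ, ℝ) (𝓘(ℝ, E).prod 𝓘(ℝ, F)) ∞
    (fun t => TotalSpace.mk' F (v 0 t).proj (w t))
  w_left : w t₀ = 0
  w_right : w t₁ = 0
  variation : ∀ t ∈ Icc t₀ t₁, covDerivAlong P.nabla (fun lam => v lam t) 0 =
    covDerivAlong P.nabla (fun s => TotalSpace.mk' F (v 0 s).proj (w s)) t +
      P.bracket (v 0 t).proj (v 0 t).2 (w t) +
      P.twoForm (v 0 t).proj (velocity E (fun lam => (v lam t).proj) 0)
        (velocity E (fun s => (v 0 s).proj) t)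

/-- The bundle map `A` represents the first variation of the action of `L` over the allowed
variations: for every allowed deformation, the derivative of the action at `lam = 0` is
`∫ A([q]⁽²⁾ ⊕ [v]⁽¹⁾) · (δq ⊕ w) dt`. -/
def RepresentsFirstVariation (P : LPBundle E F V) (L : TangentSum E F V → ℝ) (t₀ t₁ : ℝ)
    (A : SecondOrderBundleMap E F V) : Prop :=
  ∀ (v : ℝ → ℝ → TotalSpace F V) (w : ∀ t, V (v 0 t).proj),
    IsAllowedDeformation P t₀ t₁ v w →
    HasDerivAt (fun lam => action L t₀ t₁ (v lam))
      (∫ t in t₀..t₁,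
        ((A.atCurve P.nabla (v 0) t).1 (velocity E (fun lam => (v lam t).proj) 0) +
          (A.atCurve P.nabla (v 0) t).2 (w t))) 0

end LagrangePoincare

end

/-!
The proof rests on a pointwise first variation formula. For a smooth family `v lam t` of curves and
a curve `w` over the base curve of `v 0`, the boundary term `G = ⟨∂L/∂q̇, δq⟩ + ⟨∂L/∂v, w⟩`
satisfies
`dG/dt = δL - ⟨Hor, δq⟩ - ⟨Ver, w⟩ - ⟨∂L/∂v, c⟩`,
where `c = δv - Dw/dt - [v, w] - ω(δq, q̇)` is the failure of the variation to be the allowed one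
given by `w`, and `Hor`, `Ver` are expressions in the 2-jet of the base curve and the 1-jet of `v`.
In a chart and a trivialization of `V` this is the chain rule, the equality of mixed derivatives and
the antisymmetry of `ω` (`CoordLP.hasDerivAt_boundary`, `hasDerivAt_boundaryTerm`).

*Existence.* The formula holds for all families, without any constraint, and every term in it other
than `Hor` and `Ver` is intrinsic. Every jet and every pair of vectors `δq`, `w` at its base point
are realized by a family of curves (`exists_chart_family`), so the coordinate expressions `Hor`,
`Ver` do not depend on the coordinates (`localLP_eq`) and patch to a smooth bundle map
`lagrangePoincareMap`. For an allowed deformation `c = 0` on `[t₀, t₁]` and `G` vanishes at the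
endpoints, and integration gives the representation of the first variation
(`lagrangePoincareMap_representsFirstVariation`).

*Uniqueness.* In coordinates the constraint `c = 0` can be solved for the variation of the fibre
coordinates of `v`, so `δq` and `w` can be prescribed as a test function times constant coordinate
vectors (`exists_allowedDeformation`). The fundamental lemma of the calculus of variations along a
curve with prescribed jet at an interior time then determines the bundle map
(`RepresentsFirstVariation.unique`).

*Formulas.* Covariant derivatives differ from coordinate derivatives by Christoffel forms. In
`∂L/∂q - D/dt ∂L/∂q̇` those of the connection on `TQ` enter as
`-⟨∂L/∂q̇, Γ(X, q̇)⟩ + ⟨∂L/∂q̇, Γ(q̇, X)⟩`, which vanishes as a torsion-free connection has a symmetric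
Christoffel form (`christoffel_symm`); those of the connection on `V` match the coordinate
expressions (`lagrangePoincareMap_hor`, `lagrangePoincareMap_ver`).
-/

noncomputable section

set_option linter.unusedSectionVars false

/-! ### First variation in coordinates -/

section Euclidean

variable {E F : Type*} [NormedAddCommGroup E] [NormedSpace ℝ E]
  [NormedAddCommGroup F] [NormedSpace ℝ F]

/-- The product rule for the evaluation of a curve of continuous linear maps, between normed spaces.
It specialises `HasDerivAt.clm_apply`, whose instance arguments are costly to infer. -/
theorem hasDerivAt_clm_apply {c : ℝ → E →L[ℝ] F} {c' : E →L[ℝ] F} {u : ℝ → E} {u' : E} {t : ℝ}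
    (hc : HasDerivAt c c' t) (hu : HasDerivAt u u' t) :
    HasDerivAt (fun s => c s (u s)) (c' (u t) + c t u') t := hc.clm_apply hu

/-- The partial derivative of `ℓ(x, a, f)` in the base variable `x`. -/
def baseDeriv (ℓ : E × E × F → ℝ) (y : E × E × F) : E →L[ℝ] ℝ :=
  (fderiv ℝ ℓ y).comp (ContinuousLinearMap.inl ℝ E (E × F))

/-- The partial derivative of `ℓ(x, a, f)` in the velocity variable `a`. -/
def velDeriv (ℓ : E × E × F → ℝ) (y : E × E × F) : E →L[ℝ] ℝ :=
  (fderiv ℝ ℓ y).comp ((ContinuousLinearMap.inr ℝ E (E × F)).comp (ContinuousLinearMap.inl ℝ E F))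

/-- The partial derivative of `ℓ(x, a, f)` in the vertical variable `f`. -/
def vertDeriv (ℓ : E × E × F → ℝ) (y : E × E × F) : F →L[ℝ] ℝ :=
  (fderiv ℝ ℓ y).comp ((ContinuousLinearMap.inr ℝ E (E × F)).comp (ContinuousLinearMap.inr ℝ E F))

theorem fderiv_eq_partials (ℓ : E × E × F → ℝ) (y : E × E × F) (a b : E) (f : F) :
    fderiv ℝ ℓ y (a, b, f) = baseDeriv ℓ y a + velDeriv ℓ y b + vertDeriv ℓ y f := by
  simp only [baseDeriv, velDeriv, vertDeriv, ContinuousLinearMap.comp_apply, ← map_add]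
  simp

theorem ContDiffOn.baseDeriv {ℓ : E × E × F → ℝ} {s : Set (E × E × F)} (hs : IsOpen s)
    (h : ContDiffOn ℝ ∞ ℓ s) : ContDiffOn ℝ ∞ (baseDeriv ℓ) s :=
  (h.fderiv_of_isOpen hs (by simp)).clm_comp contDiffOn_const

theorem ContDiffOn.velDeriv {ℓ : E × E × F → ℝ} {s : Set (E × E × F)} (hs : IsOpen s)
    (h : ContDiffOn ℝ ∞ ℓ s) : ContDiffOn ℝ ∞ (velDeriv ℓ) s :=
  (h.fderiv_of_isOpen hs (by simp)).clm_comp contDiffOn_const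

theorem ContDiffOn.vertDeriv {ℓ : E × E × F → ℝ} {s : Set (E × E × F)} (hs : IsOpen s)
    (h : ContDiffOn ℝ ∞ ℓ s) : ContDiffOn ℝ ∞ (vertDeriv ℓ) s :=
  (h.fderiv_of_isOpen hs (by simp)).clm_comp contDiffOn_const

variable (E F) in
/-- The coordinate expressions of a Lagrangian and of the structure maps of an `𝔏𝔓`-bundle over an
open set of the model space: the Lagrangian `ℓ(x, ẋ, f)`, the Christoffel form `Γ` of the
connection on `V`, the fibre bracket and the two-form. -/
structure CoordLP where
  /-- The Lagrangian. -/
  lag : E × E × F → ℝ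
  /-- The Christoffel form, `∇_a f = df(a) + Γ(a) f`. -/
  conn : E → E →L[ℝ] F →L[ℝ] F
  /-- The fibre bracket. -/
  brk : E → F →L[ℝ] F →L[ℝ] F
  /-- The two-form. -/
  curv : E → E →L[ℝ] E →L[ℝ] F

namespace CoordLP

/-- Smoothness of all the coordinate expressions over the open set `W`, where the two-form is
moreover alternating. -/
structure IsSmoothOn (D : CoordLP E F) (W : Set E) : Prop where
  isOpen : IsOpen W
  lag : ContDiffOn ℝ ∞ D.lag (W ×ˢ univ)
  conn : ContDiffOn ℝ ∞ D.conn W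
  brk : ContDiffOn ℝ ∞ D.brk W
  curv : ContDiffOn ℝ ∞ D.curv W
  curv_self : ∀ x ∈ W, ∀ a, D.curv x a a = 0

/-- The horizontal Lagrange–Poincaré expression in coordinates, at a point `x` with first and second
derivative `a`, `b`, and at `f` with (ordinary) derivative `g`. -/
def hor (D : CoordLP E F) (y : E × (E × E) × (F × F)) : E →L[ℝ] ℝ :=
  baseDeriv D.lag (y.1, y.2.1.1, y.2.2.1) -
    fderiv ℝ (velDeriv D.lag) (y.1, y.2.1.1, y.2.2.1) (y.2.1.1, y.2.1.2, y.2.2.2) -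
    (vertDeriv D.lag (y.1, y.2.1.1, y.2.2.1)).comp ((D.conn y.1).flip y.2.2.1) -
    (vertDeriv D.lag (y.1, y.2.1.1, y.2.2.1)).comp (D.curv y.1 y.2.1.1)

/-- The vertical Lagrange–Poincaré expression in coordinates, at the same arguments as `hor`. The
last term turns the ordinary derivative of `∂ℓ/∂f` into the covariant one. -/
def ver (D : CoordLP E F) (y : E × (E × E) × (F × F)) : F →L[ℝ] ℝ :=
  (vertDeriv D.lag (y.1, y.2.1.1, y.2.2.1)).comp (D.brk y.1 y.2.2.1) -
    fderiv ℝ (vertDeriv D.lag) (y.1, y.2.1.1, y.2.2.1) (y.2.1.1, y.2.1.2, y.2.2.2) +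
    (vertDeriv D.lag (y.1, y.2.1.1, y.2.2.1)).comp (D.conn y.1 y.2.1.1)

variable {D : CoordLP E F} {W : Set E}

theorem IsSmoothOn.isOpen_prod (h : D.IsSmoothOn W) :
    IsOpen (W ×ˢ (univ : Set (E × F))) := h.isOpen.prod isOpen_univ

theorem IsSmoothOn.contDiffOn_hor [FiniteDimensional ℝ E] (h : D.IsSmoothOn W) :
    ContDiffOn ℝ ∞ D.hor (W ×ˢ univ) := by
  have hW := h.isOpen_prod
  have hm : MapsTo (fun y : E × (E × E) × (F × F) => (y.1, y.2.1.1, y.2.2.1))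
    (W ×ˢ univ) (W ×ˢ univ) := fun y hy => ⟨hy.1, mem_univ _⟩
  have hm1 : MapsTo (fun y : E × (E × E) × (F × F) => y.1) (W ×ˢ univ) W := fun y hy => hy.1
  have h1 := (h.lag.baseDeriv hW).comp (g := baseDeriv D.lag) (by fun_prop) hm
  have h2 := ((h.lag.velDeriv hW).fderiv_of_isOpen hW (m := ∞) (by simp)).comp
    (by fun_prop) hm
  have h3 := (h.lag.vertDeriv hW).comp (g := vertDeriv D.lag) (by fun_prop) hm
  have h4 := h.conn.comp (by fun_prop) hm1
  have h5 := h.curv.comp (by fun_prop) hm1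
  refine contDiffOn_clm_apply.2 fun ξ => ?_
  have k1 := h1.clm_apply (contDiffOn_const (c := ξ))
  have k2 := (h2.clm_apply (g := fun y => (y.2.1.1, y.2.1.2, y.2.2.2)) (by fun_prop)).clm_apply
    (contDiffOn_const (c := ξ))
  have k3 := h3.clm_apply ((h4.clm_apply (contDiffOn_const (c := ξ))).clm_apply
    (g := fun y => y.2.2.1) (by fun_prop))
  have k4 := h3.clm_apply ((h5.clm_apply (g := fun y => y.2.1.1) (by fun_prop)).clm_apply
    (contDiffOn_const (c := ξ)))
  exact (((k1.sub k2).sub k3).sub k4).congr fun y _ => rfl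

theorem IsSmoothOn.contDiffOn_ver [FiniteDimensional ℝ F] (h : D.IsSmoothOn W) :
    ContDiffOn ℝ ∞ D.ver (W ×ˢ univ) := by
  have hW := h.isOpen_prod
  have hm : MapsTo (fun y : E × (E × E) × (F × F) => (y.1, y.2.1.1, y.2.2.1))
    (W ×ˢ univ) (W ×ˢ univ) := fun y hy => ⟨hy.1, mem_univ _⟩
  have hm1 : MapsTo (fun y : E × (E × E) × (F × F) => y.1) (W ×ˢ univ) W := fun y hy => hy.1
  have h2 := ((h.lag.vertDeriv hW).fderiv_of_isOpen hW (m := ∞) (by simp)).comp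
    (by fun_prop) hm
  have h3 := (h.lag.vertDeriv hW).comp (g := vertDeriv D.lag) (by fun_prop) hm
  have h4 := h.conn.comp (by fun_prop) hm1
  have h5 := h.brk.comp (by fun_prop) hm1
  refine contDiffOn_clm_apply.2 fun η => ?_
  have k1 := h3.clm_apply ((h5.clm_apply (g := fun y => y.2.2.1) (by fun_prop)).clm_apply
    (contDiffOn_const (c := η)))
  have k2 := (h2.clm_apply (g := fun y => (y.2.1.1, y.2.1.2, y.2.2.2)) (by fun_prop)).clm_apply
    (contDiffOn_const (c := η))
  have k3 := h3.clm_apply ((h4.clm_apply (g := fun y => y.2.1.1) (by fun_prop)).clm_apply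
    (contDiffOn_const (c := η)))
  exact ((k1.sub k2).add k3).congr fun y _ => rfl

/-- Pointwise first variation formula in coordinates. The derivative of the boundary term
`⟨∂ℓ/∂ẋ, δx⟩ + ⟨∂ℓ/∂f, w⟩` is the variation of `ℓ`, minus the Lagrange–Poincaré expressions, minus
the pairing of `∂ℓ/∂f` with the defect of the constraint on the variation. -/
theorem hasDerivAt_boundary (h : D.IsSmoothOn W) {x a δx : ℝ → E} {f w : ℝ → F} {t : ℝ}
    {b δa : E} {g δf w' : F} (hxW : x t ∈ W) (hx : HasDerivAt x (a t) t) (ha : HasDerivAt a b t)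
    (hf : HasDerivAt f g t) (hδ : HasDerivAt δx δa t) (hw : HasDerivAt w w' t) :
    HasDerivAt (fun s => velDeriv D.lag (x s, a s, f s) (δx s) +
        vertDeriv D.lag (x s, a s, f s) (w s))
      (fderiv ℝ D.lag (x t, a t, f t) (δx t, δa, δf) -
        D.hor (x t, (a t, b), (f t, g)) (δx t) - D.ver (x t, (a t, b), (f t, g)) (w t) -
        vertDeriv D.lag (x t, a t, f t) (δf + D.conn (x t) (δx t) (f t) -
          (w' + D.conn (x t) (a t) (w t) + D.brk (x t) (f t) (w t) +
            D.curv (x t) (δx t) (a t)))) t := by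
  have hW := h.isOpen_prod
  have hc : HasDerivAt (fun s => (x s, a s, f s)) (a t, b, g) t := hx.prodMk (ha.prodMk hf)
  have hmem : W ×ˢ (univ : Set (E × F)) ∈ 𝓝 (x t, a t, f t) := hW.mem_nhds ⟨hxW, mem_univ _⟩
  have h1 : HasFDerivAt (velDeriv D.lag) _ (x t, a t, f t) :=
    (((h.lag.velDeriv hW).contDiffAt hmem).differentiableAt (by simp)).hasFDerivAt
  have h2 : HasFDerivAt (vertDeriv D.lag) _ (x t, a t, f t) :=
    (((h.lag.vertDeriv hW).contDiffAt hmem).differentiableAt (by simp)).hasFDerivAt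
  have h1' : HasDerivAt (fun s => velDeriv D.lag (x s, a s, f s))
      (fderiv ℝ (velDeriv D.lag) (x t, a t, f t) (a t, b, g)) t :=
    h1.comp_hasDerivAt (f := fun s => (x s, a s, f s)) t hc
  have h2' : HasDerivAt (fun s => vertDeriv D.lag (x s, a s, f s))
      (fderiv ℝ (vertDeriv D.lag) (x t, a t, f t) (a t, b, g)) t :=
    h2.comp_hasDerivAt (f := fun s => (x s, a s, f s)) t hc
  have h3 := hasDerivAt_clm_apply h1' hδ
  have h4 := hasDerivAt_clm_apply h2' hw
  refine (h3.add h4).congr_deriv ?_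
  -- `hor` contains `curv` evaluated at `(ẋ, δx)`, the constraint contains it at `(δx, ẋ)`.
  have hanti : D.curv (x t) (a t) (δx t) = - D.curv (x t) (δx t) (a t) := by
    have := h.curv_self _ hxW (a t + δx t)
    simp only [map_add, add_apply, h.curv_self _ hxW, zero_add,
      add_zero] at this
    exact eq_neg_of_add_eq_zero_right this
  rw [fderiv_eq_partials]
  simp only [hor, ver, sub_apply, add_apply,
    ContinuousLinearMap.comp_apply, ContinuousLinearMap.flip_apply, map_add, map_sub, hanti,
    map_neg]
  ring

end CoordLP

/-- Partial derivatives of a map of two real variables commute. -/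
theorem deriv_deriv_comm {x : ℝ × ℝ → E} {l t : ℝ} (hx : ContDiffAt ℝ ∞ x (l, t)) :
    deriv (fun m => deriv (fun s => x (m, s)) t) l =
      deriv (fun s => deriv (fun m => x (m, s)) l) t := by
  have hd : ∀ᶠ p in 𝓝 (l, t), DifferentiableAt ℝ x p :=
    ((hx.of_le (m := 1) ENat.LEInfty.out).eventually (by simp)).mono
      fun p hp => hp.differentiableAt (by simp)
  have e1 : (fun m => deriv (fun s => x (m, s)) t) =ᶠ[𝓝 l]
      fun m => fderiv ℝ x (m, t) (0, 1) := by
    filter_upwards [(by fun_prop : Continuous fun m : ℝ => (m, t)).continuousAt.eventually hd]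
      with m hm
    exact (hm.hasFDerivAt.comp_hasDerivAt t
      ((hasDerivAt_const t m).prodMk (hasDerivAt_id t))).deriv
  have e2 : (fun s => deriv (fun m => x (m, s)) l) =ᶠ[𝓝 t]
      fun s => fderiv ℝ x (l, s) (1, 0) := by
    filter_upwards [(by fun_prop : Continuous fun s : ℝ => (l, s)).continuousAt.eventually hd]
      with s hs
    exact (hs.hasFDerivAt.comp_hasDerivAt l
      ((hasDerivAt_id l).prodMk (hasDerivAt_const l s))).deriv
  have h2 : HasFDerivAt (fderiv ℝ x) _ (l, t) :=
    ((hx.fderiv_right (m := 1) (by norm_cast)).differentiableAt (by simp)).hasFDerivAt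
  have d1 : HasDerivAt (fun m => fderiv ℝ x (m, t)) (fderiv ℝ (fderiv ℝ x) (l, t) (1, 0)) l :=
    h2.comp_hasDerivAt l ((hasDerivAt_id l).prodMk (hasDerivAt_const l t))
  have d2 : HasDerivAt (fun s => fderiv ℝ x (l, s)) (fderiv ℝ (fderiv ℝ x) (l, t) (0, 1)) t :=
    h2.comp_hasDerivAt t ((hasDerivAt_const t l).prodMk (hasDerivAt_id t))
  replace d1 := hasDerivAt_clm_apply d1 (hasDerivAt_const l ((0, 1) : ℝ × ℝ))
  replace d2 := hasDerivAt_clm_apply d2 (hasDerivAt_const t ((1, 0) : ℝ × ℝ))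
  rw [e1.deriv_eq, e2.deriv_eq]
  refine d1.deriv.trans (Eq.trans ?_ d2.deriv.symm)
  simpa using (hx.isSymmSndFDerivAt (by simpa using ENat.LEInfty.out)).eq (1, 0) (0, 1)

end Euclidean

/-! ### Calculus on fibres and continuous bilinear maps -/

section FibreCalculus

/-- Differentiability is transported by a continuous linear equivalence from a topological vector
space to a normed space. -/
theorem HasFDerivAt.comp_continuousLinearEquiv {W F G : Type*} [AddCommGroup W] [Module ℝ W]
    [TopologicalSpace W] [NormedAddCommGroup F] [NormedSpace ℝ F] [NormedAddCommGroup G]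
    [NormedSpace ℝ G] (e : W ≃L[ℝ] F) {g : F → G} {x : W} {g' : F →L[ℝ] G}
    (h : HasFDerivAt g g' (e x)) :
    HasFDerivAt (fun y => g (e y)) (g'.comp (e : W →L[ℝ] F)) x := by
  rw [hasFDerivAt_iff_isLittleOTVS] at h ⊢
  have h1 := (h.comp_tendsto (e.continuous.tendsto x)).trans_isBigOTVS
    (k := fun y => y - x) ?_
  · simpa [Function.comp_def] using h1
  · simpa [Function.comp_def] using
      ContinuousLinearMap.isBigOTVS_fun_comp (f := fun y => y - x) (l := 𝓝 x) (e : W →L[ℝ] F)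

theorem HasFDerivAt.of_comp_continuousLinearEquiv {W F G : Type*} [AddCommGroup W] [Module ℝ W]
    [TopologicalSpace W] [NormedAddCommGroup F] [NormedSpace ℝ F] [NormedAddCommGroup G]
    [NormedSpace ℝ G] (e : W ≃L[ℝ] F) {g : F → G} {x : W} {g' : W →L[ℝ] G}
    (h : HasFDerivAt (fun y => g (e y)) g' x) :
    HasFDerivAt g (g'.comp (e.symm : F →L[ℝ] W)) (e x) := by
  rw [hasFDerivAt_iff_isLittleOTVS] at h ⊢
  have ht : Filter.Tendsto e.symm (𝓝 (e x)) (𝓝 x) := by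
    simpa using e.symm.continuous.tendsto (e x)
  have h1 := (h.comp_tendsto ht).trans_isBigOTVS (k := fun y => y - e x) ?_
  · simpa [Function.comp_def] using h1
  · simpa [Function.comp_def] using ContinuousLinearMap.isBigOTVS_fun_comp
      (f := fun y => y - e x) (l := 𝓝 (e x)) (e.symm : F →L[ℝ] W)

theorem fderiv_comp_continuousLinearEquiv {W F G : Type*} [AddCommGroup W] [Module ℝ W]
    [TopologicalSpace W] [NormedAddCommGroup F] [NormedSpace ℝ F] [NormedAddCommGroup G]
    [NormedSpace ℝ G] (e : W ≃L[ℝ] F) {g : F → G} {x : W} (h : DifferentiableAt ℝ g (e x)) :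
    fderiv ℝ (fun y => g (e y)) x = (fderiv ℝ g (e x)).comp (e : W →L[ℝ] F) := by
  have h1 : DifferentiableAt ℝ (fun y => g (e y)) x :=
    ⟨_, h.hasFDerivAt.comp_continuousLinearEquiv e⟩
  have h2 : HasFDerivAt (fun y => g (e y)) (fderiv ℝ (fun y => g (e y)) x) x :=
    h1.hasFDerivAt
  rw [(h2.of_comp_continuousLinearEquiv e).fderiv]
  ext y
  simp

/-- A bilinear map between finite dimensional spaces, as a continuous bilinear map. -/
def LinearMap.toContinuousBilinear {E F G : Type*} [NormedAddCommGroup E] [NormedSpace ℝ E]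
    [FiniteDimensional ℝ E] [NormedAddCommGroup F] [NormedSpace ℝ F] [FiniteDimensional ℝ F]
    [NormedAddCommGroup G] [NormedSpace ℝ G] (B : E →ₗ[ℝ] F →ₗ[ℝ] G) : E →L[ℝ] F →L[ℝ] G :=
  LinearMap.toContinuousLinearMap
    ((LinearMap.toContinuousLinearMap : (F →ₗ[ℝ] G) ≃ₗ[ℝ] (F →L[ℝ] G)).toLinearMap ∘ₗ B)

@[simp]
theorem LinearMap.toContinuousBilinear_apply {E F G : Type*} [NormedAddCommGroup E]
    [NormedSpace ℝ E] [FiniteDimensional ℝ E] [NormedAddCommGroup F] [NormedSpace ℝ F]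
    [FiniteDimensional ℝ F] [NormedAddCommGroup G] [NormedSpace ℝ G] (B : E →ₗ[ℝ] F →ₗ[ℝ] G)
    (a : E) (f : F) : B.toContinuousBilinear a f = B a f := rfl

theorem contDiffOn_toContinuousBilinear {E F G X : Type*} [NormedAddCommGroup E]
    [NormedSpace ℝ E] [FiniteDimensional ℝ E] [NormedAddCommGroup F] [NormedSpace ℝ F]
    [FiniteDimensional ℝ F] [NormedAddCommGroup G] [NormedSpace ℝ G] [NormedAddCommGroup X]
    [NormedSpace ℝ X] {B : X → E →ₗ[ℝ] F →ₗ[ℝ] G} {s : Set X}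
    (h : ∀ a f, ContDiffOn ℝ ∞ (fun x => B x a f) s) :
    ContDiffOn ℝ ∞ (fun x => (B x).toContinuousBilinear) s :=
  contDiffOn_clm_apply.2 fun a => contDiffOn_clm_apply.2 fun f => h a f

end FibreCalculus

/-! ### Coordinates and Christoffel forms -/

section Coordinates

variable {E : Type*} [NormedAddCommGroup E] [NormedSpace ℝ E]
  {F : Type*} [NormedAddCommGroup F] [NormedSpace ℝ F]
  {Q : Type*} [TopologicalSpace Q] [ChartedSpace E Q] [IsManifold 𝓘(ℝ, E) ∞ Q]
  {V : Q → Type*} [TopologicalSpace (TotalSpace F V)]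
  [∀ x, AddCommGroup (V x)] [∀ x, Module ℝ (V x)] [∀ x, TopologicalSpace (V x)]
  [∀ x, IsTopologicalAddGroup (V x)] [∀ x, ContinuousSMul ℝ (V x)]
  [FiberBundle F V] [VectorBundle ℝ F V]

variable (E) in
/-- The trivialization of `TQ` over the preferred chart at `q₀`. -/
abbrev tanTriv (q₀ : Q) :
    Trivialization E (TotalSpace.proj : TotalSpace E (fun x : Q => TangentSpace 𝓘(ℝ, E) x) → Q) :=
  trivializationAt E (fun x : Q => TangentSpace 𝓘(ℝ, E) x) q₀

variable (F V) in
/-- The preferred trivialization of `V` at `q₀`. -/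
abbrev vecTriv (q₀ : Q) : Trivialization F (TotalSpace.proj : TotalSpace F V → Q) :=
  trivializationAt F V q₀

variable (E F V) in
/-- The points of `Q` at which both the preferred chart and the preferred trivialization at `q₀` are
defined. -/
def baseDomain (q₀ : Q) : Set Q := (chartAt E q₀).source ∩ (vecTriv F V q₀).baseSet

variable (E F V) in
/-- The image of `baseDomain` under the preferred chart at `q₀`. -/
def coordDomain (q₀ : Q) : Set E :=
  (chartAt E q₀).target ∩ (chartAt E q₀).symm ⁻¹' (vecTriv F V q₀).baseSet

theorem isOpen_coordDomain (q₀ : Q) : IsOpen (coordDomain E F V q₀) :=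
  (chartAt E q₀).isOpen_inter_preimage_symm (vecTriv F V q₀).open_baseSet

theorem isOpen_baseDomain (q₀ : Q) : IsOpen (baseDomain E F V q₀) :=
  (chartAt E q₀).open_source.inter (vecTriv F V q₀).open_baseSet

theorem mem_baseDomain_self (q : Q) : q ∈ baseDomain E F V q :=
  ⟨mem_chart_source E q, mem_baseSet_trivializationAt F V q⟩

theorem chart_mem_coordDomain {q₀ q : Q} (h : q ∈ baseDomain E F V q₀) :
    chartAt E q₀ q ∈ coordDomain E F V q₀ := by
  refine ⟨(chartAt E q₀).map_source h.1, ?_⟩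
  simpa [(chartAt E q₀).left_inv h.1] using h.2

theorem chart_symm_mem_baseDomain {q₀ : Q} {x : E} (h : x ∈ coordDomain E F V q₀) :
    (chartAt E q₀).symm x ∈ baseDomain E F V q₀ :=
  ⟨(chartAt E q₀).map_target h.1, h.2⟩

theorem contMDiffAt_chart_symm {q₀ : Q} {x : E} (hx : x ∈ coordDomain E F V q₀) :
    ContMDiffAt 𝓘(ℝ, E) 𝓘(ℝ, E) ∞ (chartAt E q₀).symm x :=
  (contMDiffOn_chart_symm (n := ∞)).contMDiffAt ((chartAt E q₀).open_target.mem_nhds hx.1)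

/-- Constant sections in a trivialization are smooth. -/
theorem contMDiffAt_symmL_const [ContMDiffVectorBundle ∞ F V 𝓘(ℝ, E)] {q₀ q : Q}
    (h : q ∈ (vecTriv F V q₀).baseSet) (f : F) :
    ContMDiffAt 𝓘(ℝ, E) (𝓘(ℝ, E).prod 𝓘(ℝ, F)) ∞
      (fun y => TotalSpace.mk' F y ((vecTriv F V q₀).symmL ℝ y f)) q := by
  rw [(vecTriv F V q₀).contMDiffAt_section_iff h]
  refine (contMDiffAt_const (c := f)).congr_of_eventuallyEq ?_
  filter_upwards [(vecTriv F V q₀).open_baseSet.mem_nhds h] with y hy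
  rw [← (vecTriv F V q₀).continuousLinearMapAt_apply_of_mem (R := ℝ) hy,
    Trivialization.continuousLinearMapAt_symmL _ hy]

/-- The coordinate expression of a smooth section is smooth. -/
theorem contDiffAt_coord_section [ContMDiffVectorBundle ∞ F V 𝓘(ℝ, E)] {q₀ : Q} {x : E}
    (hx : x ∈ coordDomain E F V q₀) {s : ∀ y, V y}
    (hs : ContMDiffAt 𝓘(ℝ, E) (𝓘(ℝ, E).prod 𝓘(ℝ, F)) ∞ (fun y => TotalSpace.mk' F y (s y))
      ((chartAt E q₀).symm x)) :
    ContDiffAt ℝ ∞ (fun z => (vecTriv F V q₀).continuousLinearMapAt ℝ ((chartAt E q₀).symm z)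
      (s ((chartAt E q₀).symm z))) x := by
  rw [(vecTriv F V q₀).contMDiffAt_section_iff hx.2] at hs
  have h1 := hs.comp x (contMDiffAt_chart_symm hx)
  refine h1.contDiffAt.congr_of_eventuallyEq ?_
  filter_upwards [(isOpen_coordDomain (F := F) (V := V) q₀).mem_nhds hx] with z hz
  exact (vecTriv F V q₀).continuousLinearMapAt_apply_of_mem (R := ℝ) hz.2 _

/-- The flat derivative of a section: the derivative of its components in the trivialization at
`q₀`. It is the reference connection that the Christoffel form measures the difference from. -/
def flatDeriv (q₀ : Q) (s : ∀ y, V y) (y : Q) : TangentSpace 𝓘(ℝ, E) y →L[ℝ] V y :=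
  ((vecTriv F V q₀).symmL ℝ y).comp (mvfderiv 𝓘(ℝ, E) (fun z => (vecTriv F V q₀ ⟨z, s z⟩).2) y)

theorem isCovariantDerivativeOn_flatDeriv [ContMDiffVectorBundle ∞ F V 𝓘(ℝ, E)] (q₀ : Q) :
    IsCovariantDerivativeOn (I := 𝓘(ℝ, E)) F (flatDeriv (F := F) (V := V) q₀)
      (vecTriv F V q₀).baseSet where
  add {σ σ' x} hσ hσ' hx := by
    rw [(vecTriv F V q₀).mdifferentiableAt_section_iff _ _ hx] at hσ hσ'
    have h : (fun z => (vecTriv F V q₀ ⟨z, (σ + σ') z⟩).2) =ᶠ[𝓝 x]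
        (fun z => (vecTriv F V q₀ ⟨z, σ z⟩).2) + fun z => (vecTriv F V q₀ ⟨z, σ' z⟩).2 := by
      filter_upwards [(vecTriv F V q₀).open_baseSet.mem_nhds hx] with z hz
      simp [← (vecTriv F V q₀).continuousLinearMapAt_apply_of_mem (R := ℝ) hz]
    have h2 := mvfderiv_add hσ hσ'
    rw [flatDeriv, flatDeriv, flatDeriv, ← ContinuousLinearMap.comp_add]
    congr 1
    rw [← h2]
    simp only [mvfderiv, h.mfderiv_eq]
    rfl
  leibniz {σ g x} hσ hg hx := by
    rw [(vecTriv F V q₀).mdifferentiableAt_section_iff _ _ hx] at hσ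
    have h : (fun z => (vecTriv F V q₀ ⟨z, (g • σ) z⟩).2) =ᶠ[𝓝 x]
        g • (fun z => (vecTriv F V q₀ ⟨z, σ z⟩).2) := by
      filter_upwards [(vecTriv F V q₀).open_baseSet.mem_nhds hx] with z hz
      simp [← (vecTriv F V q₀).continuousLinearMapAt_apply_of_mem (R := ℝ) hz]
    have h2 := mvfderiv_smul hg hσ
    have h3 : mvfderiv 𝓘(ℝ, E) (fun z => (vecTriv F V q₀ ⟨z, (g • σ) z⟩).2) x =
        mvfderiv 𝓘(ℝ, E) (g • (fun z => (vecTriv F V q₀ ⟨z, σ z⟩).2)) x := by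
      simp only [mvfderiv, h.mfderiv_eq]
      rfl
    rw [flatDeriv, flatDeriv, h3, h2]
    ext X
    simp only [ContinuousLinearMap.comp_apply, add_apply, smul_apply, map_add, map_smul,
      ContinuousLinearMap.smulRight_apply]
    rw [← (vecTriv F V q₀).continuousLinearMapAt_apply_of_mem (R := ℝ) hx,
      Trivialization.symmL_continuousLinearMapAt _ hx]

variable [FiniteDimensional ℝ E] [FiniteDimensional ℝ F] [ContMDiffVectorBundle ∞ F V 𝓘(ℝ, E)]

/-- The Christoffel form of a connection at a point `q`, in the preferred chart and trivialization at
`q₀`: the difference between the connection and the flat derivative, read in coordinates. -/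
def christoffelAt (nabla : CovariantDerivative 𝓘(ℝ, E) F V) (q₀ q : Q) : E →L[ℝ] F →L[ℝ] F :=
  letI Δ := (nabla.isCovariantDerivativeOn (s := (vecTriv F V q₀).baseSet)).difference
    (isCovariantDerivativeOn_flatDeriv (E := E) (F := F) (V := V) q₀) q
  LinearMap.toContinuousBilinear <| LinearMap.mk₂ ℝ
    (fun a f => (vecTriv F V q₀).continuousLinearMapAt ℝ q
      (Δ ((vecTriv F V q₀).symmL ℝ q f) ((tanTriv E q₀).symmL ℝ q a)))
    (by simp) (by simp) (by simp) (by simp)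

/-- The Christoffel form as a function of the coordinates. -/
def christoffel (nabla : CovariantDerivative 𝓘(ℝ, E) F V) (q₀ : Q) (x : E) : E →L[ℝ] F →L[ℝ] F :=
  christoffelAt nabla q₀ ((chartAt E q₀).symm x)

/-- A connection is the derivative plus the Christoffel form, in coordinates. -/
theorem coord_covariantDerivative (nabla : CovariantDerivative 𝓘(ℝ, E) F V) {q₀ q : Q}
    (hq : q ∈ baseDomain E F V q₀) {s : ∀ y, V y}
    (hs : MDifferentiableAt 𝓘(ℝ, E) (𝓘(ℝ, E).prod 𝓘(ℝ, F)) (fun y => TotalSpace.mk' F y (s y)) q)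
    (X : TangentSpace 𝓘(ℝ, E) q) :
    (vecTriv F V q₀).continuousLinearMapAt ℝ q (nabla s q X) =
      mvfderiv 𝓘(ℝ, E) (fun z => (vecTriv F V q₀ ⟨z, s z⟩).2) q X +
      christoffel nabla q₀ (chartAt E q₀ q) ((tanTriv E q₀).continuousLinearMapAt ℝ q X)
        ((vecTriv F V q₀).continuousLinearMapAt ℝ q (s q)) := by
  have h2 := (nabla.isCovariantDerivativeOn (s := (vecTriv F V q₀).baseSet)).difference_apply
    (isCovariantDerivativeOn_flatDeriv (E := E) (F := F) (V := V) q₀) hq.2 hs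
  rw [christoffel, (chartAt E q₀).left_inv hq.1, christoffelAt,
    LinearMap.toContinuousBilinear_apply, LinearMap.mk₂_apply,
    Trivialization.symmL_continuousLinearMapAt _ hq.2,
    Trivialization.symmL_continuousLinearMapAt _ (show q ∈ (tanTriv E q₀).baseSet from hq.1), h2]
  simp only [sub_apply, map_sub, flatDeriv, ContinuousLinearMap.comp_apply]
  rw [Trivialization.continuousLinearMapAt_symmL _ hq.2]
  abel

/-- The Christoffel form is the covariant derivative of the constant sections. -/
theorem christoffel_apply (nabla : CovariantDerivative 𝓘(ℝ, E) F V) {q₀ : Q} {x : E}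
    (hx : x ∈ coordDomain E F V q₀) (a : E) (f : F) :
    christoffel nabla q₀ x a f = (vecTriv F V q₀).continuousLinearMapAt ℝ ((chartAt E q₀).symm x)
      (nabla (fun y => (vecTriv F V q₀).symmL ℝ y f) ((chartAt E q₀).symm x)
        ((tanTriv E q₀).symmL ℝ ((chartAt E q₀).symm x) a)) := by
  have hq := chart_symm_mem_baseDomain hx
  rw [coord_covariantDerivative nabla hq
    ((contMDiffAt_symmL_const hq.2 f).mdifferentiableAt (by simp)),
    Trivialization.continuousLinearMapAt_symmL _ hq.2,
    Trivialization.continuousLinearMapAt_symmL _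
      (show (chartAt E q₀).symm x ∈ (tanTriv E q₀).baseSet from hq.1),
    (chartAt E q₀).right_inv hx.1]
  have h : (fun z => (vecTriv F V q₀ ⟨z, (vecTriv F V q₀).symmL ℝ z f⟩).2)
      =ᶠ[𝓝 ((chartAt E q₀).symm x)] fun _ => f := by
    filter_upwards [(vecTriv F V q₀).open_baseSet.mem_nhds hq.2] with z hz
    rw [← (vecTriv F V q₀).continuousLinearMapAt_apply_of_mem (R := ℝ) hz,
      Trivialization.continuousLinearMapAt_symmL _ hz]
  have h0 : mvfderiv 𝓘(ℝ, E) (fun z => (vecTriv F V q₀ ⟨z, (vecTriv F V q₀).symmL ℝ z f⟩).2)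
      ((chartAt E q₀).symm x) = 0 := by
    rw [← mvfderiv_const (I := 𝓘(ℝ, E)) f]
    simp only [mvfderiv, h.mfderiv_eq]
    rfl
  rw [h0]
  exact (zero_add _).symm

/-- Smooth connections differentiate locally smooth sections to locally smooth sections: the
section is cut off by a bump function, as the smoothness of `∇` refers to global sections. -/
theorem contMDiffAt_covariantDerivative [T2Space Q] {nabla : CovariantDerivative 𝓘(ℝ, E) F V}
    (hn : CovariantDerivative.ContMDiffCovariantDerivative nabla ∞) {U : Set Q} (hU : IsOpen U)
    {q : Q} (hq : q ∈ U) {s : ∀ y, V y}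
    (hs : ∀ y ∈ U, ContMDiffAt 𝓘(ℝ, E) (𝓘(ℝ, E).prod 𝓘(ℝ, F)) ∞
      (fun y => TotalSpace.mk' F y (s y)) y)
    {X : ∀ y : Q, TangentSpace 𝓘(ℝ, E) y}
    (hX : ContMDiffAt 𝓘(ℝ, E) (𝓘(ℝ, E).prod 𝓘(ℝ, E)) ∞ (fun y => TotalSpace.mk' E y (X y)) q) :
    ContMDiffAt 𝓘(ℝ, E) (𝓘(ℝ, E).prod 𝓘(ℝ, F)) ∞
      (fun y => TotalSpace.mk' F y (nabla s y (X y))) q := by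
  obtain ⟨χ, -, hχ⟩ := (SmoothBumpFunction.nhds_basis_tsupport (I := 𝓘(ℝ, E)) q).mem_iff.1
    (hU.mem_nhds hq)
  have h1 : ContMDiff 𝓘(ℝ, E) (𝓘(ℝ, E).prod 𝓘(ℝ, F)) ∞
      (fun y => TotalSpace.mk' F y (((χ : Q → ℝ) • s) y)) :=
    ContMDiffOn.smul_section_of_tsupport χ.contMDiff.contMDiffOn hU hχ
      fun y hy => (hs y hy).contMDiffWithinAt
  have h2 := (hn.contMDiff.contMDiff (σ := (χ : Q → ℝ) • s) h1.contMDiffOn).contMDiffAt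
    (x := q) Filter.univ_mem
  have h3 := h2.clm_bundle_apply hX
  refine h3.congr_of_eventuallyEq ?_
  have h4 : ∀ᶠ y in 𝓝 q, ∀ᶠ z in 𝓝 y, χ z = 1 := χ.eventuallyEq_one.eventually_nhds
  filter_upwards [h4, hU.mem_nhds hq] with y hy hyU
  have h5 : nabla ((χ : Q → ℝ) • s) y = nabla s y :=
    (nabla.isCovariantDerivativeOn (s := univ)).congr_of_eventuallyEq
      ((h1 y).mdifferentiableAt (by simp)) ((hs y hyU).mdifferentiableAt (by simp))
      Filter.univ_mem (hy.mono fun z hz => by simp [hz])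
  simp only [h5]

theorem contDiffOn_christoffel [T2Space Q] {nabla : CovariantDerivative 𝓘(ℝ, E) F V}
    (hn : CovariantDerivative.ContMDiffCovariantDerivative nabla ∞) (q₀ : Q) :
    ContDiffOn ℝ ∞ (christoffel nabla q₀) (coordDomain E F V q₀) := by
  refine contDiffOn_clm_apply.2 fun a => contDiffOn_clm_apply.2 fun f => ?_
  intro x hx
  have hq := chart_symm_mem_baseDomain hx
  have h1 := contMDiffAt_covariantDerivative hn (isOpen_baseDomain (F := F) (V := V) q₀) hq
    (s := fun y => (vecTriv F V q₀).symmL ℝ y f) (fun y hy => contMDiffAt_symmL_const hy.2 f)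
    (X := fun y => (tanTriv E q₀).symmL ℝ y a) (contMDiffAt_symmL_const hq.1 a)
  exact (contDiffAt_coord_section hx h1).contDiffWithinAt.congr
    (fun z hz => christoffel_apply nabla hz a f) (christoffel_apply nabla hx a f)

end Coordinates

/-! ### Coordinate expressions of the structure maps and of the Lagrangian -/

section CoordinateExpressions

variable {E : Type*} [NormedAddCommGroup E] [NormedSpace ℝ E]
  {F : Type*} [NormedAddCommGroup F] [NormedSpace ℝ F]
  {Q : Type*} [TopologicalSpace Q] [ChartedSpace E Q] [IsManifold 𝓘(ℝ, E) ∞ Q]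
  {V : Q → Type*} [TopologicalSpace (TotalSpace F V)]
  [∀ x, AddCommGroup (V x)] [∀ x, Module ℝ (V x)] [∀ x, TopologicalSpace (V x)]
  [∀ x, IsTopologicalAddGroup (V x)] [∀ x, ContinuousSMul ℝ (V x)]
  [FiberBundle F V] [VectorBundle ℝ F V]
  [FiniteDimensional ℝ E] [FiniteDimensional ℝ F] [ContMDiffVectorBundle ∞ F V 𝓘(ℝ, E)]

variable (E) in
/-- The coordinates of tangent vectors in the preferred chart at `q₀`. -/
abbrev tanCoord (q₀ q : Q) : TangentSpace 𝓘(ℝ, E) q →L[ℝ] E :=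
  (tanTriv E q₀).continuousLinearMapAt ℝ q

variable (F V) in
/-- The coordinates of vectors in the preferred trivialization of `V` at `q₀`. -/
abbrev vecCoord (q₀ q : Q) : V q →L[ℝ] F := (vecTriv F V q₀).continuousLinearMapAt ℝ q

/-- The coordinates of a point of `TQ ⊕ V`. -/
def sumCoord (q₀ : Q) (p : TangentSum E F V) : E × E × F :=
  (chartAt E q₀ p.proj, tanCoord E q₀ p.proj p.2.1, vecCoord F V q₀ p.proj p.2.2)

/-- The coordinate expressions at `q₀` of an `𝔏𝔓`-bundle and of a Lagrangian. They are meaningful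
over `coordDomain E F V q₀` only. -/
def coordLP (P : LPBundle E F V) (L : TangentSum E F V → ℝ) (q₀ : Q) : CoordLP E F where
  lag y := L ⟨(chartAt E q₀).symm y.1, (tanTriv E q₀).symmL ℝ _ y.2.1,
    (vecTriv F V q₀).symmL ℝ _ y.2.2⟩
  conn := christoffel P.nabla q₀
  brk x := LinearMap.toContinuousBilinear
    (((P.bracket ((chartAt E q₀).symm x)).compl₁₂
      ((vecTriv F V q₀).symmL ℝ ((chartAt E q₀).symm x)).toLinearMap
      ((vecTriv F V q₀).symmL ℝ ((chartAt E q₀).symm x)).toLinearMap).compr₂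
        (vecCoord F V q₀ ((chartAt E q₀).symm x)).toLinearMap)
  curv x := LinearMap.toContinuousBilinear
    (((P.twoForm ((chartAt E q₀).symm x)).compl₁₂
      ((tanTriv E q₀).symmL ℝ ((chartAt E q₀).symm x)).toLinearMap
      ((tanTriv E q₀).symmL ℝ ((chartAt E q₀).symm x)).toLinearMap).compr₂
        (vecCoord F V q₀ ((chartAt E q₀).symm x)).toLinearMap)

theorem coord_bracket (P : LPBundle E F V) (L : TangentSum E F V → ℝ) {q₀ q : Q}
    (hq : q ∈ baseDomain E F V q₀) (u w : V q) :
    vecCoord F V q₀ q (P.bracket q u w) =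
      (coordLP P L q₀).brk (chartAt E q₀ q) (vecCoord F V q₀ q u) (vecCoord F V q₀ q w) := by
  have h : ∀ q' : Q, q' = q → vecCoord F V q₀ q (P.bracket q u w) =
      vecCoord F V q₀ q' (P.bracket q' ((vecTriv F V q₀).symmL ℝ q' (vecCoord F V q₀ q u))
        ((vecTriv F V q₀).symmL ℝ q' (vecCoord F V q₀ q w))) := by
    rintro _ rfl
    rw [Trivialization.symmL_continuousLinearMapAt _ hq.2,
      Trivialization.symmL_continuousLinearMapAt _ hq.2]
  exact h _ ((chartAt E q₀).left_inv hq.1)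

theorem coord_twoForm (P : LPBundle E F V) (L : TangentSum E F V → ℝ) {q₀ q : Q}
    (hq : q ∈ baseDomain E F V q₀) (X Y : TangentSpace 𝓘(ℝ, E) q) :
    vecCoord F V q₀ q (P.twoForm q X Y) =
      (coordLP P L q₀).curv (chartAt E q₀ q) (tanCoord E q₀ q X) (tanCoord E q₀ q Y) := by
  have h : ∀ q' : Q, q' = q → vecCoord F V q₀ q (P.twoForm q X Y) =
      vecCoord F V q₀ q' (P.twoForm q' ((tanTriv E q₀).symmL ℝ q' (tanCoord E q₀ q X))
        ((tanTriv E q₀).symmL ℝ q' (tanCoord E q₀ q Y))) := by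
    rintro _ rfl
    rw [Trivialization.symmL_continuousLinearMapAt _ hq.1,
      Trivialization.symmL_continuousLinearMapAt _ hq.1]
  exact h _ ((chartAt E q₀).left_inv hq.1)

theorem coord_lag (P : LPBundle E F V) (L : TangentSum E F V → ℝ) {q₀ : Q} {p : TangentSum E F V}
    (hp : p.proj ∈ baseDomain E F V q₀) : L p = (coordLP P L q₀).lag (sumCoord q₀ p) := by
  obtain ⟨q, X, u⟩ := p
  have h : ∀ q' : Q, q' = q → L ⟨q, X, u⟩ = L ⟨q', (tanTriv E q₀).symmL ℝ q' (tanCoord E q₀ q X),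
      (vecTriv F V q₀).symmL ℝ q' (vecCoord F V q₀ q u)⟩ := by
    rintro _ rfl
    rw [Trivialization.symmL_continuousLinearMapAt _ hp.2,
      Trivialization.symmL_continuousLinearMapAt _ hp.1]
  exact h _ ((chartAt E q₀).left_inv hp.1)

theorem contDiffOn_coord_lag (P : LPBundle E F V) {L : TangentSum E F V → ℝ}
    (hL : ContMDiff (𝓘(ℝ, E).prod 𝓘(ℝ, E × F)) 𝓘(ℝ, ℝ) ∞ L) (q₀ : Q) :
    ContDiffOn ℝ ∞ (coordLP P L q₀).lag (coordDomain E F V q₀ ×ˢ univ) := by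
  rintro y ⟨hy, -⟩
  have hq := chart_symm_mem_baseDomain hy
  have hmem : coordDomain E F V q₀ ×ˢ (univ : Set (E × F)) ∈ 𝓝 y :=
    ((isOpen_coordDomain q₀).prod isOpen_univ).mem_nhds ⟨hy, mem_univ _⟩
  let e := (tanTriv E q₀).prod (vecTriv F V q₀)
  have h1 : ContMDiffAt 𝓘(ℝ, E × E × F) (𝓘(ℝ, E).prod 𝓘(ℝ, E × F)) ∞
      (fun y : E × E × F => (⟨(chartAt E q₀).symm y.1, (tanTriv E q₀).symmL ℝ _ y.2.1,
        (vecTriv F V q₀).symmL ℝ _ y.2.2⟩ : TangentSum E F V)) y := by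
    rw [e.contMDiffAt_iff (show _ ∈ e.source from hq)]
    refine ⟨(contMDiffAt_chart_symm hy).comp y contDiff_fst.contMDiff.contMDiffAt, ?_⟩
    refine (contDiff_snd.contMDiff.contMDiffAt (f := Prod.snd)).congr_of_eventuallyEq ?_
    filter_upwards [hmem] with z hz
    have hz' := chart_symm_mem_baseDomain hz.1
    refine Prod.ext ?_ ?_
    · exact ((tanTriv E q₀).continuousLinearMapAt_apply_of_mem (R := ℝ) hz'.1 _).symm.trans
        (Trivialization.continuousLinearMapAt_symmL _ hz'.1 _)
    · exact ((vecTriv F V q₀).continuousLinearMapAt_apply_of_mem (R := ℝ) hz'.2 _).symm.trans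
        (Trivialization.continuousLinearMapAt_symmL _ hz'.2 _)
  exact ((hL _).comp y h1).contDiffAt.contDiffWithinAt

theorem coordLP_isSmoothOn [T2Space Q] (P : LPBundle E F V) {L : TangentSum E F V → ℝ}
    (hL : ContMDiff (𝓘(ℝ, E).prod 𝓘(ℝ, E × F)) 𝓘(ℝ, ℝ) ∞ L) (q₀ : Q) :
    (coordLP P L q₀).IsSmoothOn (coordDomain E F V q₀) where
  isOpen := isOpen_coordDomain q₀
  lag := contDiffOn_coord_lag P hL q₀
  conn := contDiffOn_christoffel P.nabla_smooth q₀
  brk := contDiffOn_toContinuousBilinear fun f g x hx =>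
    (contDiffAt_coord_section hx (P.bracket_smooth _ _ _
      (contMDiffAt_symmL_const hx.2 f) (contMDiffAt_symmL_const hx.2 g))).contDiffWithinAt
  curv := contDiffOn_toContinuousBilinear fun a b x hx =>
    (contDiffAt_coord_section hx (P.twoForm_smooth _ _ _
      (contMDiffAt_symmL_const (chart_symm_mem_baseDomain hx).1 a)
      (contMDiffAt_symmL_const (chart_symm_mem_baseDomain hx).1 b))).contDiffWithinAt
  curv_self x hx a := by simp [coordLP, P.twoForm_self]

theorem fiberDerivVel_eq (P : LPBundle E F V) {L : TangentSum E F V → ℝ}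
    (hL : ContMDiff (𝓘(ℝ, E).prod 𝓘(ℝ, E × F)) 𝓘(ℝ, ℝ) ∞ L) {q₀ : Q} {p : TangentSum E F V}
    (hp : p.proj ∈ baseDomain E F V q₀) (X : TangentSpace 𝓘(ℝ, E) p.proj) :
    fiberDerivVel L p X = velDeriv (coordLP P L q₀).lag (sumCoord q₀ p) (tanCoord E q₀ p.proj X) := by
  have hd : DifferentiableAt ℝ (coordLP P L q₀).lag (sumCoord q₀ p) :=
    ((contDiffOn_coord_lag P hL q₀).contDiffAt (((isOpen_coordDomain q₀).prod
      isOpen_univ).mem_nhds ⟨chart_mem_coordDomain hp, mem_univ _⟩)).differentiableAt (by simp)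
  let e := (tanTriv E q₀).continuousLinearEquivAt ℝ p.proj hp.1
  have he : ∀ u, e u = tanCoord E q₀ p.proj u := fun u =>
    congrFun ((tanTriv E q₀).coe_continuousLinearEquivAt_eq (R := ℝ) hp.1) u
  let g : E → ℝ := fun a =>
    (coordLP P L q₀).lag (chartAt E q₀ p.proj, a, vecCoord F V q₀ p.proj p.2.2)
  have h1 : HasFDerivAt g (velDeriv (coordLP P L q₀).lag (sumCoord q₀ p)) (e p.2.1) := by
    have h2 : HasFDerivAt (fun a : E => (chartAt E q₀ p.proj, a, vecCoord F V q₀ p.proj p.2.2))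
        ((ContinuousLinearMap.inr ℝ E (E × F)).comp (ContinuousLinearMap.inl ℝ E F))
        (e p.2.1) :=
      (hasFDerivAt_prodMk_right _ _).comp (𝕜 := ℝ) (e p.2.1)
        (hasFDerivAt_prodMk_left (𝕜 := ℝ) _ _)
    refine HasFDerivAt.comp (e p.2.1) (g := (coordLP P L q₀).lag) ?_ h2
    rw [he]
    exact hd.hasFDerivAt
  have h3 : (fun u : TangentSpace 𝓘(ℝ, E) p.proj => L ⟨p.proj, u, p.2.2⟩) = fun u => g (e u) := by
    funext u
    rw [coord_lag P L (q₀ := q₀) (p := ⟨p.proj, u, p.2.2⟩) hp]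
    simp only [g, he]
    rfl
  rw [fiberDerivVel, h3]
  rw [fderiv_comp_continuousLinearEquiv e h1.differentiableAt, h1.fderiv]
  simp [he]

theorem fiberDerivVert_eq (P : LPBundle E F V) {L : TangentSum E F V → ℝ}
    (hL : ContMDiff (𝓘(ℝ, E).prod 𝓘(ℝ, E × F)) 𝓘(ℝ, ℝ) ∞ L) {q₀ : Q} {p : TangentSum E F V}
    (hp : p.proj ∈ baseDomain E F V q₀) (Y : V p.proj) :
    fiberDerivVert L p Y =
      vertDeriv (coordLP P L q₀).lag (sumCoord q₀ p) (vecCoord F V q₀ p.proj Y) := by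
  have hd : DifferentiableAt ℝ (coordLP P L q₀).lag (sumCoord q₀ p) :=
    ((contDiffOn_coord_lag P hL q₀).contDiffAt (((isOpen_coordDomain q₀).prod
      isOpen_univ).mem_nhds ⟨chart_mem_coordDomain hp, mem_univ _⟩)).differentiableAt (by simp)
  let e := (vecTriv F V q₀).continuousLinearEquivAt ℝ p.proj hp.2
  have he : ∀ u, e u = vecCoord F V q₀ p.proj u := fun u =>
    congrFun ((vecTriv F V q₀).coe_continuousLinearEquivAt_eq (R := ℝ) hp.2) u
  let g : F → ℝ := fun f =>
    (coordLP P L q₀).lag (chartAt E q₀ p.proj, tanCoord E q₀ p.proj p.2.1, f)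
  have h1 : HasFDerivAt g (vertDeriv (coordLP P L q₀).lag (sumCoord q₀ p)) (e p.2.2) := by
    have h2 : HasFDerivAt (fun f : F => (chartAt E q₀ p.proj, tanCoord E q₀ p.proj p.2.1, f))
        ((ContinuousLinearMap.inr ℝ E (E × F)).comp (ContinuousLinearMap.inr ℝ E F))
        (e p.2.2) :=
      (hasFDerivAt_prodMk_right _ _).comp (𝕜 := ℝ) (e p.2.2)
        (hasFDerivAt_prodMk_right (𝕜 := ℝ) _ _)
    refine HasFDerivAt.comp (e p.2.2) (g := (coordLP P L q₀).lag) ?_ h2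
    rw [he]
    exact hd.hasFDerivAt
  have h3 : (fun u : V p.proj => L ⟨p.proj, p.2.1, u⟩) = fun u => g (e u) := by
    funext u
    rw [coord_lag P L (q₀ := q₀) (p := ⟨p.proj, p.2.1, u⟩) hp]
    simp only [g, he]
    rfl
  rw [fiberDerivVert, h3, fderiv_comp_continuousLinearEquiv e h1.differentiableAt, h1.fderiv]
  simp [he]

end CoordinateExpressions

/-! ### Velocities and covariant derivatives in coordinates -/

section Curves

variable {E : Type*} [NormedAddCommGroup E] [NormedSpace ℝ E]
  {F : Type*} [NormedAddCommGroup F] [NormedSpace ℝ F]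
  {Q : Type*} [TopologicalSpace Q] [ChartedSpace E Q] [IsManifold 𝓘(ℝ, E) ∞ Q]
  {V : Q → Type*} [TopologicalSpace (TotalSpace F V)]
  [∀ x, AddCommGroup (V x)] [∀ x, Module ℝ (V x)] [∀ x, TopologicalSpace (V x)]
  [∀ x, IsTopologicalAddGroup (V x)] [∀ x, ContinuousSMul ℝ (V x)]
  [FiberBundle F V] [VectorBundle ℝ F V]
  [FiniteDimensional ℝ E] [FiniteDimensional ℝ F] [ContMDiffVectorBundle ∞ F V 𝓘(ℝ, E)]

theorem mfderiv_apply_velocity {G : Type*} [NormedAddCommGroup G] [NormedSpace ℝ G] {q : ℝ → Q}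
    {t : ℝ} (hq : MDifferentiableAt 𝓘(ℝ, ℝ) 𝓘(ℝ, E) q t) {h : Q → G}
    (hh : MDifferentiableAt 𝓘(ℝ, E) 𝓘(ℝ, G) h (q t)) :
    mvfderiv 𝓘(ℝ, E) h (q t) (velocity E q t) = deriv (fun s => h (q s)) t := by
  have h1 := mfderiv_comp_apply t hh hq (1 : ℝ)
  have h2 : mfderiv 𝓘(ℝ, ℝ) 𝓘(ℝ, G) (h ∘ q) t (1 : ℝ) = deriv (fun s => h (q s)) t := by
    rw [mfderiv_eq_fderiv]
    exact fderiv_apply_one_eq_deriv (𝕜 := ℝ) (f := fun s => h (q s)) (x := t)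
  exact h1.symm.trans h2

theorem tanCoord_velocity {q : ℝ → Q} {t : ℝ} {q₀ : Q}
    (hq : MDifferentiableAt 𝓘(ℝ, ℝ) 𝓘(ℝ, E) q t) (h0 : q t ∈ (chartAt E q₀).source) :
    tanCoord E q₀ (q t) (velocity E q t) = deriv (fun s => chartAt E q₀ (q s)) t := by
  rw [← mfderiv_apply_velocity hq
    ((contMDiffAt_of_mem_maximalAtlas (n := ∞) (IsManifold.chart_mem_maximalAtlas (I := 𝓘(ℝ, E)) q₀)
      h0).mdifferentiableAt (by simp))]
  rw [tanCoord, TangentBundle.continuousLinearMapAt_trivializationAt h0]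
  rfl

/-- The coordinate expression of the covariant derivative along a curve. The definition of
`covDerivAlong` uses the trivialization at the current base point, so the proof transforms the
derivative of the fibre coordinates to the trivialization at `q₀`. -/
theorem vecCoord_covDerivAlong (nabla : CovariantDerivative 𝓘(ℝ, E) F V) {v : ℝ → TotalSpace F V}
    {t : ℝ} (hv : ContMDiffAt 𝓘(ℝ, ℝ) (𝓘(ℝ, E).prod 𝓘(ℝ, F)) ∞ v t) {q₀ : Q}
    (h0 : (v t).proj ∈ baseDomain E F V q₀) :
    vecCoord F V q₀ (v t).proj (covDerivAlong nabla v t) =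
      deriv (fun s => (vecTriv F V q₀ (v s)).2) t +
      christoffel nabla q₀ (chartAt E q₀ (v t).proj)
        (deriv (fun s => chartAt E q₀ (v s).proj) t) (vecCoord F V q₀ (v t).proj (v t).2) := by
  have hp : ContMDiffAt 𝓘(ℝ, ℝ) 𝓘(ℝ, E) ∞ (fun s => (v s).proj) t :=
    (contMDiffAt_totalSpace.1 hv).1
  have hpd := hp.mdifferentiableAt (by simp)
  set q₁ := (v t).proj with hq₁
  have h1 : q₁ ∈ (vecTriv F V q₁).baseSet := mem_baseSet_trivializationAt F V q₁
  have hf₁ : ContMDiffAt 𝓘(ℝ, ℝ) 𝓘(ℝ, F) ∞ (fun s => (vecTriv F V q₁ (v s)).2) t :=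
    (contMDiffAt_totalSpace.1 hv).2
  have hf₁d : DifferentiableAt ℝ (fun s => (vecTriv F V q₁ (v s)).2) t :=
    hf₁.contDiffAt.differentiableAt (by simp)
  set f₁ := (vecTriv F V q₁ (v t)).2 with hf₁t
  let g : Q → F →L[ℝ] F := fun y => ((vecTriv F V q₁).coordChangeL ℝ (vecTriv F V q₀) y : F →L[ℝ] F)
  have hgM : ContMDiffAt 𝓘(ℝ, E) 𝓘(ℝ, F →L[ℝ] F) ∞ g q₁ := contMDiffAt_coordChangeL h1 h0.2
  have hgd : DifferentiableAt ℝ (fun s => g (v s).proj) t :=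
    (ContMDiffAt.comp (g := g) (f := fun s => (v s).proj) t hgM hp).contDiffAt.differentiableAt (by simp)
  have hg : ∀ y ∈ (vecTriv F V q₁).baseSet ∩ (vecTriv F V q₀).baseSet, ∀ f,
      (vecTriv F V q₀ ⟨y, (vecTriv F V q₁).symm y f⟩).2 = g y f := fun y hy f =>
    ((vecTriv F V q₁).coordChangeL_apply (vecTriv F V q₀) hy f).symm
  have hmem : ∀ᶠ y in 𝓝 q₁, y ∈ (vecTriv F V q₁).baseSet ∩ (vecTriv F V q₀).baseSet :=
    ((vecTriv F V q₁).open_baseSet.inter (vecTriv F V q₀).open_baseSet).mem_nhds ⟨h1, h0.2⟩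
  -- the coordinates at `q₀` are obtained from those at `q₁` by the transition function
  have hf₀ : (fun s => (vecTriv F V q₀ (v s)).2) =ᶠ[𝓝 t]
      fun s => g (v s).proj (vecTriv F V q₁ (v s)).2 := by
    filter_upwards [hp.continuousAt.eventually hmem] with s hs
    rw [← hg _ hs, Trivialization.symm_proj_apply _ _ hs.1]
  have hd₀ : deriv (fun s => (vecTriv F V q₀ (v s)).2) t =
      deriv (fun s => g (v s).proj) t f₁ + g q₁ (deriv (fun s => (vecTriv F V q₁ (v s)).2) t) := by
    rw [hf₀.deriv_eq]
    exact (hasDerivAt_clm_apply hgd.hasDerivAt hf₁d.hasDerivAt).deriv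
  -- the local section with constant components
  have hσ : MDifferentiableAt 𝓘(ℝ, E) (𝓘(ℝ, E).prod 𝓘(ℝ, F))
      (fun y => TotalSpace.mk' F y (FiberBundle.extend F (v t).2 y)) q₁ :=
    FiberBundle.mdifferentiableAt_extend 𝓘(ℝ, E) F (v t).2
  have hσc : (fun z => (vecTriv F V q₀ ⟨z, FiberBundle.extend F (v t).2 z⟩).2) =ᶠ[𝓝 q₁]
      fun z => g z f₁ := by
    filter_upwards [hmem] with z hz
    exact hg z hz f₁
  have hσd : mvfderiv 𝓘(ℝ, E) (fun z => (vecTriv F V q₀ ⟨z, FiberBundle.extend F (v t).2 z⟩).2) q₁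
      (velocity E (fun s => (v s).proj) t) = deriv (fun s => g (v s).proj) t f₁ := by
    have hh : MDifferentiableAt 𝓘(ℝ, E) 𝓘(ℝ, F)
        (fun z => (vecTriv F V q₀ ⟨z, FiberBundle.extend F (v t).2 z⟩).2) q₁ := by
      refine MDifferentiableAt.congr_of_eventuallyEq ?_ hσc
      exact (hgM.clm_apply contMDiffAt_const).mdifferentiableAt (by simp)
    rw [mfderiv_apply_velocity hpd hh]
    have hc : (fun s => (vecTriv F V q₀ ⟨(v s).proj, FiberBundle.extend F (v t).2 (v s).proj⟩).2)
        =ᶠ[𝓝 t] fun s => g (v s).proj f₁ := hp.continuousAt.eventually hσc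
    rw [hc.deriv_eq]
    simpa using (hasDerivAt_clm_apply hgd.hasDerivAt (hasDerivAt_const t f₁)).deriv
  rw [covDerivAlong, map_add, coord_covariantDerivative nabla h0 hσ, hσd,
    FiberBundle.extend_apply_self, tanCoord_velocity hpd h0.1, hd₀,
    (vecTriv F V q₀).continuousLinearMapAt_apply_of_mem (R := ℝ) h0.2, hg _ ⟨h1, h0.2⟩]
  abel

end Curves

/-! ### Partial derivatives of maps of two real variables -/

section Partials

variable {G : Type*} [NormedAddCommGroup G] [NormedSpace ℝ G] {x : ℝ × ℝ → G} {l t : ℝ}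

theorem ContDiffAt.eventually_differentiableAt (hx : ContDiffAt ℝ ∞ x (l, t)) :
    ∀ᶠ p in 𝓝 (l, t), DifferentiableAt ℝ x p :=
  ((hx.of_le (m := 1) ENat.LEInfty.out).eventually (by simp)).mono
    fun _ hp => hp.differentiableAt (by simp)

theorem hasDerivAt_fst_slice (hx : DifferentiableAt ℝ x (l, t)) :
    HasDerivAt (fun m => x (m, t)) (fderiv ℝ x (l, t) (1, 0)) l :=
  hx.hasFDerivAt.comp_hasDerivAt (f := fun m => (m, t)) l
    ((hasDerivAt_id l).prodMk (hasDerivAt_const l t))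

theorem hasDerivAt_snd_slice (hx : DifferentiableAt ℝ x (l, t)) :
    HasDerivAt (fun s => x (l, s)) (fderiv ℝ x (l, t) (0, 1)) t :=
  hx.hasFDerivAt.comp_hasDerivAt (f := fun s => (l, s)) t
    ((hasDerivAt_const t l).prodMk (hasDerivAt_id t))

theorem ContDiffAt.deriv_fst_slice (hx : ContDiffAt ℝ ∞ x (l, t)) :
    ContDiffAt ℝ ∞ (fun p : ℝ × ℝ => deriv (fun m => x (m, p.2)) p.1) (l, t) := by
  have h : ContDiffAt ℝ ∞ (fun p => fderiv ℝ x p (1, 0)) (l, t) :=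
    (hx.fderiv_right (m := ∞) (by simp)).clm_apply contDiffAt_const
  refine h.congr_of_eventuallyEq ?_
  filter_upwards [hx.eventually_differentiableAt] with p hp
  exact (hasDerivAt_fst_slice (l := p.1) (t := p.2) hp).deriv

theorem ContDiffAt.deriv_snd_slice (hx : ContDiffAt ℝ ∞ x (l, t)) :
    ContDiffAt ℝ ∞ (fun p : ℝ × ℝ => deriv (fun s => x (p.1, s)) p.2) (l, t) := by
  have h : ContDiffAt ℝ ∞ (fun p => fderiv ℝ x p (0, 1)) (l, t) :=
    (hx.fderiv_right (m := ∞) (by simp)).clm_apply contDiffAt_const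
  refine h.congr_of_eventuallyEq ?_
  filter_upwards [hx.eventually_differentiableAt] with p hp
  exact (hasDerivAt_snd_slice (l := p.1) (t := p.2) hp).deriv

theorem ContDiffAt.deriv_infty {c : ℝ → G} (hc : ContDiffAt ℝ ∞ c t) :
    ContDiffAt ℝ ∞ (deriv c) t :=
  (hc.fderiv_right (m := ∞) (by simp)).clm_apply (contDiffAt_const (c := (1 : ℝ)))

end Partials

/-! ### Coordinates of jets -/

section Jets
variable {E : Type*} [NormedAddCommGroup E] [NormedSpace ℝ E]
  {F : Type*} [NormedAddCommGroup F] [NormedSpace ℝ F]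
  {Q : Type*} [TopologicalSpace Q] [ChartedSpace E Q] [IsManifold 𝓘(ℝ, E) ∞ Q]
  {V : Q → Type*} [TopologicalSpace (TotalSpace F V)]
  [∀ x, AddCommGroup (V x)] [∀ x, Module ℝ (V x)] [∀ x, TopologicalSpace (V x)]
  [∀ x, IsTopologicalAddGroup (V x)] [∀ x, ContinuousSMul ℝ (V x)]
  [FiberBundle F V] [VectorBundle ℝ F V]
  [FiniteDimensional ℝ E] [FiniteDimensional ℝ F] [ContMDiffVectorBundle ∞ F V 𝓘(ℝ, E)]

theorem contDiffAt_coord_base {N : Type*} [NormedAddCommGroup N] [NormedSpace ℝ N] {q : N → Q}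
    {n : N} (hq : ContMDiffAt 𝓘(ℝ, N) 𝓘(ℝ, E) ∞ q n) {q₀ : Q} (h0 : q n ∈ (chartAt E q₀).source) :
    ContDiffAt ℝ ∞ (fun m => chartAt E q₀ (q m)) n :=
  (ContMDiffAt.comp (g := chartAt E q₀) (f := q) n
    (contMDiffAt_of_mem_maximalAtlas (n := ∞)
      (IsManifold.chart_mem_maximalAtlas (I := 𝓘(ℝ, E)) q₀) h0) hq).contDiffAt

theorem contMDiffAt_base {N : Type*} [NormedAddCommGroup N] [NormedSpace ℝ N]
    {v : N → TotalSpace F V} {n : N} (hv : ContMDiffAt 𝓘(ℝ, N) (𝓘(ℝ, E).prod 𝓘(ℝ, F)) ∞ v n) :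
    ContMDiffAt 𝓘(ℝ, N) 𝓘(ℝ, E) ∞ (fun m => (v m).proj) n :=
  (contMDiffAt_totalSpace.1 hv).1

theorem contDiffAt_coord_fibre {N : Type*} [NormedAddCommGroup N] [NormedSpace ℝ N]
    {v : N → TotalSpace F V} {n : N} (hv : ContMDiffAt 𝓘(ℝ, N) (𝓘(ℝ, E).prod 𝓘(ℝ, F)) ∞ v n)
    {q₀ : Q} (h0 : (v n).proj ∈ (vecTriv F V q₀).baseSet) :
    ContDiffAt ℝ ∞ (fun m => (vecTriv F V q₀ (v m)).2) n :=
  (((vecTriv F V q₀).contMDiffAt_iff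
    ((vecTriv F V q₀).mem_source.2 h0)).1 hv).2.contDiffAt

/-- The 2-jet of a curve, in the trivialization of `T⁽²⁾Q` given by the chart at `q₀`, consists of
the first two derivatives of the curve in that chart. -/
theorem trivialization_jetTwo {q : ℝ → Q} {t : ℝ} (hq : ContMDiffAt 𝓘(ℝ, ℝ) 𝓘(ℝ, E) ∞ q t) {q₀ : Q}
    (h0 : q t ∈ (chartAt E q₀).source) :
    (trivializationAt (E × E) (JetSpace E Q) q₀ ⟨q t, jetTwo E q t⟩).2 =
      (deriv (fun s => chartAt E q₀ (q s)) t,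
        deriv (deriv (fun s => chartAt E q₀ (q s))) t) := by
  set φ₁ := chartAt E (q t) with hφ₁
  set φ₀ := chartAt E q₀ with hφ₀
  have h1 : q t ∈ φ₁.source := mem_chart_source E (q t)
  let T := φ₀ ∘ φ₁.symm
  let c := fun s => φ₁ (q s)
  have hT : ContDiffAt ℝ ∞ T (c t) :=
    (contDiffOn_transition E Q (achart E (q t)) (achart E q₀)).contDiffAt
      ((φ₁.symm.trans φ₀).open_source.mem_nhds
        (mem_transition_source E Q (i := achart E (q t)) (j := achart E q₀) h1 h0))
  have hc : ContDiffAt ℝ ∞ c t := contDiffAt_coord_base hq h1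
  have hcT : ∀ᶠ s in 𝓝 t, φ₀ (q s) = T (c s) := by
    filter_upwards [hq.continuousAt.eventually (φ₁.open_source.mem_nhds h1)] with s hs
    simp [T, c, φ₁.left_inv hs]
  have hTd : ∀ᶠ s in 𝓝 t, DifferentiableAt ℝ T (c s) :=
    hc.continuousAt.eventually (((hT.of_le (m := 1) ENat.LEInfty.out).eventually (by simp)).mono
      fun _ hp => hp.differentiableAt (by simp))
  have hcd : ∀ᶠ s in 𝓝 t, DifferentiableAt ℝ c s :=
    ((hc.of_le (m := 1) ENat.LEInfty.out).eventually (by simp)).mono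
      fun _ hp => hp.differentiableAt (by simp)
  have hd1 : (deriv fun s => φ₀ (q s)) =ᶠ[𝓝 t] fun s => fderiv ℝ T (c s) (deriv c s) := by
    filter_upwards [hcT.eventually_nhds, hTd, hcd] with s h1 h2 h3
    rw [Filter.EventuallyEq.deriv_eq (f := fun s => T (c s)) h1]
    exact (h2.hasFDerivAt.comp_hasDerivAt (f := c) s h3.hasDerivAt).deriv
  have hT2 : HasDerivAt (fun s => fderiv ℝ T (c s))
      (fderiv ℝ (fderiv ℝ T) (c t) (deriv c t)) t :=
    ((hT.fderiv_right (m := 1) (by norm_cast)).differentiableAt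
      (by simp)).hasFDerivAt.comp_hasDerivAt (f := c) t hcd.self_of_nhds.hasDerivAt
  have hc2 : HasDerivAt (deriv c) (deriv (deriv c) t) t :=
    (hc.deriv_infty.differentiableAt (by simp)).hasDerivAt
  rw [hd1.deriv_eq, hd1.eq_of_nhds, (hasDerivAt_clm_apply hT2 hc2).deriv]
  rfl

variable (E F V) in
/-- The total space of `T⁽²⁾Q ⊕ 2V`. -/
abbrev JetSum : Type _ :=
  TotalSpace ((E × E) × (F × F)) (fun q : Q => JetSpace E Q q × (V q × V q))

/-- The curve `[q]⁽²⁾ ⊕ [v]⁽¹⁾` in `T⁽²⁾Q ⊕ 2V` determined by a curve `v` in `V` over `q`. -/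
def jetLift (nabla : CovariantDerivative 𝓘(ℝ, E) F V) (v : ℝ → TotalSpace F V) (t : ℝ) :
    JetSum E F V :=
  ⟨(v t).proj, jetTwo E (fun s => (v s).proj) t, ((v t).2, covDerivAlong nabla v t)⟩

/-- Coordinates on `T⁽²⁾Q ⊕ 2V`. The last coordinate is chosen to be the ordinary derivative of the
fibre coordinates, so that along `jetLift` all coordinates are derivatives of coordinates of the
curve. -/
def jetCoord (nabla : CovariantDerivative 𝓘(ℝ, E) F V) (q₀ : Q) (p : JetSum E F V) :
    E × (E × E) × (F × F) :=
  letI y := (trivializationAt ((E × E) × (F × F))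
    (fun q : Q => JetSpace E Q q × (V q × V q)) q₀ p).2
  (chartAt E q₀ p.proj, y.1,
    (y.2.1, y.2.2 - christoffel nabla q₀ (chartAt E q₀ p.proj) y.1.1 y.2.1))

theorem jetCoord_jetLift (nabla : CovariantDerivative 𝓘(ℝ, E) F V) {v : ℝ → TotalSpace F V}
    {t : ℝ} (hv : ContMDiffAt 𝓘(ℝ, ℝ) (𝓘(ℝ, E).prod 𝓘(ℝ, F)) ∞ v t) {q₀ : Q}
    (h0 : (v t).proj ∈ baseDomain E F V q₀) :
    jetCoord nabla q₀ (jetLift nabla v t) =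
      (chartAt E q₀ (v t).proj, (deriv (fun s => chartAt E q₀ (v s).proj) t,
        deriv (deriv (fun s => chartAt E q₀ (v s).proj)) t),
        ((vecTriv F V q₀ (v t)).2, deriv (fun s => (vecTriv F V q₀ (v s)).2) t)) := by
  have h1 := trivialization_jetTwo (contMDiffAt_base hv) h0.1
  have h2 := vecCoord_covDerivAlong nabla hv h0
  rw [vecCoord, (vecTriv F V q₀).continuousLinearMapAt_apply_of_mem (R := ℝ) h0.2,
    Trivialization.continuousLinearMapAt_apply_of_mem (R := ℝ) _ h0.2] at h2
  have h3 : (trivializationAt ((E × E) × (F × F)) (fun q : Q => JetSpace E Q q × (V q × V q)) q₀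
      (jetLift nabla v t)).2 = ((trivializationAt (E × E) (JetSpace E Q) q₀
        ⟨(v t).proj, jetTwo E (fun s => (v s).proj) t⟩).2, ((vecTriv F V q₀ (v t)).2,
          (vecTriv F V q₀ ⟨(v t).proj, covDerivAlong nabla v t⟩).2)) := rfl
  simp only [jetCoord, h3, h1, h2]
  simp [jetLift]

/-- The map `jetCoord` is injective over the domain of the coordinates, so that an element of
`T⁽²⁾Q ⊕ 2V` can be identified by its coordinates. -/
theorem jetCoord_injective (nabla : CovariantDerivative 𝓘(ℝ, E) F V) {q₀ : Q} {p p' : JetSum E F V}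
    (hp : p.proj ∈ baseDomain E F V q₀) (hp' : p'.proj ∈ baseDomain E F V q₀)
    (h : jetCoord nabla q₀ p = jetCoord nabla q₀ p') : p = p' := by
  simp only [jetCoord, Prod.mk.injEq] at h
  obtain ⟨h1, h2, h3, h4⟩ := h
  have hproj : p.proj = p'.proj := (chartAt E q₀).injOn hp.1 hp'.1 h1
  refine (trivializationAt ((E × E) × (F × F)) (fun q : Q => JetSpace E Q q × (V q × V q))
    q₀).injOn ((Trivialization.mem_source _).2 ⟨hp.1, hp.2, hp.2⟩)
    ((Trivialization.mem_source _).2 ⟨hp'.1, hp'.2, hp'.2⟩) (Prod.ext hproj ?_)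
  refine Prod.ext h2 (Prod.ext h3 ?_)
  rw [h1, h2, h3] at h4
  exact sub_left_injective h4

end Jets

/-! ### The intrinsic first variation formula -/

section FirstVariation

variable {E : Type*} [NormedAddCommGroup E] [NormedSpace ℝ E]
  {F : Type*} [NormedAddCommGroup F] [NormedSpace ℝ F]
  {Q : Type*} [TopologicalSpace Q] [ChartedSpace E Q] [IsManifold 𝓘(ℝ, E) ∞ Q]
  {V : Q → Type*} [TopologicalSpace (TotalSpace F V)]
  [∀ x, AddCommGroup (V x)] [∀ x, Module ℝ (V x)] [∀ x, TopologicalSpace (V x)]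
  [∀ x, IsTopologicalAddGroup (V x)] [∀ x, ContinuousSMul ℝ (V x)]
  [FiberBundle F V] [VectorBundle ℝ F V]
  [FiniteDimensional ℝ E] [FiniteDimensional ℝ F] [ContMDiffVectorBundle ∞ F V 𝓘(ℝ, E)]

theorem sumCoord_liftCurve {u : ℝ → TotalSpace F V} {t : ℝ}
    (hu : ContMDiffAt 𝓘(ℝ, ℝ) (𝓘(ℝ, E).prod 𝓘(ℝ, F)) ∞ u t) {q₀ : Q}
    (h0 : (u t).proj ∈ baseDomain E F V q₀) :
    sumCoord q₀ (liftCurve (E := E) u t) = (chartAt E q₀ (u t).proj,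
      deriv (fun s => chartAt E q₀ (u s).proj) t, (vecTriv F V q₀ (u t)).2) := by
  refine Prod.ext rfl (Prod.ext ?_ ?_)
  · exact tanCoord_velocity ((contMDiffAt_base hu).mdifferentiableAt (by simp)) h0.1
  · exact (vecTriv F V q₀).continuousLinearMapAt_apply_of_mem (R := ℝ) h0.2 _

/-- The Lagrange–Poincaré expressions as computed in the coordinates at `q₀`, as covectors at the
base point. That they do not depend on `q₀` is `localLP_eq`. -/
def localLP (P : LPBundle E F V) (L : TangentSum E F V → ℝ) (q₀ : Q) (p : JetSum E F V) :
    (TangentSpace 𝓘(ℝ, E) p.proj →L[ℝ] ℝ) × (V p.proj →L[ℝ] ℝ) :=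
  (((coordLP P L q₀).hor (jetCoord P.nabla q₀ p)).comp (tanCoord E q₀ p.proj),
    ((coordLP P L q₀).ver (jetCoord P.nabla q₀ p)).comp (vecCoord F V q₀ p.proj))

/-- The boundary term `⟨∂L/∂q̇, δq⟩ + ⟨∂L/∂v, w⟩` of the first variation. -/
def boundaryTerm (L : TangentSum E F V → ℝ) (v : ℝ → ℝ → TotalSpace F V)
    (w : ∀ t, V (v 0 t).proj) (t : ℝ) : ℝ :=
  fiberDerivVel L (liftCurve (v 0) t) (velocity E (fun lam => (v lam t).proj) 0) +
    fiberDerivVert L (liftCurve (v 0) t) (w t)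

/-- The failure of the variation of `v` to be the allowed one determined by `w`. -/
def variationDefect (P : LPBundle E F V) (v : ℝ → ℝ → TotalSpace F V)
    (w : ∀ t, V (v 0 t).proj) (t : ℝ) : V (v 0 t).proj :=
  covDerivAlong P.nabla (fun lam => v lam t) 0 -
    (covDerivAlong P.nabla (fun s => TotalSpace.mk' F (v 0 s).proj (w s)) t +
      P.bracket (v 0 t).proj (v 0 t).2 (w t) +
      P.twoForm (v 0 t).proj (velocity E (fun lam => (v lam t).proj) 0)
        (velocity E (fun s => (v 0 s).proj) t))

section Family

variable {v : ℝ → ℝ → TotalSpace F V} {w : ∀ t, V (v 0 t).proj}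

theorem contMDiff_snd_slice
    (hv : ContMDiff 𝓘(ℝ, ℝ × ℝ) (𝓘(ℝ, E).prod 𝓘(ℝ, F)) ∞ (fun p : ℝ × ℝ => v p.1 p.2)) (l : ℝ) :
    ContMDiff 𝓘(ℝ, ℝ) (𝓘(ℝ, E).prod 𝓘(ℝ, F)) ∞ (v l) :=
  hv.comp (g := fun p : ℝ × ℝ => v p.1 p.2) (f := fun s : ℝ => (l, s))
    (ContDiff.contMDiff (by fun_prop))

theorem contMDiff_fst_slice
    (hv : ContMDiff 𝓘(ℝ, ℝ × ℝ) (𝓘(ℝ, E).prod 𝓘(ℝ, F)) ∞ (fun p : ℝ × ℝ => v p.1 p.2)) (t : ℝ) :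
    ContMDiff 𝓘(ℝ, ℝ) (𝓘(ℝ, E).prod 𝓘(ℝ, F)) ∞ (fun l => v l t) :=
  hv.comp (g := fun p : ℝ × ℝ => v p.1 p.2) (f := fun l : ℝ => (l, t))
    (ContDiff.contMDiff (by fun_prop))

theorem contDiffAt_family_base
    (hv : ContMDiff 𝓘(ℝ, ℝ × ℝ) (𝓘(ℝ, E).prod 𝓘(ℝ, F)) ∞ (fun p : ℝ × ℝ => v p.1 p.2))
    {q₀ : Q} {l t : ℝ} (h0 : (v l t).proj ∈ baseDomain E F V q₀) :
    ContDiffAt ℝ ∞ (fun p : ℝ × ℝ => chartAt E q₀ (v p.1 p.2).proj) (l, t) :=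
  contDiffAt_coord_base (q := fun p : ℝ × ℝ => (v p.1 p.2).proj) (contMDiffAt_base (hv _)) h0.1

theorem contDiffAt_family_fibre
    (hv : ContMDiff 𝓘(ℝ, ℝ × ℝ) (𝓘(ℝ, E).prod 𝓘(ℝ, F)) ∞ (fun p : ℝ × ℝ => v p.1 p.2))
    {q₀ : Q} {l t : ℝ} (h0 : (v l t).proj ∈ baseDomain E F V q₀) :
    ContDiffAt ℝ ∞ (fun p : ℝ × ℝ => (vecTriv F V q₀ (v p.1 p.2)).2) (l, t) :=
  contDiffAt_coord_fibre (v := fun p : ℝ × ℝ => v p.1 p.2) (hv _) h0.2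

theorem eventually_family_mem
    (hv : ContMDiff 𝓘(ℝ, ℝ × ℝ) (𝓘(ℝ, E).prod 𝓘(ℝ, F)) ∞ (fun p : ℝ × ℝ => v p.1 p.2))
    {q₀ : Q} {l t : ℝ} (h0 : (v l t).proj ∈ baseDomain E F V q₀) :
    ∀ᶠ p : ℝ × ℝ in 𝓝 (l, t), (v p.1 p.2).proj ∈ baseDomain E F V q₀ :=
  (contMDiffAt_base (v := fun p : ℝ × ℝ => v p.1 p.2) (hv (l, t))).continuousAt.eventually
    ((isOpen_baseDomain q₀).mem_nhds h0)

/-- The coordinates of `q̇ ⊕ v` depend smoothly on both parameters of a deformation. -/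
theorem contDiffAt_family_liftCurve
    (hv : ContMDiff 𝓘(ℝ, ℝ × ℝ) (𝓘(ℝ, E).prod 𝓘(ℝ, F)) ∞ (fun p : ℝ × ℝ => v p.1 p.2))
    {q₀ : Q} {l t : ℝ} (h0 : (v l t).proj ∈ baseDomain E F V q₀) :
    ContDiffAt ℝ ∞ (fun p : ℝ × ℝ => sumCoord q₀ (liftCurve (E := E) (v p.1) p.2)) (l, t) := by
  refine ((contDiffAt_family_base hv h0).prodMk ((contDiffAt_family_base hv h0).deriv_snd_slice.prodMk
    (contDiffAt_family_fibre hv h0))).congr_of_eventuallyEq ?_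
  filter_upwards [eventually_family_mem hv h0] with p hp
  exact sumCoord_liftCurve (contMDiff_snd_slice hv p.1 p.2) hp

theorem contDiff_lagrangian_family (P : LPBundle E F V) {L : TangentSum E F V → ℝ}
    (hL : ContMDiff (𝓘(ℝ, E).prod 𝓘(ℝ, E × F)) 𝓘(ℝ, ℝ) ∞ L)
    (hv : ContMDiff 𝓘(ℝ, ℝ × ℝ) (𝓘(ℝ, E).prod 𝓘(ℝ, F)) ∞ (fun p : ℝ × ℝ => v p.1 p.2)) :
    ContDiff ℝ ∞ (fun p : ℝ × ℝ => L (liftCurve (v p.1) p.2)) := by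
  refine contDiff_iff_contDiffAt.2 fun ⟨l, t⟩ => ?_
  have h0 := mem_baseDomain_self (E := E) (F := F) (V := V) (v l t).proj
  have h1 : ContDiffAt ℝ ∞ (coordLP P L (v l t).proj).lag
      (sumCoord (v l t).proj (liftCurve (E := E) (v l) t)) :=
    (contDiffOn_coord_lag P hL (v l t).proj).contDiffAt (((isOpen_coordDomain _).prod
      isOpen_univ).mem_nhds ⟨chart_mem_coordDomain h0, mem_univ _⟩)
  refine (ContDiffAt.comp (f := fun p : ℝ × ℝ =>
    sumCoord (v l t).proj (liftCurve (E := E) (v p.1) p.2)) (l, t) h1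
    (contDiffAt_family_liftCurve hv h0)).congr_of_eventuallyEq ?_
  filter_upwards [eventually_family_mem hv h0] with p hp
  exact coord_lag P L (p := liftCurve (v p.1) p.2) hp

theorem boundaryTerm_eq (P : LPBundle E F V) {L : TangentSum E F V → ℝ}
    (hL : ContMDiff (𝓘(ℝ, E).prod 𝓘(ℝ, E × F)) 𝓘(ℝ, ℝ) ∞ L)
    (hv : ContMDiff 𝓘(ℝ, ℝ × ℝ) (𝓘(ℝ, E).prod 𝓘(ℝ, F)) ∞ (fun p : ℝ × ℝ => v p.1 p.2))
    {q₀ : Q} {t : ℝ} (h0 : (v 0 t).proj ∈ baseDomain E F V q₀) :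
    boundaryTerm L v w t =
      velDeriv (coordLP P L q₀).lag (sumCoord q₀ (liftCurve (E := E) (v 0) t))
        (deriv (fun l => chartAt E q₀ (v l t).proj) 0) +
      vertDeriv (coordLP P L q₀).lag (sumCoord q₀ (liftCurve (E := E) (v 0) t))
        (vecTriv F V q₀ ⟨(v 0 t).proj, w t⟩).2 := by
  have h1 : tanCoord E q₀ (v 0 t).proj (velocity E (fun lam => (v lam t).proj) 0) =
      deriv (fun l => chartAt E q₀ (v l t).proj) 0 :=
    tanCoord_velocity ((contMDiffAt_base (contMDiff_fst_slice hv t 0)).mdifferentiableAt (by simp))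
      h0.1
  have h2 : vecCoord F V q₀ (v 0 t).proj (w t) = (vecTriv F V q₀ ⟨(v 0 t).proj, w t⟩).2 :=
    (vecTriv F V q₀).continuousLinearMapAt_apply_of_mem (R := ℝ) h0.2 _
  exact congrArg₂ _
    ((fiberDerivVel_eq P hL (q₀ := q₀) (p := liftCurve (v 0) t) h0 _).trans (congrArg _ h1))
    ((fiberDerivVert_eq P hL (q₀ := q₀) (p := liftCurve (v 0) t) h0 _).trans (congrArg _ h2))

theorem contDiff_boundaryTerm (P : LPBundle E F V) {L : TangentSum E F V → ℝ}
    (hL : ContMDiff (𝓘(ℝ, E).prod 𝓘(ℝ, E × F)) 𝓘(ℝ, ℝ) ∞ L)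
    (hv : ContMDiff 𝓘(ℝ, ℝ × ℝ) (𝓘(ℝ, E).prod 𝓘(ℝ, F)) ∞ (fun p : ℝ × ℝ => v p.1 p.2))
    (hw : ContMDiff 𝓘(ℝ, ℝ) (𝓘(ℝ, E).prod 𝓘(ℝ, F)) ∞
      (fun t => TotalSpace.mk' F (v 0 t).proj (w t))) :
    ContDiff ℝ ∞ (boundaryTerm L v w) := by
  refine contDiff_iff_contDiffAt.2 fun t => ?_
  have h0 := mem_baseDomain_self (E := E) (F := F) (V := V) (v 0 t).proj
  set q₀ := (v 0 t).proj with hq₀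
  have hopen := (isOpen_coordDomain (E := E) (F := F) (V := V) q₀).prod
    (isOpen_univ (X := E × F))
  have hl := contDiffOn_coord_lag P hL q₀
  have hmem : coordDomain E F V q₀ ×ˢ univ ∈ 𝓝 (sumCoord q₀ (liftCurve (E := E) (v 0) t)) :=
    hopen.mem_nhds ⟨chart_mem_coordDomain h0, mem_univ _⟩
  have hline : ContDiffAt ℝ ∞ (fun s : ℝ => ((0 : ℝ), s)) t := by fun_prop
  have hs : ContDiffAt ℝ ∞ (fun s => sumCoord q₀ (liftCurve (E := E) (v 0) s)) t :=
    ContDiffAt.comp (g := fun p : ℝ × ℝ => sumCoord q₀ (liftCurve (E := E) (v p.1) p.2))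
      (f := fun s : ℝ => ((0 : ℝ), s)) t (contDiffAt_family_liftCurve hv h0) hline
  have hδ : ContDiffAt ℝ ∞ (fun s => deriv (fun l => chartAt E q₀ (v l s).proj) 0) t :=
    ContDiffAt.comp
      (g := fun p : ℝ × ℝ => deriv (fun l => chartAt E q₀ (v l p.2).proj) p.1)
      (f := fun s : ℝ => ((0 : ℝ), s)) t (contDiffAt_family_base hv h0).deriv_fst_slice hline
  have hz := contDiffAt_coord_fibre (hw t) (q₀ := q₀) h0.2
  have h1 := (((hl.velDeriv hopen).contDiffAt hmem).comp t hs).clm_apply hδ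
  have h2 := (((hl.vertDeriv hopen).contDiffAt hmem).comp t hs).clm_apply hz
  refine (h1.add h2).congr_of_eventuallyEq ?_
  filter_upwards [hline.continuousAt.eventually (eventually_family_mem hv h0)] with s hs
  exact boundaryTerm_eq P hL hv hs

/-- The coordinate expression of the defect of the constraint on the variation. -/
theorem vecCoord_variationDefect (P : LPBundle E F V) (L : TangentSum E F V → ℝ)
    (hv : ContMDiff 𝓘(ℝ, ℝ × ℝ) (𝓘(ℝ, E).prod 𝓘(ℝ, F)) ∞ (fun p : ℝ × ℝ => v p.1 p.2))
    (hw : ContMDiff 𝓘(ℝ, ℝ) (𝓘(ℝ, E).prod 𝓘(ℝ, F)) ∞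
      (fun t => TotalSpace.mk' F (v 0 t).proj (w t)))
    {q₀ : Q} {t : ℝ} (h0 : (v 0 t).proj ∈ baseDomain E F V q₀) :
    letI D := coordLP P L q₀
    letI x := fun s => chartAt E q₀ (v 0 s).proj
    letI δx := deriv (fun l => chartAt E q₀ (v l t).proj) 0
    letI f := (vecTriv F V q₀ (v 0 t)).2
    letI z := fun s => (vecTriv F V q₀ ⟨(v 0 s).proj, w s⟩).2
    vecCoord F V q₀ (v 0 t).proj (variationDefect P v w t) =
      deriv (fun l => (vecTriv F V q₀ (v l t)).2) 0 + D.conn (x t) δx f -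
        (deriv z t + D.conn (x t) (deriv x t) (z t) + D.brk (x t) f (z t) +
          D.curv (x t) δx (deriv x t)) := by
  have hv0 := contMDiff_snd_slice hv 0
  have hvt := contMDiff_fst_slice hv t
  have hδt : tanCoord E q₀ (v 0 t).proj (velocity E (fun lam => (v lam t).proj) 0) =
      deriv (fun l => chartAt E q₀ (v l t).proj) 0 :=
    tanCoord_velocity ((contMDiffAt_base (hvt 0)).mdifferentiableAt (by simp)) h0.1
  have hat : tanCoord E q₀ (v 0 t).proj (velocity E (fun s => (v 0 s).proj) t) =
      deriv (fun s => chartAt E q₀ (v 0 s).proj) t :=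
    tanCoord_velocity ((contMDiffAt_base (hv0 t)).mdifferentiableAt (by simp)) h0.1
  have hzt : vecCoord F V q₀ (v 0 t).proj (w t) = (vecTriv F V q₀ ⟨(v 0 t).proj, w t⟩).2 :=
    (vecTriv F V q₀).continuousLinearMapAt_apply_of_mem (R := ℝ) h0.2 _
  have hft : vecCoord F V q₀ (v 0 t).proj (v 0 t).2 = (vecTriv F V q₀ (v 0 t)).2 :=
    (vecTriv F V q₀).continuousLinearMapAt_apply_of_mem (R := ℝ) h0.2 _
  have k1 := vecCoord_covDerivAlong P.nabla (hvt 0) (q₀ := q₀) h0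
  have k2 := vecCoord_covDerivAlong P.nabla (hw t) (q₀ := q₀) h0
  have k3 := coord_bracket P L h0 (v 0 t).2 (w t)
  have k4 := coord_twoForm P L h0 (velocity E (fun lam => (v lam t).proj) 0)
    (velocity E (fun s => (v 0 s).proj) t)
  rw [variationDefect, map_sub, map_add, map_add, k3, k4, hδt, hat, hzt, hft]
  rw [hft] at k1
  refine congrArg₂ _ k1 (congrArg₂ _ (congrArg₂ _ (k2.trans ?_) rfl) rfl)
  exact congrArg₂ _ rfl (congrArg _ hzt)

/-- Pointwise first variation formula. All terms other than `localLP` are defined without reference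
to the coordinates at `q₀`. -/
theorem hasDerivAt_boundaryTerm [T2Space Q] (P : LPBundle E F V) {L : TangentSum E F V → ℝ}
    (hL : ContMDiff (𝓘(ℝ, E).prod 𝓘(ℝ, E × F)) 𝓘(ℝ, ℝ) ∞ L)
    (hv : ContMDiff 𝓘(ℝ, ℝ × ℝ) (𝓘(ℝ, E).prod 𝓘(ℝ, F)) ∞ (fun p : ℝ × ℝ => v p.1 p.2))
    (hw : ContMDiff 𝓘(ℝ, ℝ) (𝓘(ℝ, E).prod 𝓘(ℝ, F)) ∞
      (fun t => TotalSpace.mk' F (v 0 t).proj (w t)))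
    {q₀ : Q} {t : ℝ} (h0 : (v 0 t).proj ∈ baseDomain E F V q₀) :
    HasDerivAt (boundaryTerm L v w)
      (deriv (fun l => L (liftCurve (v l) t)) 0 -
        (localLP P L q₀ (jetLift P.nabla (v 0) t)).1 (velocity E (fun lam => (v lam t).proj) 0) -
        (localLP P L q₀ (jetLift P.nabla (v 0) t)).2 (w t) -
        fiberDerivVert L (liftCurve (v 0) t) (variationDefect P v w t)) t := by
  have hS := coordLP_isSmoothOn P hL q₀
  set D := coordLP P L q₀ with hD
  have hx := contDiffAt_family_base hv h0
  have hf := contDiffAt_family_fibre hv h0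
  have hline : ContDiffAt ℝ ∞ (fun s : ℝ => ((0 : ℝ), s)) t := by fun_prop
  have hline' : ContDiffAt ℝ ∞ (fun l : ℝ => (l, t)) 0 := by fun_prop
  have hv0 := contMDiff_snd_slice hv 0
  have hvt := contMDiff_fst_slice hv t
  have hev := hline.continuousAt.eventually (eventually_family_mem hv h0)
  have hev' := hline'.continuousAt.eventually (eventually_family_mem hv h0)
  let x : ℝ → E := fun s => chartAt E q₀ (v 0 s).proj
  let f : ℝ → F := fun s => (vecTriv F V q₀ (v 0 s)).2
  let δx : ℝ → E := fun s => deriv (fun l => chartAt E q₀ (v l s).proj) 0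
  let z : ℝ → F := fun s => (vecTriv F V q₀ ⟨(v 0 s).proj, w s⟩).2
  have hxc : ContDiffAt ℝ ∞ x t := contDiffAt_coord_base (contMDiffAt_base (hv0 t)) h0.1
  have hxd : HasDerivAt x (deriv x t) t := (hxc.differentiableAt (by simp)).hasDerivAt
  have had : HasDerivAt (deriv x) (deriv (deriv x) t) t :=
    (hxc.deriv_infty.differentiableAt (by simp)).hasDerivAt
  have hfd : HasDerivAt f (deriv f t) t :=
    ((contDiffAt_coord_fibre (hv0 t) h0.2).differentiableAt (by simp)).hasDerivAt
  have hδd : HasDerivAt δx (deriv δx t) t := by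
    have : ContDiffAt ℝ ∞ δx t := ContDiffAt.comp
      (g := fun p : ℝ × ℝ => deriv (fun l => chartAt E q₀ (v l p.2).proj) p.1)
      (f := fun s : ℝ => ((0 : ℝ), s)) t hx.deriv_fst_slice hline
    exact (this.differentiableAt (by simp)).hasDerivAt
  have hzd : HasDerivAt z (deriv z t) t :=
    ((contDiffAt_coord_fibre (hw t) h0.2).differentiableAt (by simp)).hasDerivAt
  let δf : F := deriv (fun l => (vecTriv F V q₀ (v l t)).2) 0
  have hvel : ∀ {s}, (v 0 s).proj ∈ baseDomain E F V q₀ →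
      sumCoord q₀ (liftCurve (E := E) (v 0) s) = (x s, deriv x s, f s) := fun hs =>
    sumCoord_liftCurve (hv0 _) hs
  have hδt : tanCoord E q₀ (v 0 t).proj (velocity E (fun lam => (v lam t).proj) 0) = δx t :=
    tanCoord_velocity ((contMDiffAt_base (hvt 0)).mdifferentiableAt (by simp)) h0.1
  have hzt : vecCoord F V q₀ (v 0 t).proj (w t) = z t :=
    (vecTriv F V q₀).continuousLinearMapAt_apply_of_mem (R := ℝ) h0.2 _
  have hjet := jetCoord_jetLift P.nabla (hv0 t) h0
  -- the variation of the Lagrangian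
  have hLd : deriv (fun l => L (liftCurve (v l) t)) 0 =
      fderiv ℝ D.lag (x t, deriv x t, f t) (δx t, deriv δx t, δf) := by
    have e1 : (fun l => L (liftCurve (v l) t)) =ᶠ[𝓝 0] fun l => D.lag
        (chartAt E q₀ (v l t).proj, deriv (fun s => chartAt E q₀ (v l s).proj) t,
          (vecTriv F V q₀ (v l t)).2) := by
      filter_upwards [hev'] with l hl
      rw [coord_lag P L (q₀ := q₀) (p := liftCurve (v l) t) hl,
        sumCoord_liftCurve (contMDiff_snd_slice hv l t) hl]
    have d1 : HasDerivAt (fun l => chartAt E q₀ (v l t).proj) (δx t) 0 :=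
      ((ContDiffAt.comp (f := fun l : ℝ => (l, t)) 0 hx hline').differentiableAt
        (by simp)).hasDerivAt
    have d2 : HasDerivAt (fun l => deriv (fun s => chartAt E q₀ (v l s).proj) t)
        (deriv δx t) 0 := by
      have h : ContDiffAt ℝ ∞ (fun l => deriv (fun s => chartAt E q₀ (v l s).proj) t) 0 :=
        ContDiffAt.comp
          (g := fun p : ℝ × ℝ => deriv (fun s => chartAt E q₀ (v p.1 s).proj) p.2)
          (f := fun l : ℝ => (l, t)) 0 hx.deriv_snd_slice hline'
      have h' := (h.differentiableAt (by simp)).hasDerivAt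
      rwa [deriv_deriv_comm (x := fun p : ℝ × ℝ => chartAt E q₀ (v p.1 p.2).proj) hx] at h'
    have d3 : HasDerivAt (fun l => (vecTriv F V q₀ (v l t)).2) δf 0 :=
      ((contDiffAt_coord_fibre (hvt 0) h0.2).differentiableAt (by simp)).hasDerivAt
    have hDd : HasFDerivAt D.lag (fderiv ℝ D.lag (x t, deriv x t, f t)) (x t, deriv x t, f t) :=
      ((hS.lag.contDiffAt (hS.isOpen_prod.mem_nhds
        ⟨chart_mem_coordDomain h0, mem_univ _⟩)).differentiableAt (by simp)).hasFDerivAt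
    rw [e1.deriv_eq]
    exact (hDd.comp_hasDerivAt (f := fun l => (chartAt E q₀ (v l t).proj,
      deriv (fun s => chartAt E q₀ (v l s).proj) t, (vecTriv F V q₀ (v l t)).2)) 0
      (d1.prodMk (d2.prodMk d3))).deriv
  have hdef : vecCoord F V q₀ (v 0 t).proj (variationDefect P v w t) =
      δf + D.conn (x t) (δx t) (f t) - (deriv z t + D.conn (x t) (deriv x t) (z t) +
        D.brk (x t) (f t) (z t) + D.curv (x t) (δx t) (deriv x t)) :=
    vecCoord_variationDefect P L hv hw h0
  have key := CoordLP.hasDerivAt_boundary hS (chart_mem_coordDomain h0) hxd had hfd hδd hzd (δf := δf)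
  have hG : boundaryTerm L v w =ᶠ[𝓝 t] fun s =>
      velDeriv D.lag (x s, deriv x s, f s) (δx s) +
        vertDeriv D.lag (x s, deriv x s, f s) (z s) := by
    filter_upwards [hev] with s hs
    rw [boundaryTerm_eq P hL hv hs, hvel hs]
  refine (key.congr_of_eventuallyEq hG).congr_deriv ?_
  have r1 : (localLP P L q₀ (jetLift P.nabla (v 0) t)).1
      (velocity E (fun lam => (v lam t).proj) 0) =
      D.hor (x t, (deriv x t, deriv (deriv x) t), (f t, deriv f t)) (δx t) := by
    rw [← hδt]
    exact congrArg (fun y => D.hor y (tanCoord E q₀ (v 0 t).proj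
      (velocity E (fun lam => (v lam t).proj) 0))) hjet
  have r2 : (localLP P L q₀ (jetLift P.nabla (v 0) t)).2 (w t) =
      D.ver (x t, (deriv x t, deriv (deriv x) t), (f t, deriv f t)) (z t) := by
    rw [← hzt]
    exact congrArg (fun y => D.ver y (vecCoord F V q₀ (v 0 t).proj (w t))) hjet
  have r3 : fiberDerivVert L (liftCurve (v 0) t) (variationDefect P v w t) =
      vertDeriv D.lag (x t, deriv x t, f t)
        (vecCoord F V q₀ (v 0 t).proj (variationDefect P v w t)) := by
    refine (fiberDerivVert_eq P hL (q₀ := q₀) (p := liftCurve (v 0) t) h0 _).trans ?_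
    exact congrArg (fun y => vertDeriv D.lag y (vecCoord F V q₀ (v 0 t).proj
      (variationDefect P v w t))) (hvel h0)
  rw [hLd, r1, r2, r3, hdef]

end Family

end FirstVariation

/-! ### Curves with prescribed jets in an open set -/

section Osc

/-- For `ε > 0`, a smooth function with values in `[-ε, ε]` that is tangent to the identity to second
order at `0`. -/
def osc (ε s : ℝ) : ℝ := ε * Real.sin (s / ε)

theorem hasDerivAt_osc {ε : ℝ} (hε : ε ≠ 0) (s : ℝ) :
    HasDerivAt (osc ε) (Real.cos (s / ε)) s := by
  have := (((hasDerivAt_id s).div_const ε).sin).const_mul ε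
  refine this.congr_deriv ?_
  simp only [id]
  field_simp

theorem abs_osc_le {ε : ℝ} (hε : 0 ≤ ε) (s : ℝ) : |osc ε s| ≤ ε := by
  rw [osc, abs_mul, abs_of_nonneg hε]
  exact mul_le_of_le_one_right hε (Real.abs_sin_le_one _)

theorem contDiff_osc (ε : ℝ) : ContDiff ℝ ∞ (osc ε) := by
  unfold osc
  fun_prop

/-- A two-parameter family of points of a given open set with prescribed 2-jet in one parameter and
constant derivative in the other one. Bounding the parameters by `osc` keeps the whole family in the
open set. -/
theorem exists_family_of_jet {E : Type*} [NormedAddCommGroup E] [NormedSpace ℝ E] {W : Set E}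
    (hW : IsOpen W) {x : E} (hx : x ∈ W) (a b ξ : E) (t : ℝ) :
    ∃ X : ℝ × ℝ → E, ContDiff ℝ ∞ X ∧ (∀ p, X p ∈ W) ∧ X (0, t) = x ∧
      deriv (fun s => X (0, s)) t = a ∧ deriv (deriv fun s => X (0, s)) t = b ∧
      ∀ s, HasDerivAt (fun m => X (m, s)) ξ 0 := by
  obtain ⟨r, hr, hball⟩ := Metric.isOpen_iff.1 hW x hx
  let C := ‖a‖ + ‖b‖ + ‖ξ‖ + 1
  have hC : 0 < C := by positivity
  let ε := min 1 (r / (2 * C))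
  have hε : 0 < ε := by positivity
  have hε1 : ε ≤ 1 := min_le_left _ _
  have hεC : ε * C < r := by
    have h1 : ε * C ≤ r / (2 * C) * C := by gcongr; exact min_le_right _ _
    have h2 : r / (2 * C) * C = r / 2 := by field_simp
    linarith
  have hosc := contDiff_osc ε
  have h00 : osc ε 0 = 0 := by simp [osc]
  have hd := hasDerivAt_osc hε.ne'
  refine ⟨fun p => x + osc ε (p.2 - t) • a + (osc ε (p.2 - t) ^ 2 / 2) • b + osc ε p.1 • ξ,
    ?_, fun p => hball ?_, by simp [h00], ?_⟩
  · exact ((contDiff_const.add ((hosc.comp (by fun_prop)).smul contDiff_const)).add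
      ((((hosc.comp (by fun_prop)).pow 2).div_const 2).smul contDiff_const)).add
        ((hosc.comp (by fun_prop)).smul contDiff_const)
  · rw [mem_ball_iff_norm]
    have h1 := abs_osc_le hε.le (p.2 - t)
    have h2 := abs_osc_le hε.le p.1
    have h3 : |osc ε (p.2 - t) ^ 2 / 2| ≤ ε := by
      rw [abs_of_nonneg (by positivity), ← sq_abs]
      nlinarith [abs_nonneg (osc ε (p.2 - t))]
    calc ‖_‖ = ‖osc ε (p.2 - t) • a + (osc ε (p.2 - t) ^ 2 / 2) • b + osc ε p.1 • ξ‖ := by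
          simp only [add_assoc, add_sub_cancel_left]
      _ ≤ |osc ε (p.2 - t)| * ‖a‖ + |osc ε (p.2 - t) ^ 2 / 2| * ‖b‖ + |osc ε p.1| * ‖ξ‖ := by
          refine (norm_add₃_le).trans ?_
          simp only [norm_smul, Real.norm_eq_abs]
          exact le_rfl
      _ ≤ ε * ‖a‖ + ε * ‖b‖ + ε * ‖ξ‖ := by gcongr
      _ ≤ ε * C := by simp only [C]; nlinarith
      _ < r := hεC
  · have hds : ∀ s, HasDerivAt (fun s => osc ε (s - t)) (Real.cos ((s - t) / ε)) s := fun s => by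
      simpa using (hd (s - t)).comp_sub_const s t
    have e1 : ∀ s, HasDerivAt (fun s => x + osc ε (s - t) • a + (osc ε (s - t) ^ 2 / 2) • b +
        osc ε 0 • ξ)
        (Real.cos ((s - t) / ε) • a + (osc ε (s - t) * Real.cos ((s - t) / ε)) • b) s := fun s => by
      have := ((((hds s).smul_const a).const_add x).add
        ((((hds s).pow 2).div_const 2).smul_const b)).add_const (osc ε 0 • ξ)
      refine this.congr_deriv ?_
      congr 2
      simp
      ring
    have e2 : (deriv fun s => x + osc ε (s - t) • a + (osc ε (s - t) ^ 2 / 2) • b +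
        osc ε 0 • ξ) =
        fun s => Real.cos ((s - t) / ε) • a + (osc ε (s - t) * Real.cos ((s - t) / ε)) • b :=
      funext fun s => (e1 s).deriv
    have hc : HasDerivAt (fun s => Real.cos ((s - t) / ε)) 0 t := by
      have := (((hasDerivAt_id t).sub_const t).div_const ε).cos
      simpa using this
    refine ⟨?_, ?_, fun s => ?_⟩
    · simp only [e2]
      simp [h00]
    · simp only [e2]
      have := (hc.smul_const a).add (((hds t).mul hc).smul_const b)
      refine this.deriv.trans ?_
      simp
    · have := ((hd 0).smul_const ξ).const_add
        (x + osc ε (s - t) • a + (osc ε (s - t) ^ 2 / 2) • b)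
      simpa using this

end Osc

/-! ### Families of curves with prescribed jets -/

section Realization

variable {E : Type*} [NormedAddCommGroup E] [NormedSpace ℝ E]
  {F : Type*} [NormedAddCommGroup F] [NormedSpace ℝ F]
  {Q : Type*} [TopologicalSpace Q] [ChartedSpace E Q] [IsManifold 𝓘(ℝ, E) ∞ Q]
  {V : Q → Type*} [TopologicalSpace (TotalSpace F V)]
  [∀ x, AddCommGroup (V x)] [∀ x, Module ℝ (V x)] [∀ x, TopologicalSpace (V x)]
  [∀ x, IsTopologicalAddGroup (V x)] [∀ x, ContinuousSMul ℝ (V x)]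
  [FiberBundle F V] [VectorBundle ℝ F V]
  [FiniteDimensional ℝ E] [FiniteDimensional ℝ F] [ContMDiffVectorBundle ∞ F V 𝓘(ℝ, E)]

/-- The point of `V` with given coordinates in the chart and trivialization at `q₀`. -/
def chartPoint (q₀ : Q) (x : E) (f : F) : TotalSpace F V :=
  ⟨(chartAt E q₀).symm x, (vecTriv F V q₀).symmL ℝ _ f⟩

theorem chartPoint_proj_mem {q₀ : Q} {x : E} (hx : x ∈ coordDomain E F V q₀) (f : F) :
    (chartPoint (V := V) q₀ x f).proj ∈ baseDomain E F V q₀ := chart_symm_mem_baseDomain hx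

theorem chart_chartPoint {q₀ : Q} {x : E} (hx : x ∈ coordDomain E F V q₀) (f : F) :
    chartAt E q₀ (chartPoint (V := V) q₀ x f).proj = x := (chartAt E q₀).right_inv hx.1

theorem vecTriv_symmL {q₀ q : Q} (hq : q ∈ (vecTriv F V q₀).baseSet) (f : F) :
    (vecTriv F V q₀ ⟨q, (vecTriv F V q₀).symmL ℝ q f⟩).2 = f :=
  ((vecTriv F V q₀).continuousLinearMapAt_apply_of_mem (R := ℝ) hq _).symm.trans
    (Trivialization.continuousLinearMapAt_symmL _ hq _)

theorem vecTriv_chartPoint {q₀ : Q} {x : E} (hx : x ∈ coordDomain E F V q₀) (f : F) :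
    (vecTriv F V q₀ (chartPoint (V := V) q₀ x f)).2 = f := vecTriv_symmL hx.2 f

theorem contMDiffAt_vecTriv_symmL {N : Type*} [NormedAddCommGroup N] [NormedSpace ℝ N] {q₀ : Q}
    {q : N → Q} {f : N → F} {n : N} (hq : ContMDiffAt 𝓘(ℝ, N) 𝓘(ℝ, E) ∞ q n)
    (hf : ContDiffAt ℝ ∞ f n) (h0 : q n ∈ (vecTriv F V q₀).baseSet) :
    ContMDiffAt 𝓘(ℝ, N) (𝓘(ℝ, E).prod 𝓘(ℝ, F)) ∞
      (fun m => TotalSpace.mk' F (q m) ((vecTriv F V q₀).symmL ℝ (q m) (f m))) n := by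
  rw [(vecTriv F V q₀).contMDiffAt_iff ((vecTriv F V q₀).mem_source.2 h0)]
  refine ⟨hq, hf.contMDiffAt.congr_of_eventuallyEq ?_⟩
  filter_upwards [hq.continuousAt.eventually ((vecTriv F V q₀).open_baseSet.mem_nhds h0)] with m hm
  exact vecTriv_symmL hm _

theorem contMDiffAt_chartPoint {N : Type*} [NormedAddCommGroup N] [NormedSpace ℝ N] {q₀ : Q}
    {x : N → E} {f : N → F} {n : N} (hx : ContDiffAt ℝ ∞ x n) (hf : ContDiffAt ℝ ∞ f n)
    (h0 : x n ∈ coordDomain E F V q₀) :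
    ContMDiffAt 𝓘(ℝ, N) (𝓘(ℝ, E).prod 𝓘(ℝ, F)) ∞
      (fun m => chartPoint (V := V) q₀ (x m) (f m)) n :=
  contMDiffAt_vecTriv_symmL ((contMDiffAt_chart_symm h0).comp n hx.contMDiffAt) hf h0.2

theorem tanCoord_injective {q₀ q : Q} (hq : q ∈ (chartAt E q₀).source) :
    Function.Injective (tanCoord E q₀ q) := fun X Y h => by
  rw [← (tanTriv E q₀).symmL_continuousLinearMapAt (R := ℝ) hq X,
    ← (tanTriv E q₀).symmL_continuousLinearMapAt (R := ℝ) hq Y]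
  exact congrArg _ h

theorem vecCoord_injective {q₀ q : Q} (hq : q ∈ (vecTriv F V q₀).baseSet) :
    Function.Injective (vecCoord F V q₀ q) := fun X Y h => by
  rw [← (vecTriv F V q₀).symmL_continuousLinearMapAt (R := ℝ) hq X,
    ← (vecTriv F V q₀).symmL_continuousLinearMapAt (R := ℝ) hq Y]
  exact congrArg _ h

/-- Every element of `T⁽²⁾Q ⊕ 2V` is the jet at `t` of a smooth curve that stays over the domain of
the coordinates at `q₀`, and the base of this curve is part of a smooth family of curves whose
variation has the constant coordinates `ξ`. -/
theorem exists_chart_family (nabla : CovariantDerivative 𝓘(ℝ, E) F V) {q₀ : Q} {p : JetSum E F V}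
    (hp : p.proj ∈ baseDomain E F V q₀) (ξ : E) (t : ℝ) :
    ∃ (X : ℝ × ℝ → E) (f : ℝ → F), ContDiff ℝ ∞ X ∧ ContDiff ℝ ∞ f ∧
      (∀ m, X m ∈ coordDomain E F V q₀) ∧ (∀ s, HasDerivAt (fun m => X (m, s)) ξ 0) ∧
      jetLift nabla (fun s => chartPoint (V := V) q₀ (X (0, s)) (f s)) t = p := by
  set y := jetCoord nabla q₀ p with hy
  obtain ⟨X, hX, hXW, hx, ha, hb, hξ⟩ := exists_family_of_jet (isOpen_coordDomain (E := E) (F := F)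
    (V := V) q₀) (chart_mem_coordDomain hp) y.2.1.1 y.2.1.2 ξ t
  let f : ℝ → F := fun s => y.2.2.1 + (s - t) • y.2.2.2
  have hf : ContDiff ℝ ∞ f := by fun_prop
  refine ⟨X, f, hX, hf, hXW, hξ, ?_⟩
  have hu : ContMDiffAt 𝓘(ℝ, ℝ) (𝓘(ℝ, E).prod 𝓘(ℝ, F)) ∞
      (fun s => chartPoint (V := V) q₀ (X (0, s)) (f s)) t :=
    contMDiffAt_chartPoint (x := fun s => X (0, s)) (hX.comp (by fun_prop)).contDiffAt
      hf.contDiffAt (hXW _)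
  have hm : (chartPoint (V := V) q₀ (X (0, t)) (f t)).proj ∈ baseDomain E F V q₀ :=
    chartPoint_proj_mem (hXW _) _
  refine jetCoord_injective nabla hm hp ?_
  rw [jetCoord_jetLift nabla hu hm]
  have e1 : (fun s => chartAt E q₀ (chartPoint (V := V) q₀ (X (0, s)) (f s)).proj) =
      fun s => X (0, s) := funext fun s => chart_chartPoint (hXW _) _
  have e2 : (fun s => (vecTriv F V q₀ (chartPoint (V := V) q₀ (X (0, s)) (f s))).2) = f :=
    funext fun s => vecTriv_chartPoint (hXW _) _
  have e3 : deriv f t = y.2.2.2 := by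
    have : HasDerivAt f ((1 : ℝ) • y.2.2.2) t :=
      (((hasDerivAt_id t).sub_const t).smul_const y.2.2.2).const_add _
    rw [this.deriv, one_smul]
  rw [e1, e2, chart_chartPoint (hXW _), vecTriv_chartPoint (hXW _), ha, hb, hx, e3]
  simp [f, hy, jetCoord]

/-- A deformation of the curve with coordinates `X (0, t)`, `f t`. If `ξ` is the derivative of `X` in
its first argument at `0`, its variation has the coordinates `ρ t • ξ` in the base and `ζ t` in the
fibre. -/
def chartFamily (q₀ : Q) (X : ℝ × ℝ → E) (f ζ : ℝ → F) (ρ : ℝ → ℝ) (l t : ℝ) : TotalSpace F V :=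
  chartPoint q₀ (X (l * ρ t, t)) (f t + l • ζ t)

section ChartFamily

variable {q₀ : Q} {X : ℝ × ℝ → E} {f ζ : ℝ → F} {ρ : ℝ → ℝ}

theorem chartFamily_zero :
    chartFamily (V := V) q₀ X f ζ ρ 0 = fun s => chartPoint q₀ (X (0, s)) (f s) := by
  funext s
  simp [chartFamily]

theorem contMDiff_chartFamily (hX : ContDiff ℝ ∞ X) (hXW : ∀ m, X m ∈ coordDomain E F V q₀)
    (hf : ContDiff ℝ ∞ f) (hζ : ContDiff ℝ ∞ ζ) (hρ : ContDiff ℝ ∞ ρ) :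
    ContMDiff 𝓘(ℝ, ℝ × ℝ) (𝓘(ℝ, E).prod 𝓘(ℝ, F)) ∞
      (fun p : ℝ × ℝ => chartFamily (V := V) q₀ X f ζ ρ p.1 p.2) := fun p =>
  contMDiffAt_chartPoint (x := fun p : ℝ × ℝ => X (p.1 * ρ p.2, p.2))
    (f := fun p : ℝ × ℝ => f p.2 + p.1 • ζ p.2)
    (hX.comp (by fun_prop)).contDiffAt
    (ContDiff.contDiffAt (by fun_prop)) (hXW _)

theorem chartFamily_proj_mem (hXW : ∀ m, X m ∈ coordDomain E F V q₀) (l t : ℝ) :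
    (chartFamily (V := V) q₀ X f ζ ρ l t).proj ∈ baseDomain E F V q₀ :=
  chartPoint_proj_mem (hXW _) _

/-- The base variation of `chartFamily`. -/
theorem velocity_chartFamily (hX : ContDiff ℝ ∞ X) (hXW : ∀ m, X m ∈ coordDomain E F V q₀)
    (hf : ContDiff ℝ ∞ f) (hζ : ContDiff ℝ ∞ ζ) (hρ : ContDiff ℝ ∞ ρ) {ξ : E}
    (hξ : ∀ s, HasDerivAt (fun m => X (m, s)) ξ 0) (t : ℝ) :
    velocity E (fun l => (chartFamily (V := V) q₀ X f ζ ρ l t).proj) 0 =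
      (tanTriv E q₀).symmL ℝ _ (ρ t • ξ) := by
  have h0 := chartFamily_proj_mem (f := f) (ζ := ζ) (ρ := ρ) hXW 0 t
  refine tanCoord_injective h0.1 ?_
  have h1 := contMDiff_fst_slice (contMDiff_chartFamily hX hXW hf hζ hρ) t 0
  rw [tanCoord_velocity ((contMDiffAt_base h1).mdifferentiableAt (by simp)) h0.1]
  have e1 : (fun l => chartAt E q₀ (chartFamily (V := V) q₀ X f ζ ρ l t).proj) =
      fun l => X (l * ρ t, t) := funext fun l => chart_chartPoint (hXW _) _
  rw [e1]
  refine Eq.trans ?_ ((tanTriv E q₀).continuousLinearMapAt_symmL (R := ℝ) h0.1 (ρ t • ξ)).symm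
  have h2 : HasDerivAt (fun l : ℝ => l * ρ t) (ρ t) 0 := by
    simpa using (hasDerivAt_id (0 : ℝ)).mul_const (ρ t)
  have h3 : HasDerivAt (fun m => X (m, t)) ξ (0 * ρ t) := by rw [zero_mul]; exact hξ t
  exact (HasDerivAt.scomp (g₁ := fun m => X (m, t)) (h := fun l => l * ρ t) 0 h3 h2).deriv

end ChartFamily

end Realization

/-! ### Differentiation under the integral sign -/

section ParametricIntegral

/-- Differentiation under the integral sign for smooth integrands. -/
theorem hasDerivAt_integral_of_contDiff {f : ℝ × ℝ → ℝ} (hf : ContDiff ℝ ∞ f) (a b : ℝ) :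
    HasDerivAt (fun l => ∫ t in a..b, f (l, t)) (∫ t in a..b, deriv (fun l => f (l, t)) 0) 0 := by
  have hd : ∀ p : ℝ × ℝ, HasDerivAt (fun l => f (l, p.2)) (fderiv ℝ f p (1, 0)) p.1 := fun p =>
    hasDerivAt_fst_slice (l := p.1) (t := p.2) (hf.differentiable (by simp) p)
  have hc : Continuous fun p : ℝ × ℝ => fderiv ℝ f p (1, 0) :=
    (hf.continuous_fderiv (by simp)).clm_apply continuous_const
  obtain ⟨C, hC⟩ := ((isCompact_Icc (a := (-1 : ℝ)) (b := 1)).prod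
    (isCompact_uIcc (a := a) (b := b))).exists_bound_of_continuousOn hc.continuousOn
  have hfc : ∀ l, Continuous fun t => f (l, t) := fun l => hf.continuous.comp (by fun_prop)
  have hdc : Continuous fun t : ℝ => fderiv ℝ f (0, t) (1, 0) :=
    hc.comp (g := fun p : ℝ × ℝ => fderiv ℝ f p (1, 0)) (f := fun t : ℝ => (0, t)) (by fun_prop)
  have key := (intervalIntegral.hasDerivAt_integral_of_dominated_loc_of_deriv_le
    (μ := MeasureTheory.volume) (a := a) (b := b)
    (F := fun l t => f (l, t)) (F' := fun l t => fderiv ℝ f (l, t) (1, 0)) (x₀ := (0 : ℝ))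
    (bound := fun _ => C) (Icc_mem_nhds (by norm_num : (-1 : ℝ) < 0) (by norm_num : (0 : ℝ) < 1))
    (Filter.Eventually.of_forall fun l => (hfc l).aestronglyMeasurable)
    ((hfc 0).intervalIntegrable _ _) hdc.aestronglyMeasurable
    (Filter.Eventually.of_forall fun t ht l hl => hC (l, t) ⟨hl, uIoc_subset_uIcc ht⟩)
    intervalIntegrable_const
    (Filter.Eventually.of_forall fun t _ l _ => hd (l, t))).2
  refine key.congr_deriv ?_
  congr 1
  funext t
  exact (hd (0, t)).deriv.symm

end ParametricIntegral

/-! ### The Lagrange–Poincaré bundle map -/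

section BundleMap

variable {E : Type*} [NormedAddCommGroup E] [NormedSpace ℝ E]
  {F : Type*} [NormedAddCommGroup F] [NormedSpace ℝ F]
  {Q : Type*} [TopologicalSpace Q] [ChartedSpace E Q] [IsManifold 𝓘(ℝ, E) ∞ Q]
  {V : Q → Type*} [TopologicalSpace (TotalSpace F V)]
  [∀ x, AddCommGroup (V x)] [∀ x, Module ℝ (V x)] [∀ x, TopologicalSpace (V x)]
  [∀ x, IsTopologicalAddGroup (V x)] [∀ x, ContinuousSMul ℝ (V x)]
  [FiberBundle F V] [VectorBundle ℝ F V]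
  [FiniteDimensional ℝ E] [FiniteDimensional ℝ F] [ContMDiffVectorBundle ∞ F V 𝓘(ℝ, E)]

/-- The Lagrange–Poincaré expressions do not depend on the coordinates: in the first variation
formula, which holds for every smooth family of curves, all other terms are intrinsic. -/
theorem localLP_eq [T2Space Q] (P : LPBundle E F V) {L : TangentSum E F V → ℝ}
    (hL : ContMDiff (𝓘(ℝ, E).prod 𝓘(ℝ, E × F)) 𝓘(ℝ, ℝ) ∞ L) {q₀ q₁ : Q} {p : JetSum E F V}
    (h0 : p.proj ∈ baseDomain E F V q₀) (h1 : p.proj ∈ baseDomain E F V q₁) :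
    localLP P L q₀ p = localLP P L q₁ p := by
  have key : ∀ (ξ : E) (η : F),
      (localLP P L q₀ p).1 ((tanTriv E q₀).symmL ℝ p.proj ξ) +
        (localLP P L q₀ p).2 ((vecTriv F V q₀).symmL ℝ p.proj η) =
      (localLP P L q₁ p).1 ((tanTriv E q₀).symmL ℝ p.proj ξ) +
        (localLP P L q₁ p).2 ((vecTriv F V q₀).symmL ℝ p.proj η) := by
    intro ξ η
    -- Compare the first variation formulas in both coordinate systems along one family of curves
    -- that realizes `p`, `ξ` and `η`.
    obtain ⟨X, f, hX, hf, hXW, hξ, hp⟩ := exists_chart_family P.nabla h0 ξ 0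
    let v := chartFamily (V := V) q₀ X f (fun _ => 0) fun _ => 1
    let w : ∀ t, V (v 0 t).proj := fun t => (vecTriv F V q₀).symmL ℝ (v 0 t).proj η
    have hv := contMDiff_chartFamily (V := V) hX hXW hf (ζ := fun _ => 0) (ρ := fun _ => 1)
      contDiff_const contDiff_const
    have hw : ContMDiff 𝓘(ℝ, ℝ) (𝓘(ℝ, E).prod 𝓘(ℝ, F)) ∞
        (fun t => TotalSpace.mk' F (v 0 t).proj (w t)) := fun t =>
      contMDiffAt_vecTriv_symmL (contMDiffAt_base (contMDiff_snd_slice hv 0 t)) contDiffAt_const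
        (chartFamily_proj_mem hXW 0 t).2
    have hδ := velocity_chartFamily (V := V) hX hXW hf (ζ := fun _ => 0) (ρ := fun _ => 1)
      contDiff_const contDiff_const hξ 0
    rw [one_smul] at hδ
    rw [← chartFamily_zero (ζ := fun _ => 0) (ρ := fun _ => 1)] at hp
    subst hp
    have e := (hasDerivAt_boundaryTerm P hL hv hw h0).unique
      (hasDerivAt_boundaryTerm P hL hv hw h1)
    rw [hδ] at e
    simp only [sub_sub, sub_right_inj] at e
    exact add_right_cancel e
  have hX : ∀ X, (tanTriv E q₀).symmL ℝ p.proj (tanCoord E q₀ p.proj X) = X := fun X =>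
    (tanTriv E q₀).symmL_continuousLinearMapAt (R := ℝ) h0.1 X
  have hY : ∀ Y, (vecTriv F V q₀).symmL ℝ p.proj (vecCoord F V q₀ p.proj Y) = Y := fun Y =>
    (vecTriv F V q₀).symmL_continuousLinearMapAt (R := ℝ) h0.2 Y
  refine Prod.ext (ContinuousLinearMap.ext fun X => ?_) (ContinuousLinearMap.ext fun Y => ?_)
  · have := key (tanCoord E q₀ p.proj X) 0
    rwa [map_zero, map_zero, map_zero, add_zero, add_zero, hX] at this
  · have := key 0 (vecCoord F V q₀ p.proj Y)
    rwa [map_zero, map_zero, map_zero, zero_add, zero_add, hY] at this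

/-- The preferred trivialization of `T*Q ⊕ V*` composes covectors with the inverse
trivializations. -/
theorem trivializationAt_dual (q₀ q : Q)
    (α : TangentSpace 𝓘(ℝ, E) q →L[ℝ] ℝ) (β : V q →L[ℝ] ℝ) :
    (trivializationAt ((E →L[ℝ] ℝ) × (F →L[ℝ] ℝ))
      (fun q : Q => (TangentSpace 𝓘(ℝ, E) q →L[ℝ] ℝ) × (V q →L[ℝ] ℝ)) q₀ ⟨q, (α, β)⟩).2 =
      (α.comp ((tanTriv E q₀).symmL ℝ q), β.comp ((vecTriv F V q₀).symmL ℝ q)) := by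
  refine Prod.ext ?_ ?_
  · refine Eq.trans (b := ContinuousLinearMap.inCoordinates E (fun q => TangentSpace 𝓘(ℝ, E) q) ℝ
      (Trivial Q ℝ) q₀ q q₀ q α) rfl ?_
    rw [ContinuousLinearMap.inCoordinates]
    ext x
    simp
  · refine Eq.trans (b := ContinuousLinearMap.inCoordinates F V ℝ (Trivial Q ℝ) q₀ q q₀ q β) rfl ?_
    rw [ContinuousLinearMap.inCoordinates]
    ext x
    simp

theorem contMDiffAt_jetCoord [T2Space Q] {nabla : CovariantDerivative 𝓘(ℝ, E) F V}
    (hn : CovariantDerivative.ContMDiffCovariantDerivative nabla ∞) (p : JetSum E F V) :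
    ContMDiffAt (𝓘(ℝ, E).prod 𝓘(ℝ, (E × E) × (F × F))) 𝓘(ℝ, E × (E × E) × (F × F)) ∞
      (jetCoord nabla p.proj) p := by
  have h0 := mem_baseDomain_self (E := E) (F := F) (V := V) p.proj
  obtain ⟨h1, h2⟩ := contMDiffAt_totalSpace.1
    (contMDiffAt_id (I := 𝓘(ℝ, E).prod 𝓘(ℝ, (E × E) × (F × F))) (n := ∞) (x := p))
  have h3 : ContMDiffAt (𝓘(ℝ, E).prod 𝓘(ℝ, (E × E) × (F × F))) 𝓘(ℝ, E) ∞
      (fun p' : JetSum E F V => chartAt E p.proj p'.proj) p :=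
    ContMDiffAt.comp (g := chartAt E p.proj) (f := fun p' : JetSum E F V => p'.proj) p
      (contMDiffAt_of_mem_maximalAtlas (n := ∞)
        (IsManifold.chart_mem_maximalAtlas (I := 𝓘(ℝ, E)) p.proj) h0.1) h1
  have hΓ : ContDiffOn ℝ ∞ (fun y : E × ((E × E) × (F × F)) =>
      (y.1, y.2.1, (y.2.2.1, y.2.2.2 - christoffel nabla p.proj y.1 y.2.1.1 y.2.2.1)))
      (coordDomain E F V p.proj ×ˢ univ) := by
    have h4 := (contDiffOn_christoffel hn p.proj).comp
      (f := fun y : E × ((E × E) × (F × F)) => y.1)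
      (s := coordDomain E F V p.proj ×ˢ univ) (by fun_prop) fun y hy => hy.1
    have h5 := (h4.clm_apply (g := fun y => y.2.1.1) (by fun_prop)).clm_apply
      (g := fun y => y.2.2.1) (by fun_prop)
    have h6 : ContDiffOn ℝ ∞ (fun y : E × ((E × E) × (F × F)) => y.2.2.2)
      (coordDomain E F V p.proj ×ˢ univ) := by fun_prop
    exact ContDiffOn.prodMk (by fun_prop) (ContDiffOn.prodMk (by fun_prop)
      (ContDiffOn.prodMk (by fun_prop) (h6.sub h5)))
  have h7 := hΓ.contDiffAt (x := (chartAt E p.proj p.proj, (trivializationAt ((E × E) × (F × F))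
    (fun q : Q => JetSpace E Q q × (V q × V q)) p.proj p).2))
    (((isOpen_coordDomain p.proj).prod isOpen_univ).mem_nhds
    ⟨chart_mem_coordDomain h0, mem_univ _⟩)
  exact h7.contMDiffAt.comp p (h3.prodMk_space h2)

/-- A curve in `T⁽²⁾Q ⊕ 2V` induced by a smooth curve in `V` is smooth. -/
theorem contMDiff_jetLift [T2Space Q] {nabla : CovariantDerivative 𝓘(ℝ, E) F V}
    (hn : CovariantDerivative.ContMDiffCovariantDerivative nabla ∞) {u : ℝ → TotalSpace F V}
    (hu : ContMDiff 𝓘(ℝ, ℝ) (𝓘(ℝ, E).prod 𝓘(ℝ, F)) ∞ u) :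
    ContMDiff 𝓘(ℝ, ℝ) (𝓘(ℝ, E).prod 𝓘(ℝ, (E × E) × (F × F))) ∞ (jetLift nabla u) := by
  intro t
  have hb : ContMDiffAt 𝓘(ℝ, ℝ) 𝓘(ℝ, E) ∞ (fun s => (u s).proj) t := contMDiffAt_base (hu t)
  rw [contMDiffAt_totalSpace]
  refine ⟨hb, ?_⟩
  have h0 := mem_baseDomain_self (E := E) (F := F) (V := V) (u t).proj
  set q₀ := (u t).proj with hq₀
  have hx : ContDiffAt ℝ ∞ (fun s => chartAt E q₀ (u s).proj) t :=
    contDiffAt_coord_base (contMDiffAt_base (hu t)) h0.1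
  have hf : ContDiffAt ℝ ∞ (fun s => (vecTriv F V q₀ (u s)).2) t :=
    contDiffAt_coord_fibre (hu t) h0.2
  have hΓ : ContDiffAt ℝ ∞ (fun s => christoffel nabla q₀ (chartAt E q₀ (u s).proj)) t :=
    ContDiffAt.comp (f := fun s => chartAt E q₀ (u s).proj) t
      ((contDiffOn_christoffel hn q₀).contDiffAt ((isOpen_coordDomain q₀).mem_nhds
        (chart_mem_coordDomain h0))) hx
  have h1 := (hx.deriv_infty.prodMk hx.deriv_infty.deriv_infty).prodMk
    (hf.prodMk (hf.deriv_infty.add ((hΓ.clm_apply hx.deriv_infty).clm_apply hf)))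
  refine h1.contMDiffAt.congr_of_eventuallyEq ?_
  filter_upwards [(contMDiffAt_base (hu t)).continuousAt.eventually
    ((isOpen_baseDomain q₀).mem_nhds h0)] with s hs
  have h2 := jetCoord_jetLift nabla (hu s) hs
  simp only [jetCoord, Prod.mk.injEq] at h2
  obtain ⟨-, e1, e2, e3⟩ := h2
  refine Prod.ext e1 (Prod.ext e2 ?_)
  rw [e1, e2, sub_eq_iff_eq_add] at e3
  exact e3

/-- The Lagrange–Poincaré bundle map. Over `q` it is computed in the coordinates at `q`; near `q` it
may be computed in these same coordinates by `localLP_eq`, which gives its smoothness. -/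
def lagrangePoincareMap [T2Space Q] (P : LPBundle E F V) {L : TangentSum E F V → ℝ}
    (hL : ContMDiff (𝓘(ℝ, E).prod 𝓘(ℝ, E × F)) 𝓘(ℝ, ℝ) ∞ L) : SecondOrderBundleMap E F V where
  toFun q J := localLP P L q ⟨q, J⟩
  smooth := by
    intro p
    rw [contMDiffAt_totalSpace]
    have hproj := (contMDiffAt_totalSpace.1
      (contMDiffAt_id (I := 𝓘(ℝ, E).prod 𝓘(ℝ, (E × E) × (F × F))) (n := ∞) (x := p))).1
    refine ⟨hproj, ?_⟩
    have h0 := mem_baseDomain_self (E := E) (F := F) (V := V) p.proj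
    have hS := coordLP_isSmoothOn P hL p.proj
    have hmem : coordDomain E F V p.proj ×ˢ univ ∈ 𝓝 (jetCoord P.nabla p.proj p) :=
      (hS.isOpen.prod isOpen_univ).mem_nhds ⟨chart_mem_coordDomain h0, mem_univ _⟩
    have h1 := ((CoordLP.IsSmoothOn.contDiffOn_hor hS).contDiffAt hmem).prodMk
      ((CoordLP.IsSmoothOn.contDiffOn_ver hS).contDiffAt hmem)
    refine (h1.contMDiffAt.comp p (contMDiffAt_jetCoord P.nabla_smooth p)).congr_of_eventuallyEq ?_
    filter_upwards [hproj.continuousAt.eventually ((isOpen_baseDomain p.proj).mem_nhds h0)]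
      with p' hp'
    have e1 : localLP P L p'.proj p' = localLP P L p.proj p' :=
      localLP_eq P hL (mem_baseDomain_self p'.proj) hp'
    refine (trivializationAt_dual p.proj p'.proj (localLP P L p'.proj p').1
      (localLP P L p'.proj p').2).trans ?_
    rw [e1]
    refine Prod.ext (ContinuousLinearMap.ext fun ξ => ?_) (ContinuousLinearMap.ext fun η => ?_)
    · exact congrArg ((coordLP P L p.proj).hor (jetCoord P.nabla p.proj p'))
        ((tanTriv E p.proj).continuousLinearMapAt_symmL (R := ℝ) hp'.1 ξ)
    · exact congrArg ((coordLP P L p.proj).ver (jetCoord P.nabla p.proj p'))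
        ((vecTriv F V p.proj).continuousLinearMapAt_symmL (R := ℝ) hp'.2 η)

/-- For an allowed deformation the defect term in the first variation formula vanishes and the
boundary term is zero at both ends, so integrating the formula leaves the Lagrange–Poincaré
expressions. -/
theorem lagrangePoincareMap_representsFirstVariation [T2Space Q] (P : LPBundle E F V)
    {L : TangentSum E F V → ℝ} (hL : ContMDiff (𝓘(ℝ, E).prod 𝓘(ℝ, E × F)) 𝓘(ℝ, ℝ) ∞ L)
    {t₀ t₁ : ℝ} (ht : t₀ < t₁) :
    RepresentsFirstVariation P L t₀ t₁ (lagrangePoincareMap P hL) := by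
  intro v w h
  have hℓ := contDiff_lagrangian_family P hL h.smooth
  have hG := contDiff_boundaryTerm P hL h.smooth h.smooth_w
  refine (hasDerivAt_integral_of_contDiff hℓ t₀ t₁).congr_deriv ?_
  have hvel : ∀ {t}, (∀ lam, (v lam t).proj = (v 0 t).proj) →
      velocity E (fun lam => (v lam t).proj) 0 = 0 := fun {t} hl => by
    rw [velocity]
    have : (fun lam => (v lam t).proj) = fun _ => (v 0 t).proj := funext hl
    rw [this, mfderiv_const]
    rfl
  have hG0 : boundaryTerm L v w t₀ = 0 :=
    (congrArg₂ _ ((congrArg _ (hvel h.left_fixed)).trans (map_zero _))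
      ((congrArg _ h.w_left).trans (map_zero _))).trans (add_zero 0)
  have hG1 : boundaryTerm L v w t₁ = 0 :=
    (congrArg₂ _ ((congrArg _ (hvel h.right_fixed)).trans (map_zero _))
      ((congrArg _ h.w_right).trans (map_zero _))).trans (add_zero 0)
  have hGint : ∫ t in t₀..t₁, deriv (boundaryTerm L v w) t = 0 := by
    rw [intervalIntegral.integral_deriv_eq_sub (fun t _ => hG.differentiable (by simp) t)
      ((hG.continuous_deriv (by simp)).intervalIntegrable _ _), hG0, hG1, sub_zero]
  have hcont : Continuous fun t => deriv (fun l => L (liftCurve (v l) t)) 0 := by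
    have h1 : Continuous fun t : ℝ =>
        fderiv ℝ (fun p : ℝ × ℝ => L (liftCurve (v p.1) p.2)) (0, t) (1, 0) :=
      ((hℓ.continuous_fderiv (by simp)).comp (by fun_prop : Continuous fun t : ℝ =>
        ((0 : ℝ), t))).clm_apply continuous_const
    refine h1.congr fun t => ?_
    exact (hasDerivAt_fst_slice (l := 0) (t := t) (hℓ.differentiable (by simp) _)).deriv.symm
  have hsub : ∫ t in t₀..t₁, deriv (fun l => L (liftCurve (v l) t)) 0 =
      ∫ t in t₀..t₁, (deriv (fun l => L (liftCurve (v l) t)) 0 -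
        deriv (boundaryTerm L v w) t) := by
    rw [intervalIntegral.integral_sub (hcont.intervalIntegrable _ _)
      ((hG.continuous_deriv (by simp)).intervalIntegrable _ _), hGint, sub_zero]
  refine hsub.trans (intervalIntegral.integral_congr fun t htt => ?_)
  rw [uIcc_of_le ht.le] at htt
  have hd : variationDefect P v w t = 0 := by rw [variationDefect, h.variation t htt, sub_self]
  have key := (hasDerivAt_boundaryTerm P hL h.smooth h.smooth_w
    (mem_baseDomain_self (E := E) (F := F) (V := V) (v 0 t).proj)).deriv
  have hd' : fiberDerivVert L (liftCurve (v 0) t) (variationDefect P v w t) = 0 :=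
    (congrArg _ hd).trans (map_zero _)
  rw [hd', sub_zero] at key
  change _ - _ = _
  rw [key, sub_sub, sub_sub_cancel]
  rfl

end BundleMap

/-! ### Uniqueness -/

section Uniqueness

variable {E : Type*} [NormedAddCommGroup E] [NormedSpace ℝ E]
  {F : Type*} [NormedAddCommGroup F] [NormedSpace ℝ F]
  {Q : Type*} [TopologicalSpace Q] [ChartedSpace E Q] [IsManifold 𝓘(ℝ, E) ∞ Q]
  {V : Q → Type*} [TopologicalSpace (TotalSpace F V)]
  [∀ x, AddCommGroup (V x)] [∀ x, Module ℝ (V x)] [∀ x, TopologicalSpace (V x)]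
  [∀ x, IsTopologicalAddGroup (V x)] [∀ x, ContinuousSMul ℝ (V x)]
  [FiberBundle F V] [VectorBundle ℝ F V]
  [FiniteDimensional ℝ E] [FiniteDimensional ℝ F] [ContMDiffVectorBundle ∞ F V 𝓘(ℝ, E)]

/-- The pairing of a second order bundle map along a curve with the vectors that have constant
coordinates `ξ`, `η` at `q₀`. -/
def coordPairing (A : SecondOrderBundleMap E F V) (nabla : CovariantDerivative 𝓘(ℝ, E) F V)
    (q₀ : Q) (ξ : E) (η : F) (u : ℝ → TotalSpace F V) (t : ℝ) : ℝ :=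
  (A.atCurve nabla u t).1 ((tanTriv E q₀).symmL ℝ (u t).proj ξ) +
    (A.atCurve nabla u t).2 ((vecTriv F V q₀).symmL ℝ (u t).proj η)

theorem continuous_coordPairing [T2Space Q] (A : SecondOrderBundleMap E F V)
    {nabla : CovariantDerivative 𝓘(ℝ, E) F V}
    (hn : CovariantDerivative.ContMDiffCovariantDerivative nabla ∞) {q₀ : Q} (ξ : E) (η : F)
    {u : ℝ → TotalSpace F V} (hu : ContMDiff 𝓘(ℝ, ℝ) (𝓘(ℝ, E).prod 𝓘(ℝ, F)) ∞ u)
    (h0 : ∀ t, (u t).proj ∈ baseDomain E F V q₀) :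
    Continuous (coordPairing A nabla q₀ ξ η u) := by
  let S : ℝ → TotalSpace ((E →L[ℝ] ℝ) × (F →L[ℝ] ℝ))
      (fun q : Q => (TangentSpace 𝓘(ℝ, E) q →L[ℝ] ℝ) × (V q →L[ℝ] ℝ)) :=
    fun t => ⟨(u t).proj, A.atCurve nabla u t⟩
  have h1 : ContMDiff 𝓘(ℝ, ℝ) (𝓘(ℝ, E).prod 𝓘(ℝ, (E →L[ℝ] ℝ) × (F →L[ℝ] ℝ))) ∞ S :=
    A.smooth.comp (contMDiff_jetLift hn hu)
  have h2 : Continuous fun t => (trivializationAt ((E →L[ℝ] ℝ) × (F →L[ℝ] ℝ))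
      (fun q : Q => (TangentSpace 𝓘(ℝ, E) q →L[ℝ] ℝ) × (V q →L[ℝ] ℝ)) q₀ (S t)).2 := by
    refine continuous_iff_continuousAt.2 fun t => ?_
    let e := trivializationAt ((E →L[ℝ] ℝ) × (F →L[ℝ] ℝ))
      (fun q : Q => (TangentSpace 𝓘(ℝ, E) q →L[ℝ] ℝ) × (V q →L[ℝ] ℝ)) q₀
    have he : S t ∈ e.source :=
      e.mem_source.2 ⟨⟨(h0 t).1, mem_univ _⟩, ⟨(h0 t).2, mem_univ _⟩⟩
    have h := (e.contMDiffAt_iff (IB := 𝓘(ℝ, E)) (IM := 𝓘(ℝ, ℝ)) (n := ∞) (f := S) he).1 (h1 t)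
    exact h.2.continuousAt
  have h3 : Continuous fun t =>
      ((A.atCurve nabla u t).1.comp ((tanTriv E q₀).symmL ℝ (u t).proj),
        (A.atCurve nabla u t).2.comp ((vecTriv F V q₀).symmL ℝ (u t).proj)) := by
    refine h2.congr fun t => ?_
    exact trivializationAt_dual q₀ (u t).proj (A.atCurve nabla u t).1 (A.atCurve nabla u t).2
  exact (h3.fst.clm_apply continuous_const).add (h3.snd.clm_apply continuous_const)

/-- The constraint on an allowed deformation can be solved for the variation of the fibre
coordinates, so every variation `g ξ`, `g η` with `g` vanishing at the endpoints is allowed. -/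
theorem exists_allowedDeformation [T2Space Q] (P : LPBundle E F V) {L : TangentSum E F V → ℝ}
    (hL : ContMDiff (𝓘(ℝ, E).prod 𝓘(ℝ, E × F)) 𝓘(ℝ, ℝ) ∞ L) {t₀ t₁ : ℝ} {q₀ : Q}
    {X : ℝ × ℝ → E} {f : ℝ → F} (hX : ContDiff ℝ ∞ X) (hf : ContDiff ℝ ∞ f)
    (hXW : ∀ m, X m ∈ coordDomain E F V q₀) {ξ : E}
    (hξ : ∀ s, HasDerivAt (fun m => X (m, s)) ξ 0) (η : F) {g : ℝ → ℝ} (hg : ContDiff ℝ ∞ g)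
    (h₀ : g t₀ = 0) (h₁ : g t₁ = 0) :
    ∃ ζ : ℝ → F, ContDiff ℝ ∞ ζ ∧ IsAllowedDeformation P t₀ t₁ (chartFamily q₀ X f ζ g)
      fun t => (vecTriv F V q₀).symmL ℝ _ (g t • η) := by
  let D := coordLP P L q₀
  have hS : D.IsSmoothOn (coordDomain E F V q₀) := coordLP_isSmoothOn P hL q₀
  let x : ℝ → E := fun s => X (0, s)
  have hx : ContDiff ℝ ∞ x := hX.comp (by fun_prop)
  have hx' : ContDiff ℝ ∞ (deriv x) := contDiff_iff_contDiffAt.2 fun t => hx.contDiffAt.deriv_infty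
  have hz : ContDiff ℝ ∞ fun t => g t • η := hg.smul contDiff_const
  have hz' : ContDiff ℝ ∞ (deriv fun t => g t • η) :=
    contDiff_iff_contDiffAt.2 fun t => hz.contDiffAt.deriv_infty
  have hgξ : ContDiff ℝ ∞ fun t => g t • ξ := hg.smul contDiff_const
  have hconn : ContDiff ℝ ∞ fun t => D.conn (x t) := hS.conn.comp_contDiff hx fun t => hXW _
  have hbrk : ContDiff ℝ ∞ fun t => D.brk (x t) := hS.brk.comp_contDiff hx fun t => hXW _
  have hcurv : ContDiff ℝ ∞ fun t => D.curv (x t) := hS.curv.comp_contDiff hx fun t => hXW _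
  -- The coordinate form of the constraint, solved for the variation of the fibre coordinates.
  let ζ : ℝ → F := fun t => deriv (fun s => g s • η) t + D.conn (x t) (deriv x t) (g t • η) +
    D.brk (x t) (f t) (g t • η) + D.curv (x t) (g t • ξ) (deriv x t) -
      D.conn (x t) (g t • ξ) (f t)
  have hζ : ContDiff ℝ ∞ ζ :=
    (((hz'.add ((hconn.clm_apply hx').clm_apply hz)).add
      ((hbrk.clm_apply hf).clm_apply hz)).add
      ((hcurv.clm_apply hgξ).clm_apply hx')).sub
      ((hconn.clm_apply hgξ).clm_apply hf)
  have hv := contMDiff_chartFamily (V := V) hX hXW hf hζ hg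
  have hmem : ∀ l t, (chartFamily (V := V) q₀ X f ζ g l t).proj ∈ baseDomain E F V q₀ :=
    chartFamily_proj_mem hXW
  have hw : ContMDiff 𝓘(ℝ, ℝ) (𝓘(ℝ, E).prod 𝓘(ℝ, F)) ∞
      (fun t => TotalSpace.mk' F (chartFamily (V := V) q₀ X f ζ g 0 t).proj
        ((vecTriv F V q₀).symmL ℝ _ (g t • η))) := fun t =>
    contMDiffAt_vecTriv_symmL (contMDiffAt_base (contMDiff_snd_slice hv 0 t)) hz.contDiffAt
      (hmem 0 t).2
  have hfix : ∀ t, g t = 0 → ∀ l, (chartFamily (V := V) q₀ X f ζ g l t).proj =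
      (chartFamily (V := V) q₀ X f ζ g 0 t).proj := fun t h l => by
    simp [chartFamily, chartPoint, h]
  refine ⟨ζ, hζ, hv, hfix t₀ h₀, hfix t₁ h₁, hw, ?_, ?_, fun t _ => ?_⟩
  · rw [h₀, zero_smul, map_zero]
  · rw [h₁, zero_smul, map_zero]
  · refine sub_eq_zero.1 ?_
    refine vecCoord_injective (hmem 0 t).2 ?_
    have key := vecCoord_variationDefect P L hv hw (hmem 0 t)
    rw [map_zero]
    refine key.trans ?_
    have e0 : (fun s => chartAt E q₀ (chartFamily (V := V) q₀ X f ζ g 0 s).proj) = x :=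
      funext fun s => by
        rw [chartFamily_zero]
        exact chart_chartPoint (hXW _) _
    have e1 : deriv (fun l => chartAt E q₀ (chartFamily (V := V) q₀ X f ζ g l t).proj) 0 =
        g t • ξ := by
      have h := tanCoord_velocity (q₀ := q₀)
        ((contMDiffAt_base (contMDiff_fst_slice hv t 0)).mdifferentiableAt (by simp)) (hmem 0 t).1
      rw [← h, velocity_chartFamily hX hXW hf hζ hg hξ t]
      exact (tanTriv E q₀).continuousLinearMapAt_symmL (R := ℝ) (hmem 0 t).1 _
    have e2 : (fun s => (vecTriv F V q₀ ⟨(chartFamily (V := V) q₀ X f ζ g 0 s).proj,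
        (vecTriv F V q₀).symmL ℝ _ (g s • η)⟩).2) = fun s => g s • η :=
      funext fun s => vecTriv_symmL (hmem 0 s).2 _
    have e3 : (fun l => (vecTriv F V q₀ (chartFamily (V := V) q₀ X f ζ g l t)).2) =
        fun l => f t + l • ζ t := funext fun l => vecTriv_chartPoint (hXW _) _
    have e4 : deriv (fun l : ℝ => f t + l • ζ t) 0 = ζ t := by
      have := ((hasDerivAt_id (0 : ℝ)).smul_const (ζ t)).const_add (f t)
      simpa using this.deriv
    have e0t := congrFun e0 t
    have e2t := congrFun e2 t
    have e3t := congrFun e3 0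
    simp only [zero_smul, add_zero] at e3t
    simp only [e0, e1, e2, e3, e4, e0t, e2t, e3t]
    simp only [ζ, D]
    abel

/-- The fundamental lemma of the calculus of variations: every element `p` of `T⁽²⁾Q ⊕ 2V` is the jet
of a curve at an interior time, and the allowed variations along this curve include all test
functions times given directions. -/
theorem RepresentsFirstVariation.unique [T2Space Q] (P : LPBundle E F V)
    {L : TangentSum E F V → ℝ} (hL : ContMDiff (𝓘(ℝ, E).prod 𝓘(ℝ, E × F)) 𝓘(ℝ, ℝ) ∞ L)
    {t₀ t₁ : ℝ} (ht : t₀ < t₁) {A B : SecondOrderBundleMap E F V}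
    (hA : RepresentsFirstVariation P L t₀ t₁ A) (hB : RepresentsFirstVariation P L t₀ t₁ B) :
    B = A := by
  have main : ∀ (q₀ : Q) (p : JetSum E F V), p.proj ∈ baseDomain E F V q₀ → ∀ (ξ : E) (η : F),
      (B.toFun p.proj p.2).1 ((tanTriv E q₀).symmL ℝ p.proj ξ) +
        (B.toFun p.proj p.2).2 ((vecTriv F V q₀).symmL ℝ p.proj η) =
      (A.toFun p.proj p.2).1 ((tanTriv E q₀).symmL ℝ p.proj ξ) +
        (A.toFun p.proj p.2).2 ((vecTriv F V q₀).symmL ℝ p.proj η) := by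
    intro q₀ p h0 ξ η
    -- Continuity along the curve gives equality at an interior time from equality almost everywhere.
    let tm := (t₀ + t₁) / 2
    have htm : tm ∈ Ioo t₀ t₁ := ⟨by simp only [tm]; linarith, by simp only [tm]; linarith⟩
    obtain ⟨X, f, hX, hf, hXW, hξ, hp⟩ := exists_chart_family P.nabla h0 ξ tm
    let u : ℝ → TotalSpace F V := fun s => chartPoint q₀ (X (0, s)) (f s)
    have hu : ContMDiff 𝓘(ℝ, ℝ) (𝓘(ℝ, E).prod 𝓘(ℝ, F)) ∞ u := fun s =>
      contMDiffAt_chartPoint (x := fun s => X (0, s)) (hX.comp (by fun_prop)).contDiffAt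
        hf.contDiffAt (hXW _)
    have hum : ∀ s, (u s).proj ∈ baseDomain E F V q₀ := fun s => chartPoint_proj_mem (hXW _) _
    have hcA := continuous_coordPairing A P.nabla_smooth ξ η hu hum
    have hcB := continuous_coordPairing B P.nabla_smooth ξ η hu hum
    have hint : ∀ g : ℝ → ℝ, ContDiff ℝ ∞ g → tsupport g ⊆ Ioo t₀ t₁ →
        ∫ t in t₀..t₁, g t * coordPairing B P.nabla q₀ ξ η u t =
          ∫ t in t₀..t₁, g t * coordPairing A P.nabla q₀ ξ η u t := by
      intro g hg hsupp
      have h₀ : g t₀ = 0 := image_eq_zero_of_notMem_tsupport fun h => (hsupp h).1.false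
      have h₁ : g t₁ = 0 := image_eq_zero_of_notMem_tsupport fun h => (hsupp h).2.false
      obtain ⟨ζ, hζ, hall⟩ := exists_allowedDeformation P hL hX hf hXW hξ η hg h₀ h₁
      have e : ∀ C : SecondOrderBundleMap E F V, ∀ t,
          (C.atCurve P.nabla (chartFamily q₀ X f ζ g 0) t).1
            (velocity E (fun lam => (chartFamily (V := V) q₀ X f ζ g lam t).proj) 0) +
          (C.atCurve P.nabla (chartFamily q₀ X f ζ g 0) t).2
            ((vecTriv F V q₀).symmL ℝ _ (g t • η)) =
          g t * coordPairing C P.nabla q₀ ξ η u t := by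
        intro C t
        have hu0 : chartFamily (V := V) q₀ X f ζ g 0 = u := chartFamily_zero
        rw [velocity_chartFamily hX hXW hf hζ hg hξ t, ← hu0, map_smul, map_smul, map_smul,
          map_smul, coordPairing, smul_eq_mul, smul_eq_mul, mul_add]
      have h := (hB _ _ hall).unique (hA _ _ hall)
      simpa only [e] using h
    have hae : ∀ᵐ t, t ∈ Ioo t₀ t₁ → coordPairing B P.nabla q₀ ξ η u t -
        coordPairing A P.nabla q₀ ξ η u t = 0 := by
      refine isOpen_Ioo.ae_eq_zero_of_integral_contDiff_smul_eq_zero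
        ((hcB.sub hcA).locallyIntegrable.locallyIntegrableOn _) fun g hg _ hsupp => ?_
      have h1 : ∫ t, g t • (coordPairing B P.nabla q₀ ξ η u t -
          coordPairing A P.nabla q₀ ξ η u t) =
          ∫ t in t₀..t₁, (g t * coordPairing B P.nabla q₀ ξ η u t -
            g t * coordPairing A P.nabla q₀ ξ η u t) := by
        rw [intervalIntegral.integral_of_le ht.le,
          MeasureTheory.setIntegral_eq_integral_of_forall_compl_eq_zero]
        · simp only [smul_eq_mul, mul_sub]
        · intro t htt
          have : g t = 0 := image_eq_zero_of_notMem_tsupport fun h =>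
            htt ⟨(hsupp h).1, (hsupp h).2.le⟩
          simp [this]
      have iB : Continuous fun t => g t * coordPairing B P.nabla q₀ ξ η u t := hg.continuous.mul hcB
      have iA : Continuous fun t => g t * coordPairing A P.nabla q₀ ξ η u t := hg.continuous.mul hcA
      rw [h1, intervalIntegral.integral_sub (iB.intervalIntegrable _ _)
        (iA.intervalIntegrable _ _), hint g hg hsupp, sub_self]
    have heq : EqOn (fun t => coordPairing B P.nabla q₀ ξ η u t -
        coordPairing A P.nabla q₀ ξ η u t) (fun _ => 0) (Ioo t₀ t₁) :=
      MeasureTheory.Measure.eqOn_open_of_ae_eq (μ := MeasureTheory.volume)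
        ((MeasureTheory.ae_restrict_iff' measurableSet_Ioo).2 hae) isOpen_Ioo
        (hcB.sub hcA).continuousOn continuousOn_const
    have hfin := sub_eq_zero.1 (heq htm)
    clear_value tm
    subst hp
    exact hfin
  have hfun : B.toFun = A.toFun := by
    funext q J
    have key := main q ⟨q, J⟩ (mem_baseDomain_self q)
    have hX : ∀ X, (tanTriv E q).symmL ℝ q (tanCoord E q q X) = X := fun X =>
      (tanTriv E q).symmL_continuousLinearMapAt (R := ℝ) (mem_chart_source E q) X
    have hY : ∀ Y, (vecTriv F V q).symmL ℝ q (vecCoord F V q q Y) = Y := fun Y =>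
      (vecTriv F V q).symmL_continuousLinearMapAt (R := ℝ) (mem_baseSet_trivializationAt F V q) Y
    refine Prod.ext (ContinuousLinearMap.ext fun X => ?_) (ContinuousLinearMap.ext fun Y => ?_)
    · have := key (tanCoord E q q X) 0
      simp only [map_zero, add_zero, hX] at this
      exact this
    · have := key 0 (vecCoord F V q q Y)
      simp only [map_zero, zero_add, hY] at this
      exact this
  cases A
  cases B
  congr

end Uniqueness

/-! ### Covariant formulas for the components -/

section Formulas

variable {E : Type*} [NormedAddCommGroup E] [NormedSpace ℝ E]
  {F : Type*} [NormedAddCommGroup F] [NormedSpace ℝ F]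
  {Q : Type*} [TopologicalSpace Q] [ChartedSpace E Q] [IsManifold 𝓘(ℝ, E) ∞ Q]
  {V : Q → Type*} [TopologicalSpace (TotalSpace F V)]
  [∀ x, AddCommGroup (V x)] [∀ x, Module ℝ (V x)] [∀ x, TopologicalSpace (V x)]
  [∀ x, IsTopologicalAddGroup (V x)] [∀ x, ContinuousSMul ℝ (V x)]
  [FiberBundle F V] [VectorBundle ℝ F V]
  [FiniteDimensional ℝ E] [FiniteDimensional ℝ F] [ContMDiffVectorBundle ∞ F V 𝓘(ℝ, E)]

theorem vecTriv_extend_eventuallyEq {q : Q} (Y : V q) :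
    (fun z => (vecTriv F V q ⟨z, FiberBundle.extend F Y z⟩).2) =ᶠ[𝓝 q]
      fun _ => vecCoord F V q q Y := by
  filter_upwards [(vecTriv F V q).open_baseSet.mem_nhds (mem_baseSet_trivializationAt F V q)]
    with z hz
  rw [vecCoord, (vecTriv F V q).continuousLinearMapAt_apply_of_mem (R := ℝ)
    (mem_baseSet_trivializationAt F V q), FiberBundle.extend,
    (vecTriv F V q).apply_mk_symm hz]

/-- The Christoffel form at `q` is the covariant derivative of the extensions with constant
coordinates, which occur in the definitions of `horizontalDeriv` and `dualCovDerivAlong`. -/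
theorem vecCoord_nabla_extend (nabla : CovariantDerivative 𝓘(ℝ, E) F V) {q : Q} (Y : V q)
    (X : TangentSpace 𝓘(ℝ, E) q) :
    vecCoord F V q q (nabla (FiberBundle.extend F Y) q X) =
      christoffel nabla q (chartAt E q q) (tanCoord E q q X) (vecCoord F V q q Y) := by
  rw [vecCoord, coord_covariantDerivative nabla (mem_baseDomain_self q)
    (FiberBundle.mdifferentiableAt_extend 𝓘(ℝ, E) F Y), FiberBundle.extend_apply_self]
  have h := (vecTriv_extend_eventuallyEq (F := F) Y).mfderiv_eq (I := 𝓘(ℝ, E)) (I' := 𝓘(ℝ, F))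
  have h' : mvfderiv 𝓘(ℝ, E) (fun z => (vecTriv F V q ⟨z, FiberBundle.extend F Y z⟩).2) q X = 0 := by
    rw [mvfderiv, h, mfderiv_const]
    rfl
  rw [h', zero_add]

/-- Vector fields with constant coordinates in a chart commute. -/
theorem mlieBracket_extend {q : Q} (X Y : TangentSpace 𝓘(ℝ, E) q) :
    VectorField.mlieBracket 𝓘(ℝ, E) (FiberBundle.extend E X) (FiberBundle.extend E Y) q = 0 := by
  have h : ∀ X : TangentSpace 𝓘(ℝ, E) q,
      VectorField.mpullbackWithin 𝓘(ℝ, E) 𝓘(ℝ, E) (extChartAt 𝓘(ℝ, E) q).symm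
        (FiberBundle.extend E X) (range 𝓘(ℝ, E)) =ᶠ[𝓝 (extChartAt 𝓘(ℝ, E) q q)]
          fun _ => tanCoord E q q X := by
    intro X
    filter_upwards [extChartAt_target_mem_nhds (I := 𝓘(ℝ, E)) q] with y hy
    have hy' : (extChartAt 𝓘(ℝ, E) q).symm y ∈ (chartAt E q).source := by
      simpa using (extChartAt 𝓘(ℝ, E) q).map_target hy
    rw [VectorField.mpullbackWithin_apply]
    refine (isInvertible_mfderivWithin_extChartAt_symm hy).inverse_apply_eq.2 ?_
    refine tanCoord_injective hy' ?_
    have e1 : tanCoord E q _ (FiberBundle.extend E X ((extChartAt 𝓘(ℝ, E) q).symm y)) =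
        tanCoord E q q X := by
      rw [tanCoord, (tanTriv E q).continuousLinearMapAt_apply_of_mem (R := ℝ) hy',
        tanCoord, (tanTriv E q).continuousLinearMapAt_apply_of_mem (R := ℝ) (mem_chart_source E q),
        FiberBundle.extend, (tanTriv E q).apply_mk_symm hy']
    have e2 := TangentBundle.continuousLinearMapAt_trivializationAt (𝕜 := ℝ) (I := 𝓘(ℝ, E)) hy'
    refine e1.trans (Eq.trans ?_ (DFunLike.congr_fun e2 _).symm)
    exact (DFunLike.congr_fun (mfderiv_extChartAt_comp_mfderivWithin_extChartAt_symm hy)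
      (tanCoord E q q X)).symm
  rw [← VectorField.mlieBracketWithin_univ, VectorField.mlieBracketWithin_apply,
    (h X).lieBracketWithin_vectorField_eq_nhds (h Y)]
  simp only [VectorField.lieBracketWithin, fderivWithin_fun_const]
  refine (congrArg _ ?_).trans (map_zero _)
  simp
  rfl

/-- The Christoffel form of a torsion-free connection is symmetric. This is the only use of the
vanishing of the torsion. -/
theorem christoffel_symm {nablaQ : CovariantDerivative 𝓘(ℝ, E) E
      (fun x : Q => TangentSpace 𝓘(ℝ, E) x)} (h : nablaQ.torsion = 0) {q : Q}
    (X Y : TangentSpace 𝓘(ℝ, E) q) :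
    christoffel nablaQ q (chartAt E q q) (tanCoord E q q X) (tanCoord E q q Y) =
      christoffel nablaQ q (chartAt E q q) (tanCoord E q q Y) (tanCoord E q q X) := by
  have h1 := nablaQ.torsion_apply_eq_extend X Y
  rw [h, mlieBracket_extend, sub_zero, FiberBundle.extend_apply_self,
    FiberBundle.extend_apply_self] at h1
  have h2 : nablaQ (FiberBundle.extend E Y) q X = nablaQ (FiberBundle.extend E X) q Y :=
    (sub_eq_zero.1 h1.symm)
  have e1 := vecCoord_nabla_extend (F := E) nablaQ Y X
  have e2 := vecCoord_nabla_extend (F := E) nablaQ X Y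
  rw [h2] at e1
  exact e1.symm.trans e2

theorem tanCoord_extend_eventuallyEq {q : Q} (X : TangentSpace 𝓘(ℝ, E) q) :
    ∀ᶠ z in 𝓝 q, tanCoord E q z (FiberBundle.extend E X z) = tanCoord E q q X := by
  filter_upwards [vecTriv_extend_eventuallyEq (F := E) X,
    (chartAt E q).open_source.mem_nhds (mem_chart_source E q)] with z hz hz'
  exact ((tanTriv E q).continuousLinearMapAt_apply_of_mem (R := ℝ) hz' _).trans hz

theorem vecCoord_extend_eventuallyEq {q : Q} (Y : V q) :
    ∀ᶠ z in 𝓝 q, vecCoord F V q z (FiberBundle.extend F Y z) = vecCoord F V q q Y := by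
  filter_upwards [vecTriv_extend_eventuallyEq (F := F) Y,
    (vecTriv F V q).open_baseSet.mem_nhds (mem_baseSet_trivializationAt F V q)] with z hz hz'
  exact ((vecTriv F V q).continuousLinearMapAt_apply_of_mem (R := ℝ) hz' _).trans hz

theorem mvfderiv_comp_chart {q : Q} {g : E → ℝ} (hg : DifferentiableAt ℝ g (chartAt E q q))
    (X : TangentSpace 𝓘(ℝ, E) q) :
    mvfderiv 𝓘(ℝ, E) (fun z => g (chartAt E q z)) q X =
      fderiv ℝ g (chartAt E q q) (tanCoord E q q X) := by
  have h1 : MDifferentiableAt 𝓘(ℝ, E) 𝓘(ℝ, E) (chartAt E q) q :=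
    (contMDiffAt_of_mem_maximalAtlas (n := ∞) (IsManifold.chart_mem_maximalAtlas (I := 𝓘(ℝ, E)) q)
      (mem_chart_source E q)).mdifferentiableAt (by simp)
  have h2 := mfderiv_comp_apply q (g := g) hg.mdifferentiableAt h1 X
  rw [mfderiv_eq_fderiv] at h2
  have e2 := TangentBundle.continuousLinearMapAt_trivializationAt (𝕜 := ℝ) (I := 𝓘(ℝ, E))
    (mem_chart_source E q)
  exact h2.trans (congrArg (fderiv ℝ g (chartAt E q q)) (DFunLike.congr_fun e2 X).symm)

/-- The horizontal derivative in coordinates. -/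
theorem horizontalDeriv_eq (P : LPBundle E F V) {L : TangentSum E F V → ℝ}
    (hL : ContMDiff (𝓘(ℝ, E).prod 𝓘(ℝ, E × F)) 𝓘(ℝ, ℝ) ∞ L)
    (nablaQ : CovariantDerivative 𝓘(ℝ, E) E (fun x : Q => TangentSpace 𝓘(ℝ, E) x))
    (nabla : CovariantDerivative 𝓘(ℝ, E) F V) (p : TangentSum E F V)
    (X : TangentSpace 𝓘(ℝ, E) p.proj) :
    letI y := sumCoord p.proj p
    letI D := coordLP P L p.proj
    letI ξ := tanCoord E p.proj p.proj X
    horizontalDeriv nablaQ nabla L p X = baseDeriv D.lag y ξ -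
      velDeriv D.lag y (christoffel nablaQ p.proj y.1 ξ y.2.1) -
      vertDeriv D.lag y (christoffel nabla p.proj y.1 ξ y.2.2) := by
  obtain ⟨q, a, f⟩ := p
  have h0 := mem_baseDomain_self (E := E) (F := F) (V := V) q
  let D := coordLP P L q
  let y := sumCoord q (⟨q, a, f⟩ : TangentSum E F V)
  have hd : DifferentiableAt ℝ D.lag y :=
    ((contDiffOn_coord_lag P hL q).contDiffAt (((isOpen_coordDomain q).prod
      isOpen_univ).mem_nhds ⟨chart_mem_coordDomain h0, mem_univ _⟩)).differentiableAt (by simp)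
  have e1 : mvfderiv 𝓘(ℝ, E) (fun x => L ⟨x, FiberBundle.extend E a x, FiberBundle.extend F f x⟩) q
      X = baseDeriv D.lag y (tanCoord E q q X) := by
    have h1 : (fun x => L ⟨x, FiberBundle.extend E a x, FiberBundle.extend F f x⟩) =ᶠ[𝓝 q]
        fun x => D.lag (chartAt E q x, y.2) := by
      filter_upwards [(isOpen_baseDomain q).mem_nhds h0, tanCoord_extend_eventuallyEq a,
        vecCoord_extend_eventuallyEq (F := F) f] with x hx ha hf
      rw [coord_lag P L (q₀ := q) hx, sumCoord]
      exact congrArg _ (Prod.ext rfl (Prod.ext ha hf))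
    have h2 : HasFDerivAt (fun x : E => D.lag (x, y.2)) (baseDeriv D.lag y) y.1 :=
      hd.hasFDerivAt.comp (f := fun x : E => (x, y.2)) y.1 (hasFDerivAt_prodMk_left y.1 y.2)
    have h3 := mvfderiv_comp_chart (g := fun x : E => D.lag (x, y.2)) h2.differentiableAt X
    rw [mvfderiv, h1.mfderiv_eq]
    exact h3.trans (DFunLike.congr_fun h2.fderiv _)
  have e2 := fiberDerivVel_eq P hL (q₀ := q) (p := ⟨q, a, f⟩) h0
    (nablaQ (FiberBundle.extend E a) q X)
  have e3 := fiberDerivVert_eq P hL (q₀ := q) (p := ⟨q, a, f⟩) h0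
    (nabla (FiberBundle.extend F f) q X)
  have e2' := vecCoord_nabla_extend (F := E) nablaQ a X
  have e3' := vecCoord_nabla_extend (F := F) nabla f X
  exact congrArg₂ (fun a b : ℝ => a - b) (congrArg₂ (fun a b : ℝ => a - b) e1
    (e2.trans (congrArg _ e2'))) (e3.trans (congrArg _ e3'))

/-- The derivative `D/dt` of `∂L/∂q̇` in coordinates. -/
theorem dualCovDerivAlong_fiberDerivVel (P : LPBundle E F V) {L : TangentSum E F V → ℝ}
    (hL : ContMDiff (𝓘(ℝ, E).prod 𝓘(ℝ, E × F)) 𝓘(ℝ, ℝ) ∞ L)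
    (nablaQ : CovariantDerivative 𝓘(ℝ, E) E (fun x : Q => TangentSpace 𝓘(ℝ, E) x))
    {v : ℝ → TotalSpace F V} (hv : ContMDiff 𝓘(ℝ, ℝ) (𝓘(ℝ, E).prod 𝓘(ℝ, F)) ∞ v) (t : ℝ)
    (X : TangentSpace 𝓘(ℝ, E) (v t).proj) :
    letI q := (v t).proj
    letI D := coordLP P L q
    letI x := fun s => chartAt E q (v s).proj
    letI f := fun s => (vecTriv F V q (v s)).2
    letI y := (x t, deriv x t, f t)
    dualCovDerivAlong nablaQ (fun s => (v s).proj) (fun s => fiberDerivVel L (liftCurve v s)) t X =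
      fderiv ℝ (velDeriv D.lag) y (deriv x t, deriv (deriv x) t, deriv f t) (tanCoord E q q X) -
      velDeriv D.lag y (christoffel nablaQ q (x t) (deriv x t) (tanCoord E q q X)) := by
  let q := (v t).proj
  let D := coordLP P L q
  let x := fun s => chartAt E q (v s).proj
  let f := fun s => (vecTriv F V q (v s)).2
  have h0 := mem_baseDomain_self (E := E) (F := F) (V := V) q
  have hb := contMDiffAt_base (hv t)
  have hS : IsOpen (coordDomain E F V q ×ˢ (univ : Set (E × F))) :=
    (isOpen_coordDomain q).prod isOpen_univ
  have hxc : ContDiffAt ℝ ∞ x t := contDiffAt_coord_base hb h0.1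
  have hfc : ContDiffAt ℝ ∞ f t := contDiffAt_coord_fibre (hv t) h0.2
  have hc : HasDerivAt (fun s => (x s, deriv x s, f s))
      (deriv x t, deriv (deriv x) t, deriv f t) t :=
    (hxc.differentiableAt (by simp)).hasDerivAt.prodMk
      ((hxc.deriv_infty.differentiableAt (by simp)).hasDerivAt.prodMk
        (hfc.differentiableAt (by simp)).hasDerivAt)
  have hDd : HasFDerivAt (velDeriv D.lag) (fderiv ℝ (velDeriv D.lag) (x t, deriv x t, f t))
      (x t, deriv x t, f t) :=
    ((((contDiffOn_coord_lag P hL q).velDeriv hS).contDiffAt (hS.mem_nhds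
      ⟨chart_mem_coordDomain h0, mem_univ _⟩)).differentiableAt (by simp)).hasFDerivAt
  have hd : HasDerivAt (fun s => velDeriv D.lag (x s, deriv x s, f s))
      (fderiv ℝ (velDeriv D.lag) (x t, deriv x t, f t)
        (deriv x t, deriv (deriv x) t, deriv f t)) t :=
    hDd.comp_hasDerivAt (f := fun s => (x s, deriv x s, f s)) t hc
  have hd' := hasDerivAt_clm_apply hd (hasDerivAt_const t (tanCoord E q q X))
  have e1 : (fun s => fiberDerivVel L (liftCurve v s) (FiberBundle.extend E X (v s).proj)) =ᶠ[𝓝 t]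
      fun s => velDeriv D.lag (x s, deriv x s, f s) (tanCoord E q q X) := by
    filter_upwards [hb.continuousAt.eventually (tanCoord_extend_eventuallyEq X),
      hb.continuousAt.eventually ((isOpen_baseDomain q).mem_nhds h0)] with s hs hs'
    refine (fiberDerivVel_eq P hL (q₀ := q) (p := liftCurve v s) hs' _).trans ?_
    rw [sumCoord_liftCurve (hv s) hs']
    exact congrArg _ hs
  have e2 : fiberDerivVel L (liftCurve v t) (nablaQ (FiberBundle.extend E X) q
      (velocity E (fun s => (v s).proj) t)) = velDeriv D.lag (x t, deriv x t, f t)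
        (christoffel nablaQ q (x t) (deriv x t) (tanCoord E q q X)) := by
    refine (fiberDerivVel_eq P hL (q₀ := q) (p := liftCurve v t) h0 _).trans ?_
    rw [sumCoord_liftCurve (hv t) h0]
    refine congrArg _ ((vecCoord_nabla_extend (F := E) nablaQ X _).trans ?_)
    have h3 : tanCoord E q q (velocity E (fun s => (v s).proj) t) = deriv x t :=
      tanCoord_velocity (hb.mdifferentiableAt (by simp)) h0.1
    rw [h3]
  refine congrArg₂ (fun a b : ℝ => a - b) (e1.deriv_eq.trans (hd'.deriv.trans ?_)) e2
  exact (congrArg _ (map_zero _)).trans (add_zero _)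

/-- The derivative `D/dt` of `∂L/∂v` in coordinates. -/
theorem dualCovDerivAlong_fiberDerivVert (P : LPBundle E F V) {L : TangentSum E F V → ℝ}
    (hL : ContMDiff (𝓘(ℝ, E).prod 𝓘(ℝ, E × F)) 𝓘(ℝ, ℝ) ∞ L)
    (nabla : CovariantDerivative 𝓘(ℝ, E) F V)
    {v : ℝ → TotalSpace F V} (hv : ContMDiff 𝓘(ℝ, ℝ) (𝓘(ℝ, E).prod 𝓘(ℝ, F)) ∞ v) (t : ℝ)
    (Y : V (v t).proj) :
    letI q := (v t).proj
    letI D := coordLP P L q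
    letI x := fun s => chartAt E q (v s).proj
    letI f := fun s => (vecTriv F V q (v s)).2
    letI y := (x t, deriv x t, f t)
    dualCovDerivAlong nabla (fun s => (v s).proj) (fun s => fiberDerivVert L (liftCurve v s)) t Y =
      fderiv ℝ (vertDeriv D.lag) y (deriv x t, deriv (deriv x) t, deriv f t) (vecCoord F V q q Y) -
      vertDeriv D.lag y (christoffel nabla q (x t) (deriv x t) (vecCoord F V q q Y)) := by
  let q := (v t).proj
  let D := coordLP P L q
  let x := fun s => chartAt E q (v s).proj
  let f := fun s => (vecTriv F V q (v s)).2
  have h0 := mem_baseDomain_self (E := E) (F := F) (V := V) q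
  have hb := contMDiffAt_base (hv t)
  have hS : IsOpen (coordDomain E F V q ×ˢ (univ : Set (E × F))) :=
    (isOpen_coordDomain q).prod isOpen_univ
  have hxc : ContDiffAt ℝ ∞ x t := contDiffAt_coord_base hb h0.1
  have hfc : ContDiffAt ℝ ∞ f t := contDiffAt_coord_fibre (hv t) h0.2
  have hc : HasDerivAt (fun s => (x s, deriv x s, f s))
      (deriv x t, deriv (deriv x) t, deriv f t) t :=
    (hxc.differentiableAt (by simp)).hasDerivAt.prodMk
      ((hxc.deriv_infty.differentiableAt (by simp)).hasDerivAt.prodMk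
        (hfc.differentiableAt (by simp)).hasDerivAt)
  have hDd : HasFDerivAt (vertDeriv D.lag) (fderiv ℝ (vertDeriv D.lag) (x t, deriv x t, f t))
      (x t, deriv x t, f t) :=
    ((((contDiffOn_coord_lag P hL q).vertDeriv hS).contDiffAt (hS.mem_nhds
      ⟨chart_mem_coordDomain h0, mem_univ _⟩)).differentiableAt (by simp)).hasFDerivAt
  have hd : HasDerivAt (fun s => vertDeriv D.lag (x s, deriv x s, f s))
      (fderiv ℝ (vertDeriv D.lag) (x t, deriv x t, f t)
        (deriv x t, deriv (deriv x) t, deriv f t)) t :=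
    hDd.comp_hasDerivAt (f := fun s => (x s, deriv x s, f s)) t hc
  have hd' := hasDerivAt_clm_apply hd (hasDerivAt_const t (vecCoord F V q q Y))
  have e1 : (fun s => fiberDerivVert L (liftCurve v s) (FiberBundle.extend F Y (v s).proj)) =ᶠ[𝓝 t]
      fun s => vertDeriv D.lag (x s, deriv x s, f s) (vecCoord F V q q Y) := by
    filter_upwards [hb.continuousAt.eventually (vecCoord_extend_eventuallyEq (F := F) Y),
      hb.continuousAt.eventually ((isOpen_baseDomain q).mem_nhds h0)] with s hs hs'
    refine (fiberDerivVert_eq P hL (q₀ := q) (p := liftCurve v s) hs' _).trans ?_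
    rw [sumCoord_liftCurve (hv s) hs']
    exact congrArg _ hs
  have e2 : fiberDerivVert L (liftCurve v t) (nabla (FiberBundle.extend F Y) q
      (velocity E (fun s => (v s).proj) t)) = vertDeriv D.lag (x t, deriv x t, f t)
        (christoffel nabla q (x t) (deriv x t) (vecCoord F V q q Y)) := by
    refine (fiberDerivVert_eq P hL (q₀ := q) (p := liftCurve v t) h0 _).trans ?_
    rw [sumCoord_liftCurve (hv t) h0]
    refine congrArg _ ((vecCoord_nabla_extend (F := F) nabla Y _).trans ?_)
    have h3 : tanCoord E q q (velocity E (fun s => (v s).proj) t) = deriv x t :=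
      tanCoord_velocity (hb.mdifferentiableAt (by simp)) h0.1
    rw [h3]
  refine congrArg₂ (fun a b : ℝ => a - b) (e1.deriv_eq.trans (hd'.deriv.trans ?_)) e2
  exact (congrArg _ (map_zero _)).trans (add_zero _)

/-- The horizontal formula. The Christoffel terms of the connection on `TQ` in `∂L/∂q` and in
`D/dt ∂L/∂q̇` cancel by symmetry, those of the connection on `V` are part of `CoordLP.hor`. -/
theorem lagrangePoincareMap_hor [T2Space Q] (P : LPBundle E F V) {L : TangentSum E F V → ℝ}
    (hL : ContMDiff (𝓘(ℝ, E).prod 𝓘(ℝ, E × F)) 𝓘(ℝ, ℝ) ∞ L)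
    {v : ℝ → TotalSpace F V} (hv : ContMDiff 𝓘(ℝ, ℝ) (𝓘(ℝ, E).prod 𝓘(ℝ, F)) ∞ v) (t : ℝ)
    {nablaQ : CovariantDerivative 𝓘(ℝ, E) E (fun x : Q => TangentSpace 𝓘(ℝ, E) x)}
    (hQ : nablaQ.torsion = 0) (X : TangentSpace 𝓘(ℝ, E) (v t).proj) :
    ((lagrangePoincareMap P hL).atCurve P.nabla v t).1 X =
      horizontalDeriv nablaQ P.nabla L (liftCurve v t) X -
      dualCovDerivAlong nablaQ (fun s => (v s).proj)
        (fun s => fiberDerivVel L (liftCurve v s)) t X -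
      fiberDerivVert L (liftCurve v t)
        (P.twoForm (v t).proj (velocity E (fun s => (v s).proj) t) X) := by
  have h0 := mem_baseDomain_self (E := E) (F := F) (V := V) (v t).proj
  have hb := contMDiffAt_base (hv t)
  have hj := jetCoord_jetLift P.nabla (hv t) h0
  have hc := sumCoord_liftCurve (hv t) h0
  have hvel : tanCoord E (v t).proj (v t).proj (velocity E (fun s => (v s).proj) t) =
      deriv (fun s => chartAt E (v t).proj (v s).proj) t :=
    tanCoord_velocity (hb.mdifferentiableAt (by simp)) h0.1
  have e0 : ((lagrangePoincareMap P hL).atCurve P.nabla v t).1 X =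
      (coordLP P L (v t).proj).hor (jetCoord P.nabla (v t).proj (jetLift P.nabla v t))
        (tanCoord E (v t).proj (v t).proj X) := rfl
  have e1 := horizontalDeriv_eq P hL nablaQ P.nabla (liftCurve v t) X
  have e2 := dualCovDerivAlong_fiberDerivVel P hL nablaQ hv t X
  have e3 := fiberDerivVert_eq P hL (q₀ := (v t).proj) (p := liftCurve v t) h0
    (P.twoForm (v t).proj (velocity E (fun s => (v s).proj) t) X)
  have e4 := coord_twoForm P L h0 (velocity E (fun s => (v s).proj) t) X
  have e5 := christoffel_symm hQ (velocity E (fun s => (v s).proj) t) X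
  rw [hvel] at e4 e5
  change horizontalDeriv nablaQ P.nabla L (liftCurve v t) X =
    baseDeriv (coordLP P L (v t).proj).lag (sumCoord (v t).proj (liftCurve v t)) _ -
      velDeriv (coordLP P L (v t).proj).lag (sumCoord (v t).proj (liftCurve v t))
        (christoffel nablaQ (v t).proj (sumCoord (v t).proj (liftCurve (E := E) v t)).1 _
          (sumCoord (v t).proj (liftCurve (E := E) v t)).2.1) -
      vertDeriv (coordLP P L (v t).proj).lag (sumCoord (v t).proj (liftCurve v t))
        (christoffel P.nabla (v t).proj (sumCoord (v t).proj (liftCurve (E := E) v t)).1 _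
          (sumCoord (v t).proj (liftCurve (E := E) v t)).2.2) at e1
  rw [hc] at e1
  have e3' := e3.trans (congrArg (vertDeriv (coordLP P L (v t).proj).lag _) e4)
  have hc' : sumCoord (v t).proj (liftCurve (E := E) v t) = _ := hc
  rw [hc'] at e3'
  refine Eq.trans ?_ (congrArg₂ _ (congrArg₂ _ e1 e2) e3').symm
  rw [e0, hj]
  simp only [CoordLP.hor, sub_apply, ContinuousLinearMap.comp_apply,
    ContinuousLinearMap.flip_apply]
  have e6 : christoffel nablaQ (v t).proj (chartAt E (v t).proj (v t).proj)
      (deriv (fun s => chartAt E (v t).proj (v s).proj) t)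
        (tanCoord E (v t).proj (v t).proj X) =
      christoffel nablaQ (v t).proj (chartAt E (v t).proj (v t).proj)
        (tanCoord E (v t).proj (v t).proj X)
        (deriv (fun s => chartAt E (v t).proj (v s).proj) t) := e5
  simp only [e6]
  -- In `key`, `e` is the Christoffel term of the connection on the tangent bundle.
  have key : ∀ a b c d e : ℝ, a - b - c - d = (a - e - c) - (b - e) - d := by intros; ring
  exact key _ _ _ _ _

theorem lagrangePoincareMap_ver [T2Space Q] (P : LPBundle E F V) {L : TangentSum E F V → ℝ}
    (hL : ContMDiff (𝓘(ℝ, E).prod 𝓘(ℝ, E × F)) 𝓘(ℝ, ℝ) ∞ L)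
    {v : ℝ → TotalSpace F V} (hv : ContMDiff 𝓘(ℝ, ℝ) (𝓘(ℝ, E).prod 𝓘(ℝ, F)) ∞ v) (t : ℝ)
    (Y : V (v t).proj) :
    ((lagrangePoincareMap P hL).atCurve P.nabla v t).2 Y =
      fiberDerivVert L (liftCurve v t) (P.bracket (v t).proj (v t).2 Y) -
      dualCovDerivAlong P.nabla (fun s => (v s).proj)
        (fun s => fiberDerivVert L (liftCurve v s)) t Y := by
  have h0 := mem_baseDomain_self (E := E) (F := F) (V := V) (v t).proj
  have hj := jetCoord_jetLift P.nabla (hv t) h0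
  have hc := sumCoord_liftCurve (hv t) h0
  have hft : vecCoord F V (v t).proj (v t).proj (v t).2 = (vecTriv F V (v t).proj (v t)).2 :=
    (vecTriv F V (v t).proj).continuousLinearMapAt_apply_of_mem (R := ℝ) h0.2 _
  have e0 : ((lagrangePoincareMap P hL).atCurve P.nabla v t).2 Y =
      (coordLP P L (v t).proj).ver (jetCoord P.nabla (v t).proj (jetLift P.nabla v t))
        (vecCoord F V (v t).proj (v t).proj Y) := rfl
  have e2 := dualCovDerivAlong_fiberDerivVert P hL P.nabla hv t Y
  have e3 := fiberDerivVert_eq P hL (q₀ := (v t).proj) (p := liftCurve v t) h0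
    (P.bracket (v t).proj (v t).2 Y)
  have e4 := coord_bracket P L h0 (v t).2 Y
  rw [hft] at e4
  have e3' := e3.trans (congrArg (vertDeriv (coordLP P L (v t).proj).lag _) e4)
  rw [hc] at e3'
  refine Eq.trans ?_ (congrArg₂ _ e3' e2).symm
  rw [e0, hj]
  simp only [CoordLP.ver, sub_apply, add_apply, ContinuousLinearMap.comp_apply]
  have hconn : (coordLP P L (v t).proj).conn = christoffel P.nabla (v t).proj := rfl
  rw [hconn]
  ring

end Formulas

end

theorem mainTheorem4 {E : Type*} [NormedAddCommGroup E] [NormedSpace ℝ E] [FiniteDimensional ℝ E]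
    {F : Type*} [NormedAddCommGroup F] [NormedSpace ℝ F] [FiniteDimensional ℝ F]
    {Q : Type*} [TopologicalSpace Q] [T2Space Q] [SecondCountableTopology Q]
    [ChartedSpace E Q] [IsManifold 𝓘(ℝ, E) ∞ Q]
    {V : Q → Type*} [TopologicalSpace (TotalSpace F V)]
    [∀ x, AddCommGroup (V x)] [∀ x, Module ℝ (V x)] [∀ x, TopologicalSpace (V x)]
    [∀ x, IsTopologicalAddGroup (V x)] [∀ x, ContinuousSMul ℝ (V x)]
    [FiberBundle F V] [VectorBundle ℝ F V] [ContMDiffVectorBundle ∞ F V 𝓘(ℝ, E)]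
    (P : LPBundle E F V) (L : TangentSum E F V → ℝ)
    (hL : ContMDiff (𝓘(ℝ, E).prod 𝓘(ℝ, E × F)) 𝓘(ℝ, ℝ) ∞ L)
    (t₀ t₁ : ℝ) (ht : t₀ < t₁) :
    ∃ A : SecondOrderBundleMap E F V,
      RepresentsFirstVariation P L t₀ t₁ A ∧
      (∀ B : SecondOrderBundleMap E F V, RepresentsFirstVariation P L t₀ t₁ B → B = A) ∧
      (∀ v : ℝ → TotalSpace F V, ContMDiff 𝓘(ℝ, ℝ) (𝓘(ℝ, E).prod 𝓘(ℝ, F)) ∞ v → ∀ t : ℝ,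
        (∀ nablaQ : CovariantDerivative 𝓘(ℝ, E) E (fun x : Q => TangentSpace 𝓘(ℝ, E) x),
          CovariantDerivative.ContMDiffCovariantDerivative nablaQ ∞ → nablaQ.torsion = 0 →
          ∀ X : TangentSpace 𝓘(ℝ, E) (v t).proj,
            (A.atCurve P.nabla v t).1 X =
              horizontalDeriv nablaQ P.nabla L (liftCurve v t) X -
              dualCovDerivAlong nablaQ (fun s => (v s).proj)
                (fun s => fiberDerivVel L (liftCurve v s)) t X -
              fiberDerivVert L (liftCurve v t)
                (P.twoForm (v t).proj (velocity E (fun s => (v s).proj) t) X)) ∧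
        ∀ Y : V (v t).proj,
          (A.atCurve P.nabla v t).2 Y =
            fiberDerivVert L (liftCurve v t) (P.bracket (v t).proj (v t).2 Y) -
            dualCovDerivAlong P.nabla (fun s => (v s).proj)
              (fun s => fiberDerivVert L (liftCurve v s)) t Y) := by
  exact ⟨lagrangePoincareMap P hL, lagrangePoincareMap_representsFirstVariation P hL ht,
    fun _ hB => RepresentsFirstVariation.unique P hL ht
      (lagrangePoincareMap_representsFirstVariation P hL ht) hB,
    fun _ hv t => ⟨fun _ _ hQ X => lagrangePoincareMap_hor P hL hv t hQ X,
      fun Y => lagrangePoincareMap_ver P hL hv t Y⟩⟩
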